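/- **Theorem (Hedging dualities, single model).** *Market.* Let $T\ge 0$ be an integer, $\mathbb T=\{0,\dots,T\}$, and let $(\Omega,\mathcal F,\mathbb F=(\mathcal F_t)_{t\in\mathbb T},P)$ be a filtered probability space with $\mathcal F$ separable, meaning that $\mathcal F$ with the pseudometric $P(A\triangle B)$ is separable (this holds if $\mathcal F$ is countably generated). Let $S=(S_t)_{t\in\mathbb T}$ be an $\mathbb F$-adapted process in $\mathbb R^d$; $f=(f^1,\dots,f^L)$ bounded $\mathcal F_T$-measurable random variables; $g^1,\dots,g^M$, $h^1,\dots,h^N$ and $\phi$ bounded real $\mathbb F$-adapted processes indexed by $\mathbb T$. At time $0$ each $f^i$ and $g^j$ can only be bought, at the prices $\alpha^i$ and $\beta^j$, and each $h^k$ can only be sold, at the price $\gamma^k$ ($\alpha\in\mathbb R^L$, $\beta\in\mathbb R^M$, $\gamma\in\mathbb R^N$). *Enlarged space.* For $n\in\{N,N+1\}$ let $\overline\Omega^n=\Omega\times\mathbb T^n$, with elements $\overline\omega=(\omega,t^1,\dots,t^n)$, and let $$\overline{\mathcal F}^n_t=\sigma\big(A\times\mathbb T^n,\ \{\overline\omega: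 t^k\le s\}\ :\ A\in\mathcal F_t,\ 0\le s\le t,\ 1\le k\le n\big),\qquad \overline{\mathbb F}^n=(\overline{\mathcal F}^n_t)_{t\in\mathbb T}.$$ Let $P^n$ be any probability measure on $\mathbb T^n$ charging every point, and let $\overline P^n=P\otimes P^n$, regarded as a measure on $\overline{\mathcal F}^n_T$. Write $\overline{\mathbb M}^n=(\overline\Omega^n,\overline{\mathcal F}^n_T,\overline{\mathbb F}^n,\overline P^n)$. The objects $S,f^i,g^j$ (and $\phi$, when $n=N$) are extended to $\overline\Omega^n$ as functions of $\omega$ only, with extensions $\overline S^n$, $\overline{f^i}^n$, $\overline{g^j}^n$, $\overline\phi^N$. Put $\overline{h^k}^n(\overline\omega)=h^k_{t^k}(\omega)$ for $1\le k\le N$ and, when $n=N+1$, $\overline\phi^{N+1}(\overline\omega)=\phi_{t^{N+1}}(\omega)$. *Strategies.* Let $\overline{\mathcal L}^n$ be the set of $\overline{\mathbb F}^n$-adapted processes $\eta\ge 0$ with $\sum_{t=0}^T\eta_t=1$, and for a process $\psi$ put $\eta(\psi)=\sum_{t=0}^T\psi_t\eta_t$. Let $\overline{\mathcal A}^n$ be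 the set of $(H,a,b,\mu,c)$ with $H$ an $\overline{\mathbb F}^n$-adapted $\mathbb R^d$-valued process, $(a,b,c)\in\mathbb R_+^L\times\mathbb R_+^M\times\mathbb R_+^N$ and $\mu\in(\overline{\mathcal L}^n)^M$. The payoff is $$\overline\Phi^n_{\alpha,\beta,\gamma}(H,a,b,\mu,c)=\sum_{t=0}^{T-1}H_t\cdot(\overline S^n_{t+1}-\overline S^n_t)+\sum_{i=1}^L a^i(\overline{f^i}^n-\alpha^i)+\sum_{j=1}^M b^j\big(\mu^j(\overline{g^j}^n)-\beta^j\big)-\sum_{k=1}^N c^k(\overline{h^k}^n-\gamma^k).$$ *Arbitrage.* No arbitrage (NA) holds in $\overline{\mathbb M}^n$ with respect to $\alpha,\beta,\gamma$ if, for every element of $\overline{\mathcal A}^n$, $\overline\Phi^n_{\alpha,\beta,\gamma}\ge 0$ $\overline P^n$-a.s. implies $\overline\Phi^n_{\alpha,\beta,\gamma}=0$ $\overline P^n$-a.s. Strict no arbitrage (SNA) holds in $\overline{\mathbb M}^n$ if for some $\varepsilon>0$ NA holds in $\overline{\mathbb M}^n$ with respect to the prices $\alpha^i-\varepsilon$,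 $\beta^j-\varepsilon$, $\gamma^k+\varepsilon$. *Pricing measures.* Let $\overline{\mathcal T}^n$ be the set of $\mathbb T$-valued $\overline{\mathbb F}^n$-stopping times, and let $\overline{\mathcal Q}^n$ be the set of probability measures $Q$ on $\overline{\mathcal F}^n_T$ equivalent to $\overline P^n$ such that $\overline S^n$ is a $(Q,\overline{\mathbb F}^n)$-martingale, $E_Q[\overline{f^i}^n]<\alpha^i$ for all $i$, $E_Q[\overline{h^k}^n]>\gamma^k$ for all $k$, and $\sup_{\tau\in\overline{\mathcal T}^n}E_Q[\overline{g^j}^n_\tau]<\beta^j$ for all $j$. *Hedging prices.* $$\underline\pi(\phi)=\sup\{x\in\mathbb R:\ \exists\,(H,a,b,\mu,c)\in\overline{\mathcal A}^N,\ \eta\in\overline{\mathcal L}^N\ \text{with}\ \overline\Phi^N_{\alpha,\beta,\gamma}(H,a,b,\mu,c)+\eta(\overline\phi^N)\ge x\ \ \overline P^N\text{-a.s.}\},$$ $$\overline\pi(\phi)=\inf\{x\in\mathbb R:\ \exists\,(H,a,b,\mu,c)\in\overline{\mathcal A}^{N+1}\ \text{with}\ x+\overline\Phi^{N+1}_{\alpha,\beta,\gamma}(H,a,b,\mu,c)\ge\overline\phi^{N+1}\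 \ \overline P^{N+1}\text{-a.s.}\}.$$ *Claim.* Suppose that SNA holds in $\overline{\mathbb M}^N$. Then SNA also holds in $\overline{\mathbb M}^{N+1}$, and $$\underline\pi(\phi)=\inf_{Q\in\overline{\mathcal Q}^N}\ \sup_{\tau\in\overline{\mathcal T}^N}E_Q\big[\overline\phi^N_\tau\big],\qquad \overline\pi(\phi)=\sup_{Q\in\overline{\mathcal Q}^{N+1}}E_Q\big[\overline\phi^{N+1}\big].$$ Moreover both prices are finite, and optimal strategies exist: there are $(H,a,b,\mu,c)\in\overline{\mathcal A}^N$ and $\eta\in\overline{\mathcal L}^N$ with $\overline\Phi^N_{\alpha,\beta,\gamma}(H,a,b,\mu,c)+\eta(\overline\phi^N)\ge\underline\pi(\phi)$ $\overline P^N$-a.s., and there is $(H,a,b,\mu,c)\in\overline{\mathcal A}^{N+1}$ with $\overline\pi(\phi)+\overline\Phi^{N+1}_{\alpha,\beta,\gamma}(H,a,b,\mu,c)\ge\overline\phi^{N+1}$ $\overline P^{N+1}$-a.s. -/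

import Mathlib

open MeasureTheory

noncomputable section

namespace SemiStatic

/-- The enlarged sample space `Ω × 𝕋ⁿ` with `𝕋 = {0, …, T}`; the second component records the
exercise times of `n` shorted American options. -/
abbrev Enlarged (Ω : Type*) (T n : ℕ) : Type _ := Ω × (Fin n → Fin (T + 1))

variable {Ω : Type*} {mΩ : MeasurableSpace Ω} {T d L M N n : ℕ}

/-- The enlarged σ-algebra at time `t`, generated by the sets `A × 𝕋ⁿ` with `A ∈ 𝓕 t` and by the
events `{θᵏ ≤ s}` with `s ≤ t`, where `θᵏ (ω, t¹, …, tⁿ) = tᵏ`. -/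
@[reducible] def enlargedSigma (𝓕 : Filtration (Fin (T + 1)) mΩ) (n : ℕ) (t : Fin (T + 1)) :
    MeasurableSpace (Enlarged Ω T n) :=
  MeasurableSpace.comap Prod.fst (𝓕 t) ⊔
    MeasurableSpace.generateFrom
      {A | ∃ k : Fin n, ∃ s : Fin (T + 1), s ≤ t ∧ A = {w : Enlarged Ω T n | w.2 k ≤ s}}

/-- The terminal enlarged σ-algebra. -/
abbrev terminalSigma (𝓕 : Filtration (Fin (T + 1)) mΩ) (n : ℕ) :
    MeasurableSpace (Enlarged Ω T n) :=
  enlargedSigma 𝓕 n (Fin.last T)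

theorem enlargedSigma_mono (𝓕 : Filtration (Fin (T + 1)) mΩ) (n : ℕ) :
    Monotone (enlargedSigma 𝓕 n) := by
  intro s t hst
  refine sup_le_sup (MeasurableSpace.comap_mono (𝓕.mono hst)) ?_
  refine MeasurableSpace.generateFrom_mono ?_
  rintro A ⟨k, r, hr, rfl⟩
  exact ⟨k, r, hr.trans hst, rfl⟩

theorem enlargedSigma_le_prod (𝓕 : Filtration (Fin (T + 1)) mΩ) (n : ℕ) (t : Fin (T + 1)) :
    enlargedSigma 𝓕 n t ≤ (inferInstance : MeasurableSpace (Enlarged Ω T n)) := by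
  refine sup_le ?_ (MeasurableSpace.generateFrom_le ?_)
  · exact (MeasurableSpace.comap_mono (𝓕.le t)).trans measurable_fst.comap_le
  · rintro A ⟨k, s, -, rfl⟩
    have h : Measurable fun w : Enlarged Ω T n => w.2 k :=
      (measurable_pi_apply k).comp measurable_snd
    exact h (MeasurableSet.of_discrete (s := Set.Iic s))

/-- The enlarged filtration, on the measurable space `(Ω × 𝕋ⁿ, terminalSigma 𝓕 n)`. -/
def enlargedFiltration (𝓕 : Filtration (Fin (T + 1)) mΩ) (n : ℕ) :
    Filtration (Fin (T + 1)) (terminalSigma 𝓕 n) where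
  seq := enlargedSigma 𝓕 n
  mono' := enlargedSigma_mono 𝓕 n
  le' := fun t => enlargedSigma_mono 𝓕 n (Fin.le_last t)

/-- The reference measure `P ⊗ Pₙ`, as a measure on the terminal enlarged σ-algebra. -/
def refMeasure (𝓕 : Filtration (Fin (T + 1)) mΩ) (P : Measure Ω)
    (Pn : Measure (Fin n → Fin (T + 1))) : Measure[terminalSigma 𝓕 n] (Enlarged Ω T n) :=
  (P.prod Pn).trim (enlargedSigma_le_prod 𝓕 n (Fin.last T))

/-- The traded assets: a stock price process `S` in `ℝᵈ`, European options `f` (only bought),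
American options `g` (only bought) and American options `h` (only sold). -/
structure Market (𝓕 : Filtration (Fin (T + 1)) mΩ) (d L M N : ℕ) where
  S : Fin (T + 1) → Ω → (Fin d → ℝ)
  f : Fin L → Ω → ℝ
  g : Fin M → Fin (T + 1) → Ω → ℝ
  h : Fin N → Fin (T + 1) → Ω → ℝ
  adapted_S : Adapted 𝓕 S
  measurable_f : ∀ i, Measurable[𝓕 (Fin.last T)] (f i)
  adapted_g : ∀ j, Adapted 𝓕 (g j)
  adapted_h : ∀ k, Adapted 𝓕 (h k)
  bounded_f : ∃ C : ℝ, ∀ i ω, |f i ω| ≤ C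
  bounded_g : ∃ C : ℝ, ∀ j t ω, |g j t ω| ≤ C
  bounded_h : ∃ C : ℝ, ∀ k t ω, |h k t ω| ≤ C

/-- Prices at time `0` of the options `f`, `g`, `h`. -/
structure Prices (L M N : ℕ) where
  α : Fin L → ℝ
  β : Fin M → ℝ
  γ : Fin N → ℝ

/-- The prices `α - ε`, `β - ε`, `γ + ε`. -/
def Prices.shift (p : Prices L M N) (ε : ℝ) : Prices L M N where
  α := fun i => p.α i - ε
  β := fun j => p.β j - ε
  γ := fun k => p.γ k + ε

/-- Liquidating strategies for the enlarged filtration. -/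
structure IsLiquidating (𝓕 : Filtration (Fin (T + 1)) mΩ) (n : ℕ)
    (η : Fin (T + 1) → Enlarged Ω T n → ℝ) : Prop where
  adapted : Adapted (enlargedFiltration 𝓕 n) η
  nonneg : ∀ t w, 0 ≤ η t w
  sum_eq_one : ∀ w, ∑ t, η t w = 1

/-- The payoff `η(ψ) = ∑ₜ ψₜ ηₜ` of an American option `ψ` on `Ω`, extended to the enlarged space
and liquidated according to `η`. -/
def liquidate (η : Fin (T + 1) → Enlarged Ω T n → ℝ) (ψ : Fin (T + 1) → Ω → ℝ)
    (w : Enlarged Ω T n) : ℝ :=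
  ∑ t, ψ t w.1 * η t w

/-- Semi-static trading strategies `(H, a, b, μ, c)` in the enlarged space. -/
structure Strategy (𝓕 : Filtration (Fin (T + 1)) mΩ) (d L M N n : ℕ) where
  H : Fin (T + 1) → Enlarged Ω T n → (Fin d → ℝ)
  a : Fin L → ℝ
  b : Fin M → ℝ
  μ : Fin M → Fin (T + 1) → Enlarged Ω T n → ℝ
  c : Fin N → ℝ
  adapted_H : Adapted (enlargedFiltration 𝓕 n) H
  a_nonneg : ∀ i, 0 ≤ a i
  b_nonneg : ∀ j, 0 ≤ b j
  liquidating_μ : ∀ j, IsLiquidating 𝓕 n (μ j)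
  c_nonneg : ∀ k, 0 ≤ c k

/-- The gain `H · S = ∑_{t < T} Hₜ (S_{t+1} - Sₜ)` from trading the stocks. -/
def gain (H : Fin (T + 1) → Enlarged Ω T n → (Fin d → ℝ)) (S : Fin (T + 1) → Ω → (Fin d → ℝ))
    (w : Enlarged Ω T n) : ℝ :=
  ∑ t : Fin T, H t.castSucc w ⬝ᵥ (S t.succ w.1 - S t.castSucc w.1)

variable {𝓕 : Filtration (Fin (T + 1)) mΩ}

/-- The extension `(ω, t¹, …, tⁿ) ↦ hᵏ_{tᵏ}(ω)` of the shorted American option `hᵏ`, `k ≤ N ≤ n`. -/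
def Market.hExt (m : Market 𝓕 d L M N) (hn : N ≤ n) (k : Fin N) (w : Enlarged Ω T n) : ℝ :=
  m.h k (w.2 (Fin.castLE hn k)) w.1

/-- The payoff of a semi-static trading strategy with respect to given prices. -/
def payoff (m : Market 𝓕 d L M N) (p : Prices L M N) (hn : N ≤ n)
    (s : Strategy 𝓕 d L M N n) (w : Enlarged Ω T n) : ℝ :=
  gain s.H m.S w + ∑ i, s.a i * (m.f i w.1 - p.α i)
    + ∑ j, s.b j * (liquidate (s.μ j) (m.g j) w - p.β j)
    - ∑ k, s.c k * (m.hExt hn k w - p.γ k)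

/-- No arbitrage in the enlarged space with reference measure `P ⊗ Pₙ`. -/
def NoArbitrage (m : Market 𝓕 d L M N) (p : Prices L M N) (hn : N ≤ n) (P : Measure Ω)
    (Pn : Measure (Fin n → Fin (T + 1))) : Prop :=
  ∀ s : Strategy 𝓕 d L M N n,
    (∀ᵐ w ∂(refMeasure 𝓕 P Pn), 0 ≤ payoff m p hn s w) →
      ∀ᵐ w ∂(refMeasure 𝓕 P Pn), payoff m p hn s w = 0

/-- Strict no arbitrage: no arbitrage still holds for slightly more favourable prices. -/
def StrictNoArbitrage (m : Market 𝓕 d L M N) (p : Prices L M N) (hn : N ≤ n) (P : Measure Ω)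
    (Pn : Measure (Fin n → Fin (T + 1))) : Prop :=
  ∃ ε : ℝ, 0 < ε ∧ NoArbitrage m (p.shift ε) hn P Pn

/-- The `𝕋`-valued stopping times of the enlarged filtration. -/
def stoppingTimes (𝓕 : Filtration (Fin (T + 1)) mΩ) (n : ℕ) :
    Set (Enlarged Ω T n → Fin (T + 1)) :=
  {τ | IsStoppingTime (enlargedFiltration 𝓕 n) fun w => ((τ w : Fin (T + 1)) : WithTop (Fin (T + 1)))}

/-- `sup_τ E_Q[ψ_τ]` over the stopping times of the enlarged filtration, for an American option `ψ`
on `Ω` extended to the enlarged space. -/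
def optimalStopping (𝓕 : Filtration (Fin (T + 1)) mΩ)
    (Q : Measure[terminalSigma 𝓕 n] (Enlarged Ω T n)) (ψ : Fin (T + 1) → Ω → ℝ) : EReal :=
  ⨆ τ ∈ stoppingTimes 𝓕 n, ((∫ w, ψ (τ w) w.1 ∂Q : ℝ) : EReal)

/-- The martingale measures equivalent to `P ⊗ Pₙ` under which `f`, `g`, `h` satisfy the strict
price constraints. -/
structure IsPricingMeasure (m : Market 𝓕 d L M N) (p : Prices L M N) (hn : N ≤ n) (P : Measure Ω)
    (Pn : Measure (Fin n → Fin (T + 1)))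
    (Q : Measure[terminalSigma 𝓕 n] (Enlarged Ω T n)) : Prop where
  probability : IsProbabilityMeasure Q
  abs_cont : Q ≪ refMeasure 𝓕 P Pn
  abs_cont_symm : refMeasure 𝓕 P Pn ≪ Q
  martingale : Martingale (fun t w => m.S t w.1) (enlargedFiltration 𝓕 n) Q
  f_lt : ∀ i, ∫ w, m.f i w.1 ∂Q < p.α i
  lt_h : ∀ k, p.γ k < ∫ w, m.hExt hn k w ∂Q
  g_lt : ∀ j, optimalStopping 𝓕 Q (m.g j) < (p.β j : EReal)

/-- The strategy `s`, together with liquidating `φ` according to `η`, sub-hedges `φ` from `x`. -/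
def SubHedges (m : Market 𝓕 d L M N) (p : Prices L M N) (P : Measure Ω)
    (PN : Measure (Fin N → Fin (T + 1))) (φ : Fin (T + 1) → Ω → ℝ) (x : ℝ)
    (s : Strategy 𝓕 d L M N N) (η : Fin (T + 1) → Enlarged Ω T N → ℝ) : Prop :=
  IsLiquidating 𝓕 N η ∧
    ∀ᵐ w ∂(refMeasure 𝓕 P PN), x ≤ payoff m p le_rfl s w + liquidate η φ w

/-- The strategy `s` super-hedges `φ` from the initial capital `x`; the last exercise time is the
one chosen by the holder of `φ`. -/
def SuperHedges (m : Market 𝓕 d L M N) (p : Prices L M N) (P : Measure Ω)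
    (PN1 : Measure (Fin (N + 1) → Fin (T + 1))) (φ : Fin (T + 1) → Ω → ℝ) (x : ℝ)
    (s : Strategy 𝓕 d L M N (N + 1)) : Prop :=
  ∀ᵐ w ∂(refMeasure 𝓕 P PN1), φ (w.2 (Fin.last N)) w.1 ≤ x + payoff m p (Nat.le_add_right N 1) s w

/-- The sub-hedging price of `φ`. -/
def subHedgingPrice (m : Market 𝓕 d L M N) (p : Prices L M N) (P : Measure Ω)
    (PN : Measure (Fin N → Fin (T + 1))) (φ : Fin (T + 1) → Ω → ℝ) : EReal :=
  ⨆ x ∈ {x : ℝ | ∃ s η, SubHedges m p P PN φ x s η}, (x : EReal)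

/-- The super-hedging price of `φ`. -/
def superHedgingPrice (m : Market 𝓕 d L M N) (p : Prices L M N) (P : Measure Ω)
    (PN1 : Measure (Fin (N + 1) → Fin (T + 1))) (φ : Fin (T + 1) → Ω → ℝ) : EReal :=
  ⨅ x ∈ {x : ℝ | ∃ s, SuperHedges m p P PN1 φ x s}, (x : EReal)

end SemiStatic

end

open SemiStatic

/-! Both dualities are one statement about an extra payoff set `D'`. Call a debt `y` coverable if
some semi-static strategy plus some payoff in `D'` is at least `y` almost surely. For the
sub-hedging price `D'` consists of all liquidations `η(φ)`; for the super-hedging price it is the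
single payoff `-φ` at the last exercise time, and signs are reversed. In the enlarged space a
shorted American option has a fixed payoff, the exercise date being part of the state, so it can be
treated like a European option.

The engine is that the hedgeable claims are closed under almost sure convergence. For stock trading,
increments are adjoined one at a time, backwards in time. Where the positions in the new increment
are unbounded, dividing by them and invoking no arbitrage shows that the increment is already
replicable; elsewhere measurable random subsequences of positions converge
(`seqClosedAE_hedgeable_adjoinAsset`). Options are added through forward convex combinations of
their bounded payoffs. Strict no arbitrage says that no nonnegative payoff can involve a positive
amount of options (`StrictNoArbitrage.noFreeOptions`); by normalising the holdings, this both
excludes exploding holdings and survives a small further decrease of all option prices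
(`NoFreeOptions.exists_pos`).

A closed cone without free lunch has, by a Kreps–Yan argument in `L²`, an equivalent pricing measure
(`IsHedgingCone.exists_measure`). Dividing the density by a function that dominates the stock prices
makes them integrable, and applying the result after the price decrease gives strict price
inequalities with a uniform gap.

If `y` is not coverable, then `D'` offered at price `y` is one more option that creates no free
lunch, so some pricing measure values all of `D'` at most at `y`; this is strong duality. Were the
supremum of coverable debts not coverable, the price could be lowered slightly below it without
creating a free option, which contradicts the definition of a supremum; this is attainment
(`exists_isGreatest_coverable`). Weak duality is the nonpositive expectation of superreplicable
claims (`IsPricingMeasure.integral_nonpos`).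

Two bridges remain. Backward induction shows that liquidating strategies, which are randomised
stopping times, do not beat ordinary stopping times (`exists_stoppingTime_ge`). Strict no arbitrage
passes from `N` to `N + 1` exercise times because freezing the last one turns a strategy on the
larger space into one on the smaller (`NoArbitrage.succ`). -/

noncomputable section

namespace SemiStatic

open Filter Topology

/-! ### Closedness and pricing of claims hedged by dynamic trading. -/

section Gains

variable {X ι : Type*} {m0 : MeasurableSpace X} {μ : Measure X}

/-- The functions dominated almost everywhere by an element of `R`. -/
def hedgeable (μ : Measure X) (R : Set (X → ℝ)) : Set (X → ℝ) :=
  {v | ∃ r ∈ R, ∀ᵐ x ∂μ, v x ≤ r x}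

/-- Sequential closedness with respect to almost everywhere convergence. -/
def SeqClosedAE (μ : Measure X) (V : Set (X → ℝ)) : Prop :=
  ∀ (v : ℕ → X → ℝ) (w : X → ℝ), (∀ n, v n ∈ V) →
    (∀ᵐ x ∂μ, Tendsto (fun n => v n x) atTop (𝓝 (w x))) → w ∈ V

/-- Stability of a set of functions under addition and under multiplication by
`𝒢`-measurable functions. -/
structure IsMeasurableModule (𝒢 : MeasurableSpace X) (R : Set (X → ℝ)) : Prop where
  zero_mem : (fun _ => 0) ∈ R
  add_mem : ∀ r ∈ R, ∀ s ∈ R, (fun x => r x + s x) ∈ R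
  mul_mem : ∀ c : X → ℝ, Measurable[𝒢] c → ∀ r ∈ R, (fun x => c x * r x) ∈ R

/-- The absence of nontrivial nonnegative elements. -/
def NoFreeLunch (μ : Measure X) (R : Set (X → ℝ)) : Prop :=
  ∀ r ∈ R, (∀ᵐ x ∂μ, 0 ≤ r x) → ∀ᵐ x ∂μ, r x = 0

/-- The set `R + L⁰(𝒢) Y`. -/
def adjoinAsset (𝒢 : MeasurableSpace X) (R : Set (X → ℝ)) (Y : X → ℝ) : Set (X → ℝ) :=
  {u | ∃ r ∈ R, ∃ h : X → ℝ, Measurable[𝒢] h ∧ u = fun x => r x + h x * Y x}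

theorem measurable_random_index {𝒢 : MeasurableSpace X} {h : ℕ → X → ℝ}
    (hh : ∀ n, Measurable (h n)) {σ : X → ℕ} (hσ : Measurable σ) :
    Measurable fun x => h (σ x) x :=
  (measurable_from_prod_countable_right (f := fun p : ℕ × X => h p.1 p.2) hh).comp
    (hσ.prodMk measurable_id)

theorem subset_hedgeable (R : Set (X → ℝ)) : R ⊆ hedgeable μ R :=
  fun r hr => ⟨r, hr, .of_forall fun _ => le_rfl⟩

theorem hedgeable_mono_ae {R : Set (X → ℝ)} {u v : X → ℝ} (hv : v ∈ hedgeable μ R)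
    (h : ∀ᵐ x ∂μ, u x ≤ v x) : u ∈ hedgeable μ R := by
  obtain ⟨r, hr, hvr⟩ := hv
  exact ⟨r, hr, by filter_upwards [h, hvr] with x h1 h2 using h1.trans h2⟩

section Module

variable {𝒢 : MeasurableSpace X} {R : Set (X → ℝ)}

theorem IsMeasurableModule.hedgeable_add (hR : IsMeasurableModule 𝒢 R) {u v : X → ℝ}
    (hu : u ∈ hedgeable μ R) (hv : v ∈ hedgeable μ R) :
    (fun x => u x + v x) ∈ hedgeable μ R := by
  obtain ⟨r, hr, hur⟩ := hu
  obtain ⟨s, hs, hvs⟩ := hv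
  refine ⟨_, hR.add_mem r hr s hs, ?_⟩
  filter_upwards [hur, hvs] with x h1 h2 using add_le_add h1 h2

theorem IsMeasurableModule.hedgeable_mul (hR : IsMeasurableModule 𝒢 R) {c u : X → ℝ}
    (hc : Measurable[𝒢] c) (hc0 : ∀ x, 0 ≤ c x) (hu : u ∈ hedgeable μ R) :
    (fun x => c x * u x) ∈ hedgeable μ R := by
  obtain ⟨r, hr, hur⟩ := hu
  refine ⟨_, hR.mul_mem c hc r hr, ?_⟩
  filter_upwards [hur] with x h1 using mul_le_mul_of_nonneg_left h1 (hc0 x)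

theorem IsMeasurableModule.hedgeable_indicator (hR : IsMeasurableModule 𝒢 R) {A : Set X}
    {u : X → ℝ} (hA : MeasurableSet[𝒢] A) (hu : u ∈ hedgeable μ R) :
    A.indicator u ∈ hedgeable μ R := by
  have h := hR.hedgeable_mul (c := A.indicator 1) ((@measurable_const ℝ X _ 𝒢 1).indicator hA)
    (fun x => Set.indicator_nonneg (fun _ _ => zero_le_one) x) hu
  convert h using 2 with x
  by_cases hx : x ∈ A <;> simp [hx]

/-- Claims may be chosen according to `𝒢`-information: finitely many pieces on `{σ = m}` are pasted
by the module structure, and closedness handles the countably many values, the truncations being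
eventually constant at each point. -/
theorem IsMeasurableModule.hedgeable_random_index (hR : IsMeasurableModule 𝒢 R)
    (hcl : SeqClosedAE μ (hedgeable μ R)) {v : ℕ → X → ℝ} (hv : ∀ n, v n ∈ hedgeable μ R)
    {σ : X → ℕ} (hσ : Measurable[𝒢] σ) : (fun x => v (σ x) x) ∈ hedgeable μ R := by
  have key : ∀ m : ℕ, {x | σ x < m}.indicator (fun x => v (σ x) x) ∈ hedgeable μ R := by
    intro m
    induction m with
    | zero => simpa using! subset_hedgeable R hR.zero_mem
    | succ m ih =>
      have hA : MeasurableSet[𝒢] {x | σ x = m} := hσ (MeasurableSet.singleton m)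
      convert hR.hedgeable_add ih (hR.hedgeable_indicator hA (hv m)) using 2 with x
      rcases lt_trichotomy (σ x) m with h | h | h
      · have : σ x < m + 1 := by omega
        simp only [Set.indicator_apply, Set.mem_ofPred_eq, this, h, h.ne, if_false, if_true, add_zero]
      · simp [h]
      · have : ¬ σ x < m + 1 := by omega
        simp only [Set.indicator_apply, Set.mem_ofPred_eq, this, h.not_gt, h.ne', if_false, add_zero]
  refine hcl _ _ key (.of_forall fun x => ?_)
  refine tendsto_const_nhds.congr' ?_
  filter_upwards [eventually_gt_atTop (σ x)] with m hm
  simp [hm]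

/-- On the set where the positions in the additional asset are unbounded above, the additional
asset is redundant. -/
theorem hedgeable_indicator_of_unbounded (h𝒢 : IsMeasurableModule 𝒢 R)
    (hcl : SeqClosedAE μ (hedgeable μ R)) {Y : X → ℝ}
    (hNA : NoFreeLunch μ (adjoinAsset 𝒢 R Y)) {u h : ℕ → X → ℝ} {w : X → ℝ}
    (hh : ∀ n, Measurable[𝒢] (h n)) (huv : ∀ n, (fun x => u n x - h n x * Y x) ∈ hedgeable μ R)
    (hu : ∀ᵐ x ∂μ, Tendsto (fun n => u n x) atTop (𝓝 (w x))) {A : Set X}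
    (hA : A = {x | ∀ k : ℕ, ∃ n, k ≤ n ∧ (k : ℝ) ≤ h n x}) (hAm : MeasurableSet[𝒢] A) :
    A.indicator w ∈ hedgeable μ R := by
  classical
  -- The alternative `x ∉ A` only makes the search terminate everywhere; off `A` it returns `0` and
  -- is cut away later.
  have hex : ∀ (k : ℕ) (x : X), ∃ n, x ∉ A ∨ (k ≤ n ∧ (k : ℝ) ≤ h n x) := by
    intro k x
    by_cases hx : x ∈ A
    · rw [hA] at hx
      obtain ⟨n, hn⟩ := hx k
      exact ⟨n, Or.inr hn⟩
    · exact ⟨0, Or.inl hx⟩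
  let σ : ℕ → X → ℕ := fun k x => Nat.find (hex k x)
  have hσ : ∀ k, Measurable[𝒢] (σ k) := by
    intro k
    refine @measurable_find X 𝒢 _ _ (hex k) fun n => ?_
    refine MeasurableSet.union hAm.compl ?_
    by_cases hkn : k ≤ n
    · simp only [hkn, true_and]
      exact hh n measurableSet_Ici
    · simp only [hkn, false_and]
      exact @MeasurableSet.const X 𝒢 False
  have hσA : ∀ k, ∀ x ∈ A, k ≤ σ k x ∧ (k : ℝ) ≤ h (σ k x) x := by
    intro k x hx
    rcases Nat.find_spec (hex k x) with h' | h'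
    · exact absurd hx h'
    · exact h'
  have hhσ : ∀ k, Measurable[𝒢] fun x => h (σ k x) x := fun k =>
    measurable_random_index hh (hσ k)
  -- On `A`, `u / h - Y` along the chosen indices tends to `-Y`, because `u` converges while `h`
  -- tends to infinity.
  have hnegY : A.indicator (fun x => -Y x) ∈ hedgeable μ R := by
    refine hcl (fun k x => A.indicator (fun x => (h (σ k x) x)⁻¹) x *
      (u (σ k x) x - h (σ k x) x * Y x)) _ (fun k => ?_) ?_
    · refine h𝒢.hedgeable_mul ((hhσ k).inv.indicator hAm) (fun x => ?_)
        (h𝒢.hedgeable_random_index hcl huv (hσ k))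
      refine Set.indicator_nonneg (fun x hx => inv_nonneg.2 ?_) x
      exact (Nat.cast_nonneg k).trans (hσA k x hx).2
    · filter_upwards [hu] with x hx
      by_cases hxA : x ∈ A
      · have hσt : Tendsto (fun k => σ k x) atTop atTop :=
          tendsto_atTop_mono (fun k => (hσA k x hxA).1) tendsto_id
        have hht : Tendsto (fun k => h (σ k x) x) atTop atTop :=
          tendsto_atTop_mono (fun k => (hσA k x hxA).2) tendsto_natCast_atTop_atTop
        have h1 := (hht.inv_tendsto_atTop.mul (hx.comp hσt)).sub
          (tendsto_const_nhds (x := Y x))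
        simp only [hxA, Set.indicator_of_mem, zero_mul, zero_sub] at h1 ⊢
        refine h1.congr' ?_
        filter_upwards [hht.eventually_gt_atTop 0] with k hk
        simp only [Pi.inv_apply, Function.comp]
        field_simp
      · simp [hxA]
  obtain ⟨r, hr, hrY⟩ := hnegY
  -- The gain `r` plus one unit of `Y` on `A` is nonnegative, so no arbitrage forces `r = -Y` on `A`
  -- and `r = 0` off `A`: exact replication.
  have hr0 := hNA (fun x => r x + A.indicator 1 x * Y x)
    ⟨r, hr, A.indicator 1, (@measurable_const ℝ X _ 𝒢 1).indicator hAm, rfl⟩ (by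
      filter_upwards [hrY] with x hx
      by_cases hxA : x ∈ A <;> simp [hxA] at hx ⊢ <;> linarith)
  refine hcl (fun n => A.indicator (u n)) _ (fun n => ?_) ?_
  · have h1 := h𝒢.hedgeable_indicator hAm (huv n)
    -- Replacing `h n * Y` by `-h n * r` needs the full module structure, since `h n` has no sign.
    have h2 := subset_hedgeable (μ := μ) R (h𝒢.mul_mem (fun x => -h n x) (hh n).neg r hr)
    refine hedgeable_mono_ae (h𝒢.hedgeable_add h1 h2) ?_
    filter_upwards [hr0] with x hx
    by_cases hxA : x ∈ A
    · simp only [hxA, Set.indicator_of_mem, Pi.one_apply, one_mul] at hx ⊢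
      have : r x = -Y x := by linarith
      rw [this]; apply le_of_eq; ring
    · simp only [hxA, not_false_eq_true, Set.indicator_of_notMem, zero_mul, add_zero] at hx ⊢
      simp [hx]
  · filter_upwards [hu] with x hx
    by_cases hxA : x ∈ A <;> simp [hxA, hx]

theorem measurableSet_unbounded {h : ℕ → X → ℝ} (hh : ∀ n, Measurable[𝒢] (h n)) :
    MeasurableSet[𝒢] {x | ∀ k : ℕ, ∃ n, k ≤ n ∧ (k : ℝ) ≤ h n x} := by
  have : {x | ∀ k : ℕ, ∃ n, k ≤ n ∧ (k : ℝ) ≤ h n x} =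
      ⋂ k : ℕ, ⋃ n : ℕ, ⋃ _ : k ≤ n, {x | (k : ℝ) ≤ h n x} := by
    ext x; simp
  rw [this]
  refine MeasurableSet.iInter fun k => MeasurableSet.iUnion fun n => MeasurableSet.iUnion fun _ => ?_
  exact hh n measurableSet_Ici

theorem exists_near_liminf {a : ℕ → ℝ} {K : ℝ} {N : ℕ} (ha : ∀ n ≥ N, |a n| ≤ K) (k : ℕ) {ε : ℝ}
    (hε : 0 < ε) : ∃ n, k ≤ n ∧ |a n - liminf a atTop| ≤ ε := by
  have hb : ∀ᶠ n in atTop, |a n| ≤ K := eventually_atTop.2 ⟨N, ha⟩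
  have hle : IsBoundedUnder (· ≤ ·) atTop a := ⟨K, by
    rw [eventually_map]; filter_upwards [hb] with n hn using (abs_le.1 hn).2⟩
  have hge : IsBoundedUnder (· ≥ ·) atTop a := ⟨-K, by
    rw [eventually_map]; filter_upwards [hb] with n hn using (abs_le.1 hn).1⟩
  have h1 : ∃ᶠ n in atTop, a n < liminf a atTop + ε :=
    frequently_lt_of_liminf_lt hle.isCoboundedUnder_flip (by linarith)
  have h2 : ∀ᶠ n in atTop, liminf a atTop - ε < a n :=
    eventually_lt_of_lt_liminf (by linarith) hge
  obtain ⟨n, h3, h4, h5⟩ := (h1.and_eventually (h2.and (eventually_ge_atTop k))).exists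
  exact ⟨n, h5, abs_le.2 ⟨by linarith, by linarith⟩⟩

theorem IsMeasurableModule.adjoinAsset (h𝒢 : IsMeasurableModule 𝒢 R) (Y : X → ℝ) :
    IsMeasurableModule 𝒢 (adjoinAsset 𝒢 R Y) where
  zero_mem := ⟨_, h𝒢.zero_mem, fun _ => 0, @measurable_const _ _ _ 𝒢 0, by simp⟩
  add_mem := by
    rintro _ ⟨r, hr, h, hh, rfl⟩ _ ⟨s, hs, k, hk, rfl⟩
    exact ⟨_, h𝒢.add_mem r hr s hs, _, hh.add hk, by ext x; simp; ring⟩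
  mul_mem := by
    rintro c hc _ ⟨r, hr, h, hh, rfl⟩
    exact ⟨_, h𝒢.mul_mem c hc r hr, _, hc.mul hh, by ext x; simp; ring⟩

theorem subset_adjoinAsset (Y : X → ℝ) : R ⊆ adjoinAsset 𝒢 R Y :=
  fun r hr => ⟨r, hr, fun _ => 0, @measurable_const _ _ _ 𝒢 0, by simp⟩

theorem hedgeable_mono {R' : Set (X → ℝ)} (h : R ⊆ R') : hedgeable μ R ⊆ hedgeable μ R' :=
  fun _ ⟨r, hr, hv⟩ => ⟨r, h hr, hv⟩

/-- Closedness of the hedgeable claims is preserved by adjoining one asset. -/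
theorem seqClosedAE_hedgeable_adjoinAsset (h𝒢 : IsMeasurableModule 𝒢 R)
    (hcl : SeqClosedAE μ (hedgeable μ R)) {Y : X → ℝ}
    (hNA : NoFreeLunch μ (adjoinAsset 𝒢 R Y)) :
    SeqClosedAE μ (hedgeable μ (adjoinAsset 𝒢 R Y)) := by
  classical
  intro u w hu huw
  have hdec : ∀ n, ∃ h : X → ℝ, Measurable[𝒢] h ∧
      (fun x => u n x - h x * Y x) ∈ hedgeable μ R := by
    intro n
    obtain ⟨_, ⟨r, hr, h, hh, rfl⟩, hle⟩ := hu n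
    exact ⟨h, hh, r, hr, by filter_upwards [hle] with x hx using by linarith⟩
  choose h hh huv using hdec
  set A : Set X := {x | ∀ k : ℕ, ∃ n, k ≤ n ∧ (k : ℝ) ≤ h n x} with hA
  set B : Set X := {x | ∀ k : ℕ, ∃ n, k ≤ n ∧ (k : ℝ) ≤ -h n x} with hB
  have hAm : MeasurableSet[𝒢] A := measurableSet_unbounded hh
  have hBm : MeasurableSet[𝒢] B := measurableSet_unbounded fun n => (hh n).neg
  have hAw : A.indicator w ∈ hedgeable μ R :=
    hedgeable_indicator_of_unbounded h𝒢 hcl hNA hh huv huw hA hAm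
  have hBw : B.indicator w ∈ hedgeable μ R := by
    refine hedgeable_indicator_of_unbounded h𝒢 hcl (Y := fun x => -Y x) ?_
      (h := fun n x => -h n x) (fun n => (hh n).neg) (by simpa using huv) huw hB hBm
    rintro _ ⟨r, hr, k, hk, rfl⟩
    exact hNA _ ⟨r, hr, fun x => -k x, hk.neg, by simp⟩
  set D : Set X := (A ∪ B)ᶜ with hD
  have hDm : MeasurableSet[𝒢] D := (hAm.union hBm).compl
  -- On `D` the positions are eventually bounded, so this is a genuine cluster point; its value off
  -- `D` is discarded.
  let g : X → ℝ := fun x => liminf (fun n => h n x) atTop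
  have hg : Measurable[𝒢] g := @Measurable.liminf ℝ X _ _ _ 𝒢 _ _ _ _ hh
  have hbdd : ∀ x ∈ D, ∃ (K : ℝ) (N : ℕ), ∀ n ≥ N, |h n x| ≤ K := by
    intro x hx
    simp only [hD, hA, hB, Set.mem_compl_iff, Set.mem_union, Set.mem_ofPred_eq, not_or, not_forall,
      not_exists, not_and, not_le] at hx
    obtain ⟨⟨k, hk⟩, ⟨l, hl⟩⟩ := hx
    refine ⟨max k l, max k l, fun n hn => abs_le.2 ⟨?_, ?_⟩⟩
    · have := hl n ((le_max_right _ _).trans hn)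
      have := le_max_right (k : ℝ) l
      linarith
    · have := hk n ((le_max_left _ _).trans hn)
      have := le_max_left (k : ℝ) l
      linarith
  have hex : ∀ (k : ℕ) (x : X), ∃ n, x ∉ D ∨ (k ≤ n ∧ |h n x - g x| ≤ 1 / ((k : ℝ) + 1)) := by
    intro k x
    by_cases hx : x ∈ D
    · obtain ⟨K, N, hK⟩ := hbdd x hx
      obtain ⟨n, hn⟩ := exists_near_liminf hK k (ε := 1 / ((k : ℝ) + 1)) (by positivity)
      exact ⟨n, Or.inr hn⟩
    · exact ⟨0, Or.inl hx⟩
  let σ : ℕ → X → ℕ := fun k x => Nat.find (hex k x)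
  have hσ : ∀ k, Measurable[𝒢] (σ k) := by
    intro k
    refine @measurable_find X 𝒢 _ _ (hex k) fun n => ?_
    refine MeasurableSet.union hDm.compl ?_
    by_cases hkn : k ≤ n
    · simp only [hkn, true_and]
      exact measurable_abs.comp ((hh n).sub hg) measurableSet_Iic
    · simp only [hkn, false_and]
      exact @MeasurableSet.const X 𝒢 False
  have hσD : ∀ k, ∀ x ∈ D, k ≤ σ k x ∧ |h (σ k x) x - g x| ≤ 1 / ((k : ℝ) + 1) := by
    intro k x hx
    rcases Nat.find_spec (hex k x) with h' | h'
    · exact absurd hx h'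
    · exact h'
  have hDw : D.indicator (fun x => w x - g x * Y x) ∈ hedgeable μ R := by
    refine hcl (fun k => D.indicator fun x => u (σ k x) x - h (σ k x) x * Y x) _
      (fun k => h𝒢.hedgeable_indicator hDm (h𝒢.hedgeable_random_index hcl huv (hσ k))) ?_
    filter_upwards [huw] with x hx
    by_cases hxD : x ∈ D
    · have hσt : Tendsto (fun k => σ k x) atTop atTop :=
        tendsto_atTop_mono (fun k => (hσD k x hxD).1) tendsto_id
      have hht : Tendsto (fun k => h (σ k x) x) atTop (𝓝 (g x)) := by
        rw [tendsto_iff_dist_tendsto_zero]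
        refine squeeze_zero (fun _ => dist_nonneg) (fun k => ?_) tendsto_one_div_add_atTop_nhds_zero_nat
        rw [Real.dist_eq]; exact (hσD k x hxD).2
      simp only [hxD, Set.indicator_of_mem]
      exact (hx.comp hσt).sub (hht.mul_const _)
    · simp [hxD]
  have hR' := h𝒢.adjoinAsset Y
  have hsub := hedgeable_mono (μ := μ) (subset_adjoinAsset (𝒢 := 𝒢) (R := R) Y)
  have hgY : (fun x => D.indicator g x * Y x) ∈ hedgeable μ (adjoinAsset 𝒢 R Y) :=
    subset_hedgeable _ ⟨_, h𝒢.zero_mem, D.indicator g, hg.indicator hDm, by simp⟩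
  -- The pieces live on `D`, `A` and `B \ A`; the last cut avoids counting `A ∩ B` twice.
  have hsum := hR'.hedgeable_add (hR'.hedgeable_add (hsub hDw) hgY)
    (hR'.hedgeable_add (hsub hAw) (hsub (h𝒢.hedgeable_indicator hAm.compl hBw)))
  refine hedgeable_mono_ae hsum (.of_forall fun x => le_of_eq ?_)
  by_cases hxA : x ∈ A
  · have : x ∉ D := fun h => h (Or.inl hxA)
    simp [hxA, this]
  · by_cases hxB : x ∈ B
    · have : x ∉ D := fun h => h (Or.inr hxB)
      simp [hxA, hxB, this]
    · have : x ∈ D := by simp [hD, hxA, hxB]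
      simp [hxA, hxB, this]

end Module

/-- The gains from trading the increments `Y p`, `p ∈ s`, in `𝒢 p`-measurable amounts. -/
def gainSpace (𝒢 : ι → MeasurableSpace X) (Y : ι → X → ℝ) (s : Finset ι) : Set (X → ℝ) :=
  {r | ∃ h : ι → X → ℝ, (∀ p, Measurable[𝒢 p] (h p)) ∧ r = fun x => ∑ p ∈ s, h p x * Y p x}

variable {𝒢 : ι → MeasurableSpace X} {Y : ι → X → ℝ}

theorem isMeasurableModule_gainSpace {𝒢₀ : MeasurableSpace X} (s : Finset ι)
    (h : ∀ p ∈ s, 𝒢₀ ≤ 𝒢 p) : IsMeasurableModule 𝒢₀ (gainSpace 𝒢 Y s) := by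
  classical
  refine ⟨⟨fun _ _ => 0, fun p => @measurable_const _ _ _ (𝒢 p) 0, by simp⟩, ?_, ?_⟩
  · rintro _ ⟨a, ha, rfl⟩ _ ⟨b, hb, rfl⟩
    exact ⟨_, fun p => (ha p).add (hb p), by
      ext x; simp only [Pi.add_apply, add_mul, Finset.sum_add_distrib]⟩
  · rintro c hc _ ⟨a, ha, rfl⟩
    refine ⟨fun p x => if p ∈ s then c x * a p x else 0, fun p => ?_, ?_⟩
    · by_cases hp : p ∈ s
      · simp only [hp, if_true]
        exact (hc.mono (h p hp) le_rfl).mul (ha p)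
      · simp only [hp, if_false]
        exact @measurable_const _ _ _ (𝒢 p) 0
    · ext x
      rw [Finset.mul_sum]
      exact Finset.sum_congr rfl fun p hp => by simp [hp, mul_assoc]

theorem gainSpace_insert [DecidableEq ι] {a : ι} {s : Finset ι} (ha : a ∉ s) :
    gainSpace 𝒢 Y (insert a s) = adjoinAsset (𝒢 a) (gainSpace 𝒢 Y s) (Y a) := by
  ext u
  constructor
  · rintro ⟨h, hh, rfl⟩
    exact ⟨_, ⟨h, hh, rfl⟩, h a, hh a, by ext x; rw [Finset.sum_insert ha, add_comm]⟩
  · rintro ⟨_, ⟨h, hh, rfl⟩, k, hk, rfl⟩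
    refine ⟨Function.update h a k, fun p => ?_, ?_⟩
    · by_cases hp : p = a
      · subst hp; simpa using hk
      · simpa [hp] using hh p
    · ext x
      rw [Finset.sum_insert ha, add_comm]
      simp only [Function.update_self]
      congr 1
      refine Finset.sum_congr rfl fun p hp => ?_
      rw [Function.update_of_ne (ne_of_mem_of_not_mem hp ha)]

/-- Under no arbitrage, the claims hedgeable by dynamic trading form a closed set. -/
theorem seqClosedAE_hedgeable_gainSpace {α : Type*} [LinearOrder α] (key : ι → α)
    (hkey : ∀ p q, key p ≤ key q → 𝒢 p ≤ 𝒢 q) (s : Finset ι)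
    (hNA : NoFreeLunch μ (gainSpace 𝒢 Y s)) : SeqClosedAE μ (hedgeable μ (gainSpace 𝒢 Y s)) := by
  classical
  -- The inserted index has the smallest key, so in the application assets are adjoined backwards in
  -- time. The gains from the later ones then form a module over the σ-algebra of the new one.
  induction s using Finset.induction_on_min_value key with
  | empty =>
    intro v w hv hvw
    refine ⟨fun _ => 0, ⟨fun _ _ => 0, fun p => @measurable_const _ _ _ (𝒢 p) 0, by simp⟩, ?_⟩
    have hv' : ∀ᵐ x ∂μ, ∀ n, v n x ≤ 0 := ae_all_iff.2 fun n => by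
      obtain ⟨_, ⟨h, -, rfl⟩, hr⟩ := hv n
      simpa using hr
    filter_upwards [hv', hvw] with x h1 h2 using le_of_tendsto' h2 h1
  | insert a s ha hmin ih =>
    have hm := isMeasurableModule_gainSpace (Y := Y) s fun p hp => hkey a p (hmin p hp)
    rw [gainSpace_insert ha] at hNA ⊢
    exact seqClosedAE_hedgeable_adjoinAsset hm
      (ih fun r hr => hNA r (subset_adjoinAsset _ hr)) hNA

/-- A claim dominated by the gain of a dynamic strategy has nonpositive expectation under every
martingale measure. -/
theorem integral_nonpos_of_le_gain [IsFiniteMeasure μ] {α : Type*} [LinearOrder α] (key : ι → α)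
    (hkey : ∀ p q, key p ≤ key q → 𝒢 p ≤ 𝒢 q) (h𝒢 : ∀ p, 𝒢 p ≤ m0) (s : Finset ι)
    (hY : ∀ p, Integrable (Y p) μ)
    (hmart : ∀ p, ∀ c : X → ℝ, Measurable[𝒢 p] c → (∃ K, ∀ x, |c x| ≤ K) →
      ∫ x, c x * Y p x ∂μ = 0) :
    ∀ y : X → ℝ, Integrable y μ → y ∈ hedgeable μ (gainSpace 𝒢 Y s) → ∫ x, y x ∂μ ≤ 0 := by
  classical
  induction s using Finset.induction_on_min_value key with
  | empty =>
    rintro y hy ⟨_, ⟨h, -, rfl⟩, hr⟩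
    exact integral_nonpos_of_ae (by filter_upwards [hr] with x hx using by simpa using hx)
  | insert a s ha hmin ih =>
    intro y hy hyV
    have hm := isMeasurableModule_gainSpace (Y := Y) s fun p hp => hkey a p (hmin p hp)
    rw [gainSpace_insert ha] at hyV
    obtain ⟨_, ⟨r, hr, h, hh, rfl⟩, hle⟩ := hyV
    -- The position need not be integrable against `Y a`. On `B n` it is bounded, so its gain has
    -- mean zero, and the rest of the claim is covered by the later assets. Only `y` itself must be
    -- integrable to let `n` grow.
    let B : ℕ → Set X := fun n => {x | |h x| ≤ n}
    have hBm : ∀ n, MeasurableSet[𝒢 a] (B n) := fun n =>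
      measurable_abs.comp hh measurableSet_Iic
    have hbound : ∀ n x, |(B n).indicator h x| ≤ n := by
      intro n x
      by_cases hx : x ∈ B n
      · rw [Set.indicator_of_mem hx]; exact hx
      · simp [hx]
    have hint : ∀ n, Integrable (fun x => (B n).indicator h x * Y a x) μ := fun n =>
      (hY a).bdd_mul ((hh.indicator (hBm n)).mono (h𝒢 a) le_rfl).aestronglyMeasurable
        (.of_forall fun x => hbound n x)
    have hn : ∀ n, ∫ x in B n, y x ∂μ ≤ 0 := by
      intro n
      have h1 : ∫ x, ((B n).indicator y x - (B n).indicator h x * Y a x) ∂μ ≤ 0 := by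
        refine ih _ ((hy.indicator (h𝒢 a _ (hBm n))).sub (hint n)) ?_
        refine hedgeable_mono_ae (hm.hedgeable_indicator (hBm n) (subset_hedgeable _ hr)) ?_
        filter_upwards [hle] with x hx
        by_cases hxB : x ∈ B n
        · simp only [hxB, Set.indicator_of_mem]; linarith
        · simp [hxB]
      rw [integral_sub (hy.indicator (h𝒢 a _ (hBm n))) (hint n),
        hmart a _ (hh.indicator (hBm n)) ⟨n, hbound n⟩, sub_zero,
        integral_indicator (h𝒢 a _ (hBm n))] at h1
      exact h1
    have hmono : Monotone B := fun n k hnk x hx =>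
      le_trans (show |h x| ≤ n from hx) (show (n : ℝ) ≤ k by exact_mod_cast hnk)
    have hU : ⋃ n, B n = Set.univ := Set.eq_univ_of_forall fun x => by
      obtain ⟨n, hn⟩ := exists_nat_ge |h x|
      exact Set.mem_iUnion.2 ⟨n, hn⟩
    have ht := tendsto_setIntegral_of_monotone (fun n => h𝒢 a _ (hBm n)) hmono
      (f := y) (μ := μ) hy.integrableOn
    rw [hU, setIntegral_univ] at ht
    exact le_of_tendsto' ht hn

end Gains

/-! ### Forward convex combinations in Hilbert space and almost everywhere. -/

/-- Weights of a sequence of forward convex combinations. -/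
structure IsForwardWeights (s : ℕ → Finset ℕ) (w : ℕ → ℕ → ℝ) : Prop where
  le_of_mem : ∀ n, ∀ m ∈ s n, n ≤ m
  nonneg : ∀ n, ∀ m ∈ s n, 0 ≤ w n m
  sum_eq_one : ∀ n, ∑ m ∈ s n, w n m = 1

theorem IsForwardWeights.subseq {s : ℕ → Finset ℕ} {w : ℕ → ℕ → ℝ} (h : IsForwardWeights s w)
    {ns : ℕ → ℕ} (hns : StrictMono ns) :
    IsForwardWeights (fun n => s (ns n)) (fun n => w (ns n)) where
  le_of_mem := fun n m hm => (hns.id_le n).trans (h.le_of_mem _ m hm)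
  nonneg := fun _ => h.nonneg _
  sum_eq_one := fun _ => h.sum_eq_one _

theorem IsForwardWeights.tendsto {s : ℕ → Finset ℕ} {w : ℕ → ℕ → ℝ} (h : IsForwardWeights s w)
    {a : ℕ → ℝ} {l : ℝ} (ha : Tendsto a atTop (𝓝 l)) :
    Tendsto (fun n => ∑ m ∈ s n, w n m * a m) atTop (𝓝 l) := by
  rw [Metric.tendsto_atTop] at ha ⊢
  intro ε hε
  obtain ⟨N, hN⟩ := ha ε hε
  exact ⟨N, fun n hn => (convex_ball l ε).sum_mem (h.nonneg n) (h.sum_eq_one n)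
    fun m hm => hN m (hn.trans (h.le_of_mem n m hm))⟩

section Hilbert

variable {E : Type*} [NormedAddCommGroup E] [InnerProductSpace ℝ E]

/-- The convex combinations of the terms of a sequence with index at least `n`. -/
def forwardHull (x : ℕ → E) (n : ℕ) : Set E :=
  {y | ∃ (s : Finset ℕ) (w : ℕ → ℝ), (∀ m ∈ s, n ≤ m) ∧ (∀ m ∈ s, 0 ≤ w m) ∧
    ∑ m ∈ s, w m = 1 ∧ y = ∑ m ∈ s, w m • x m}

theorem forwardHull_anti (x : ℕ → E) : Antitone (forwardHull x) := by
  rintro n k hnk _ ⟨s, w, h1, h2, h3, rfl⟩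
  exact ⟨s, w, fun m hm => hnk.trans (h1 m hm), h2, h3, rfl⟩

theorem self_mem_forwardHull (x : ℕ → E) (n : ℕ) : x n ∈ forwardHull x n :=
  ⟨{n}, fun _ => 1, by simp, by simp, by simp, by simp⟩

theorem midpoint_mem_forwardHull (x : ℕ → E) (n : ℕ) {y z : E} (hy : y ∈ forwardHull x n)
    (hz : z ∈ forwardHull x n) : (1 / 2 : ℝ) • (y + z) ∈ forwardHull x n := by
  classical
  obtain ⟨s, v, h1, h2, h3, rfl⟩ := hy
  obtain ⟨t, w, k1, k2, k3, rfl⟩ := hz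
  refine ⟨s ∪ t, fun m => (1 / 2) * ((if m ∈ s then v m else 0) + if m ∈ t then w m else 0),
    ?_, ?_, ?_, ?_⟩
  · intro m hm
    rcases Finset.mem_union.1 hm with h | h
    exacts [h1 m h, k1 m h]
  · intro m _
    have a1 : 0 ≤ (if m ∈ s then v m else 0) := by split_ifs with h; exacts [h2 m h, le_rfl]
    have a2 : 0 ≤ (if m ∈ t then w m else 0) := by split_ifs with h; exacts [k2 m h, le_rfl]
    positivity
  · rw [← Finset.mul_sum, Finset.sum_add_distrib, Finset.sum_ite_mem, Finset.sum_ite_mem,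
      Finset.inter_eq_right.2 Finset.subset_union_left,
      Finset.inter_eq_right.2 Finset.subset_union_right, h3, k3]
    norm_num
  · simp only [mul_smul, add_smul, ite_smul, zero_smul]
    rw [← Finset.smul_sum, Finset.sum_add_distrib, Finset.sum_ite_mem, Finset.sum_ite_mem,
      Finset.inter_eq_right.2 Finset.subset_union_left,
      Finset.inter_eq_right.2 Finset.subset_union_right]

/-- Bounded sequences in a Hilbert space have convergent forward convex combinations. -/
theorem exists_isForwardWeights_tendsto [CompleteSpace E] (x : ℕ → E) {C : ℝ}
    (hx : ∀ n, ‖x n‖ ≤ C) : ∃ s w, IsForwardWeights s w ∧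
      ∃ y, Tendsto (fun n => ∑ m ∈ s n, w n m • x m) atTop (𝓝 y) := by
  let d : ℕ → ℝ := fun n => sInf (norm '' forwardHull x n)
  have hbdd : ∀ n, BddBelow (norm '' forwardHull x n) := fun n =>
    ⟨0, by rintro _ ⟨y, -, rfl⟩; exact norm_nonneg y⟩
  have hdle : ∀ n, ∀ y ∈ forwardHull x n, d n ≤ ‖y‖ := fun n y hy =>
    csInf_le (hbdd n) ⟨y, hy, rfl⟩
  have hd0 : ∀ n, 0 ≤ d n := fun n => Real.sInf_nonneg (by rintro _ ⟨y, -, rfl⟩; exact norm_nonneg y)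
  have hdmono : Monotone d := fun n k hnk =>
    csInf_le_csInf (hbdd n) ⟨_, x k, self_mem_forwardHull x k, rfl⟩
      (Set.image_mono (forwardHull_anti x hnk))
  have hdC : ∀ n, d n ≤ C := fun n => (hdle n _ (self_mem_forwardHull x n)).trans (hx n)
  have hdlim := tendsto_atTop_ciSup hdmono ⟨C, by rintro _ ⟨n, rfl⟩; exact hdC n⟩
  set L := ⨆ n, d n with hL
  have hdL : ∀ n, d n ≤ L := fun n => le_ciSup (f := d) ⟨C, by rintro _ ⟨n, rfl⟩; exact hdC n⟩ n
  have hex : ∀ n : ℕ, ∃ y ∈ forwardHull x n, ‖y‖ < d n + 1 / ((n : ℝ) + 1) := by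
    intro n
    obtain ⟨_, ⟨y, hy, rfl⟩, hlt⟩ := exists_lt_of_csInf_lt
      (⟨_, x n, self_mem_forwardHull x n, rfl⟩ : (norm '' forwardHull x n).Nonempty)
      (show sInf (norm '' forwardHull x n) < d n + 1 / ((n : ℝ) + 1) by
        have : (0 : ℝ) < 1 / ((n : ℝ) + 1) := by positivity
        linarith)
    exact ⟨y, hy, hlt⟩
  choose y hyK hyn using hex
  -- The parallelogram bound: for `n, m ≥ N`, `‖y n - y m‖²` is at most `4 (L + 1/(N+1))²` minus `‖y
  -- n + y m‖²`, and the midpoint, lying in the `N`-th hull, has norm at least `d N`.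
  let b : ℕ → ℝ := fun n => 4 * ((L + 1 / ((n : ℝ) + 1)) ^ 2 - d n ^ 2)
  have hb : Tendsto (fun n => √(b n)) atTop (𝓝 0) := by
    have h1 := (((tendsto_const_nhds (x := L)).add
      tendsto_one_div_add_atTop_nhds_zero_nat).pow 2 |>.sub (hdlim.pow 2)).const_mul 4
    simp only [add_zero, sub_self, mul_zero] at h1
    have h2 := h1.sqrt
    rwa [Real.sqrt_zero] at h2
  have hcauchy : CauchySeq y := by
    refine cauchySeq_of_le_tendsto_0 _ (fun n m N hn hm => ?_) hb
    rw [dist_eq_norm]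
    refine Real.le_sqrt_of_sq_le ?_
    have hpl := parallelogram_law_with_norm ℝ (y n) (y m)
    have hmid := hdle N _ (midpoint_mem_forwardHull x N (forwardHull_anti x hn (hyK n))
      (forwardHull_anti x hm (hyK m)))
    rw [norm_smul] at hmid
    norm_num at hmid
    have hbound : ∀ k, N ≤ k → ‖y k‖ ^ 2 ≤ (L + 1 / ((N : ℝ) + 1)) ^ 2 := by
      intro k hk
      have hk' : (N : ℝ) ≤ k := by exact_mod_cast hk
      have h2 : 1 / ((k : ℝ) + 1) ≤ 1 / ((N : ℝ) + 1) :=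
        one_div_le_one_div_of_le (by positivity) (by linarith)
      have h3 := hyn k
      have h4 := hdL k
      exact pow_le_pow_left₀ (norm_nonneg _) (by linarith) 2
    have h5 := hbound n hn
    have h6 := hbound m hm
    have h7 : (2 * d N) ^ 2 ≤ ‖y n + y m‖ ^ 2 :=
      pow_le_pow_left₀ (by linarith [hd0 N]) (by linarith) 2
    simp only [b]
    nlinarith
  obtain ⟨z, hz⟩ := cauchySeq_tendsto_of_complete hcauchy
  choose s w h1 h2 h3 h4 using hyK
  exact ⟨s, w, ⟨h1, h2, h3⟩, z, by simpa only [← h4] using hz⟩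

end Hilbert

variable {X : Type*} {m0 : MeasurableSpace X} {μ : Measure X}

/-- A uniformly bounded sequence of finite families of functions has forward convex combinations
that converge almost everywhere. -/
theorem exists_isForwardWeights_tendsto_ae [IsFiniteMeasure μ] {J : Type*} [Fintype J]
    (f : ℕ → J → X → ℝ) (hf : ∀ n j, Measurable (f n j)) {K : ℝ} (hK : ∀ n j x, |f n j x| ≤ K) :
    ∃ s w, IsForwardWeights s w ∧ ∃ g : J → X → ℝ,
      ∀ᵐ x ∂μ, ∀ j, Tendsto (fun n => ∑ m ∈ s n, w n m * f m j x) atTop (𝓝 (g j x)) := by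
  -- The family is packed into one vector-valued function so that a single choice of weights serves
  -- all indices `j`.
  let F : ℕ → X → EuclideanSpace ℝ J := fun n x => WithLp.toLp 2 fun j => f n j x
  have hFm : ∀ n, AEStronglyMeasurable (F n) μ := fun n =>
    ((WithLp.measurable_toLp 2 (J → ℝ)).comp
      (measurable_pi_lambda _ fun j => hf n j)).aestronglyMeasurable
  have hFb : ∀ n x, ‖F n x‖ ≤ √(∑ _j : J, K ^ 2) := by
    intro n x
    rw [EuclideanSpace.norm_eq]
    refine Real.sqrt_le_sqrt (Finset.sum_le_sum fun j _ => ?_)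
    exact pow_le_pow_left₀ (norm_nonneg _) (hK n j x) 2
  have hF : ∀ n, MemLp (F n) 2 μ := fun n => MemLp.of_bound (hFm n) _ (.of_forall (hFb n))
  obtain ⟨s, w, hw, y, hy⟩ := exists_isForwardWeights_tendsto
    (E := Lp (EuclideanSpace ℝ J) 2 μ) (fun n => (hF n).toLp)
    (fun n => Lp.norm_le_of_ae_bound (Real.sqrt_nonneg _) (by
      filter_upwards [(hF n).coeFn_toLp] with x hx
      rw [hx]
      exact hFb n x))
  obtain ⟨ns, hns, hae⟩ := (tendstoInMeasure_of_tendsto_Lp hy).exists_seq_tendsto_ae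
  refine ⟨_, _, hw.subseq hns, fun j x => y x j, ?_⟩
  have hsum : ∀ᵐ x ∂μ, ∀ n, (∑ m ∈ s n, w n m • (hF m).toLp : Lp (EuclideanSpace ℝ J) 2 μ) x =
      ∑ m ∈ s n, w n m • F m x := by
    refine ae_all_iff.2 fun n => ?_
    have key : ∀ t : Finset ℕ, (∑ m ∈ t, w n m • (hF m).toLp : Lp (EuclideanSpace ℝ J) 2 μ) =ᵐ[μ]
        fun x => ∑ m ∈ t, w n m • F m x := by
      intro t
      classical
      induction t using Finset.induction_on with
      | empty =>
        simp only [Finset.sum_empty]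
        exact Lp.coeFn_zero _ _ _
      | insert a t ha ih =>
        simp only [Finset.sum_insert ha]
        filter_upwards [Lp.coeFn_add (w n a • (hF a).toLp) (∑ m ∈ t, w n m • (hF m).toLp), ih,
          Lp.coeFn_smul (w n a) (hF a).toLp, (hF a).coeFn_toLp] with x h1 h2 h3 h4
        rw [h1, Pi.add_apply, h2, h3, Pi.smul_apply, h4]
    exact key (s n)
  filter_upwards [hae, hsum] with x h1 h2 j
  have h3 := ((EuclideanSpace.proj (𝕜 := ℝ) j).continuous.tendsto _).comp h1
  refine h3.congr fun n => ?_
  rw [Function.comp_apply, h2]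
  simp [F]

/-! ### Closedness of semi-static hedging and stability under a price decrease. -/

section Options

variable {X J : Type*} {m0 : MeasurableSpace X} {μ : Measure X}

/-- A set of payoffs from which the holder of one option can choose. -/
structure IsOptionSet (μ : Measure X) (D : Set (X → ℝ)) : Prop where
  nonempty : D.Nonempty
  measurable : ∀ δ ∈ D, Measurable δ
  bounded : ∃ K : ℝ, ∀ δ ∈ D, ∀ x, |δ x| ≤ K
  convex : Convex ℝ D
  closed : ∀ (δ : ℕ → X → ℝ) (v : X → ℝ), (∀ n, δ n ∈ D) →
    (∀ᵐ x ∂μ, Tendsto (fun n => δ n x) atTop (𝓝 (v x))) → ∃ δ' ∈ D, ∀ᵐ x ∂μ, v x ≤ δ' x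

variable [Fintype J]

/-- The claims dominated by the payoff of a semi-static strategy with dynamic gains in `R` and
options in `D`. -/
def optionCone (μ : Measure X) (R : Set (X → ℝ)) (D : J → Set (X → ℝ)) : Set (X → ℝ) :=
  {v | ∃ r ∈ R, ∃ b : J → ℝ, (∀ j, 0 ≤ b j) ∧ ∃ δ : J → X → ℝ, (∀ j, δ j ∈ D j) ∧
    ∀ᵐ x ∂μ, v x ≤ r x + ∑ j, b j * δ j x}

/-- A semi-static strategy with nonnegative payoff does not use options, even if option prices
are lowered by `ε`. -/
def NoFreeOptions (μ : Measure X) (R : Set (X → ℝ)) (D : J → Set (X → ℝ)) (ε : ℝ) : Prop :=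
  ∀ r ∈ R, ∀ b : J → ℝ, (∀ j, 0 ≤ b j) → ∀ δ : J → X → ℝ, (∀ j, δ j ∈ D j) →
    (∀ᵐ x ∂μ, 0 ≤ r x + ∑ j, b j * (δ j x + ε)) → ∀ j, b j = 0

variable {R : Set (X → ℝ)} {D : J → Set (X → ℝ)}

theorem IsMeasurableModule.sum_mem {𝒢 : MeasurableSpace X} (hR : IsMeasurableModule 𝒢 R)
    (s : Finset ℕ) (w : ℕ → ℝ) {r : ℕ → X → ℝ} (hr : ∀ n, r n ∈ R) :
    (fun x => ∑ m ∈ s, w m * r m x) ∈ R := by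
  classical
  induction s using Finset.induction_on with
  | empty => simpa using hR.zero_mem
  | insert a s ha ih =>
    simp only [Finset.sum_insert ha]
    exact hR.add_mem _ (hR.mul_mem (fun _ => w a) measurable_const _ (hr a)) _ ih

/-- With convergent holdings the bounded option payoffs can be averaged until they converge, and
closedness for dynamic trading applies to what is left after subtracting them. The averaging is over
forward convex combinations, which preserve `R`, each `D j` and existing limits. -/
theorem optionCone_limit [IsFiniteMeasure μ] {𝒢 : MeasurableSpace X}
    (hR : IsMeasurableModule 𝒢 R) (hcl : SeqClosedAE μ (hedgeable μ R))
    (hD : ∀ j, IsOptionSet μ (D j)) {r : ℕ → X → ℝ} (hr : ∀ n, r n ∈ R) {b : ℕ → J → ℝ}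
    {c : J → ℝ} (hb : ∀ n j, 0 ≤ b n j) (hbc : Tendsto b atTop (𝓝 c))
    {δ : ℕ → J → X → ℝ} (hδ : ∀ n j, δ n j ∈ D j) {u : ℕ → X → ℝ} {v : X → ℝ}
    (hu : ∀ᵐ x ∂μ, Tendsto (fun n => u n x) atTop (𝓝 (v x)))
    (hle : ∀ n, ∀ᵐ x ∂μ, u n x ≤ r n x + ∑ j, b n j * δ n j x) :
    ∃ r ∈ R, ∃ δ : J → X → ℝ, (∀ j, δ j ∈ D j) ∧ ∀ᵐ x ∂μ, v x ≤ r x + ∑ j, c j * δ j x := by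
  rw [tendsto_pi_nhds] at hbc
  have hc : ∀ j, 0 ≤ c j := fun j => ge_of_tendsto' (hbc j) fun n => hb n j
  choose K hK using fun j => (hD j).bounded
  have hKb : ∀ n j x, |δ n j x| ≤ ∑ i, |K i| := fun n j x =>
    ((hK j _ (hδ n j) x).trans (le_abs_self _)).trans
      (Finset.single_le_sum (f := fun i => |K i|) (fun i _ => abs_nonneg _) (Finset.mem_univ j))
  obtain ⟨s, w, hw, g, hg⟩ := exists_isForwardWeights_tendsto_ae (μ := μ) δ
    (fun n j => (hD j).measurable _ (hδ n j)) hKb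
  have hcomb : ∀ n j, (fun x => ∑ m ∈ s n, w n m * δ m j x) ∈ D j := by
    intro n j
    have := (hD j).convex.sum_mem (hw.nonneg n) (hw.sum_eq_one n) fun m _ => hδ m j
    convert this using 1
    ext x
    simp
  have hlim : ∀ j, ∃ δ' ∈ D j, ∀ᵐ x ∂μ, g j x ≤ δ' x := fun j =>
    (hD j).closed _ _ (fun n => hcomb n j) (by filter_upwards [hg] with x hx using hx j)
  choose δ' hδ' hgδ using hlim
  -- Holdings are first frozen at their limit `c`, at the cost of `(b m - c) * δ m`, which vanishes
  -- because the payoffs are uniformly bounded. Otherwise averaging would mix varying holdings with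
  -- varying payoffs.
  have hmem : (fun x => v x - ∑ j, c j * g j x) ∈ hedgeable μ R := by
    refine hcl (fun n x => ∑ m ∈ s n, w n m * (u m x - ∑ j, (b m j - c j) * δ m j x) -
      ∑ j, c j * ∑ m ∈ s n, w n m * δ m j x) _ (fun n => ?_) ?_
    · refine ⟨_, hR.sum_mem (s n) (w n) hr, ?_⟩
      filter_upwards [ae_all_iff.2 hle] with x hx
      have h1 : ∑ m ∈ s n, w n m * (u m x - ∑ j, (b m j - c j) * δ m j x) ≤
          ∑ m ∈ s n, w n m * (r m x + ∑ j, c j * δ m j x) := by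
        refine Finset.sum_le_sum fun m hm => mul_le_mul_of_nonneg_left ?_ (hw.nonneg n m hm)
        have h2 := hx m
        have h3 : ∑ j, (b m j - c j) * δ m j x = ∑ j, b m j * δ m j x - ∑ j, c j * δ m j x := by
          rw [← Finset.sum_sub_distrib]
          exact Finset.sum_congr rfl fun j _ => by ring
        linarith
      have h4 : ∑ m ∈ s n, w n m * (r m x + ∑ j, c j * δ m j x) =
          ∑ m ∈ s n, w n m * r m x + ∑ j, c j * ∑ m ∈ s n, w n m * δ m j x := by
        simp only [mul_add, Finset.sum_add_distrib, Finset.mul_sum]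
        congr 1
        rw [Finset.sum_comm]
        exact Finset.sum_congr rfl fun j _ => Finset.sum_congr rfl fun m _ => by ring
      linarith
    · filter_upwards [hg, hu] with x hgx hux
      refine Tendsto.sub (hw.tendsto ?_) (tendsto_finsetSum _ fun j _ => (hgx j).const_mul _)
      have h1 : Tendsto (fun m => ∑ j, (b m j - c j) * δ m j x) atTop (𝓝 0) := by
        rw [← Finset.sum_const_zero (s := (Finset.univ : Finset J))]
        refine tendsto_finsetSum _ fun j _ => ?_
        have h2 : Tendsto (fun m => b m j - c j) atTop (𝓝 0) := by
          simpa using (hbc j).sub_const (c j)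
        refine h2.zero_mul_isBoundedUnder_le ⟨∑ i, |K i|, ?_⟩
        exact eventually_map.2 (.of_forall fun m => hKb m j x)
      simpa using hux.sub h1
  obtain ⟨r', hr', hle'⟩ := hmem
  refine ⟨r', hr', δ', hδ', ?_⟩
  filter_upwards [hle', ae_all_iff.2 hgδ] with x h1 h2
  have : ∑ j, c j * g j x ≤ ∑ j, c j * δ' j x :=
    Finset.sum_le_sum fun j _ => mul_le_mul_of_nonneg_left (h2 j) (hc j)
  linarith

theorem exists_subseq_tendsto_of_sum_le {b : ℕ → J → ℝ} (hb : ∀ n j, 0 ≤ b n j) {M : ℝ}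
    (hM : ∀ n, ∑ j, b n j ≤ M) :
    ∃ c : J → ℝ, ∃ ns : ℕ → ℕ, StrictMono ns ∧ Tendsto (b ∘ ns) atTop (𝓝 c) := by
  obtain ⟨c, -, ns, h1, h2⟩ := (isCompact_Icc (a := (0 : J → ℝ)) (b := fun _ => M)).tendsto_subseq
    (x := b) (fun n => ⟨fun j => hb n j, fun j =>
      (Finset.single_le_sum (fun i _ => hb n i) (Finset.mem_univ j)).trans (hM n)⟩)
  exact ⟨c, ns, h1, h2⟩

/-- A limit of payoffs of strategies holding one option in total is such a payoff. -/
theorem exists_strategy_of_normalized [IsFiniteMeasure μ] {𝒢 : MeasurableSpace X}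
    (hR : IsMeasurableModule 𝒢 R) (hcl : SeqClosedAE μ (hedgeable μ R))
    (hD : ∀ j, IsOptionSet μ (D j)) (hNF : NoFreeOptions μ R D 0) {r : ℕ → X → ℝ}
    (hr : ∀ n, r n ∈ R) {b : ℕ → J → ℝ} (hb : ∀ n j, 0 ≤ b n j) (hb1 : ∀ n, ∑ j, b n j = 1)
    {δ : ℕ → J → X → ℝ} (hδ : ∀ n j, δ n j ∈ D j) {u : ℕ → X → ℝ}
    (hu : ∀ᵐ x ∂μ, Tendsto (fun n => u n x) atTop (𝓝 0))
    (hle : ∀ n, ∀ᵐ x ∂μ, u n x ≤ r n x + ∑ j, b n j * δ n j x) : False := by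
  obtain ⟨c, ns, hns, hc⟩ := exists_subseq_tendsto_of_sum_le hb fun n => (hb1 n).le
  obtain ⟨r', hr', δ', hδ', hle'⟩ := optionCone_limit hR hcl hD (fun n => hr (ns n))
    (fun n => hb (ns n)) hc (fun n => hδ (ns n)) (v := fun _ => 0) (u := fun n => u (ns n))
    (by filter_upwards [hu] with x hx using hx.comp hns.tendsto_atTop) (fun n => hle (ns n))
  rw [tendsto_pi_nhds] at hc
  -- The limiting strategy has nonnegative payoff, so its holdings vanish, although they are a limit
  -- of holdings with total `1`.
  have hc0 := hNF r' hr' c (fun j => ge_of_tendsto' (hc j) fun n => hb _ j) δ' hδ'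
    (by simpa using hle')
  have h1 : Tendsto (fun n => ∑ j, b (ns n) j) atTop (𝓝 (∑ j, c j)) :=
    tendsto_finsetSum _ fun j _ => hc j
  simp only [hb1, hc0, Finset.sum_const_zero] at h1
  exact one_ne_zero (tendsto_nhds_unique tendsto_const_nhds h1)

/-- The claims hedgeable by semi-static strategies form a closed set. -/
theorem seqClosedAE_optionCone [IsFiniteMeasure μ] {𝒢 : MeasurableSpace X}
    (hR : IsMeasurableModule 𝒢 R) (hcl : SeqClosedAE μ (hedgeable μ R))
    (hD : ∀ j, IsOptionSet μ (D j)) (hNF : NoFreeOptions μ R D 0) :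
    SeqClosedAE μ (optionCone μ R D) := by
  intro u v hu huv
  choose r hr b hb δ hδ hle using hu
  -- If total holdings explode, rescaling them to `1` sends the claims to zero and yields a free
  -- option; otherwise they stay bounded along a subsequence.
  by_cases hB : Tendsto (fun n => ∑ j, b n j) atTop atTop
  · exfalso
    obtain ⟨N, hN⟩ := eventually_atTop.1 (hB.eventually_gt_atTop 0)
    let β : ℕ → ℝ := fun n => (∑ j, b (n + N) j)⁻¹
    have hβ : ∀ n, 0 < β n := fun n => inv_pos.2 (hN _ (Nat.le_add_left N n))
    have hβ0 : Tendsto β atTop (𝓝 0) :=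
      (tendsto_inv_atTop_zero.comp hB).comp (tendsto_add_atTop_nat N)
    refine exists_strategy_of_normalized hR hcl hD hNF
      (r := fun n x => β n * r (n + N) x)
      (fun n => hR.mul_mem (fun _ => β n) measurable_const _ (hr _))
      (b := fun n j => β n * b (n + N) j) (fun n j => mul_nonneg (hβ n).le (hb _ j))
      (fun n => ?_) (fun n => hδ (n + N)) (u := fun n x => β n * u (n + N) x) ?_ (fun n => ?_)
    · rw [← Finset.mul_sum]
      exact inv_mul_cancel₀ (hN _ (Nat.le_add_left N n)).ne'
    · filter_upwards [huv] with x hx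
      simpa using hβ0.mul (hx.comp (tendsto_add_atTop_nat N))
    · filter_upwards [hle (n + N)] with x hx
      simp only [mul_assoc, ← Finset.mul_sum, ← mul_add]
      exact mul_le_mul_of_nonneg_left hx (hβ n).le
  · rw [tendsto_atTop] at hB
    push Not at hB
    obtain ⟨M, hM⟩ := hB
    obtain ⟨ns, hns, hnsM⟩ := extraction_of_frequently_atTop hM
    obtain ⟨c, ks, hks, hc⟩ := exists_subseq_tendsto_of_sum_le (b := fun n => b (ns n))
      (fun n => hb _) fun n => (hnsM n).le
    obtain ⟨r', hr', δ', hδ', hle'⟩ := optionCone_limit hR hcl hD (fun n => hr (ns (ks n)))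
      (fun n => hb (ns (ks n))) hc (fun n => hδ (ns (ks n))) (v := v) (u := fun n => u (ns (ks n)))
      (by filter_upwards [huv] with x hx using hx.comp (hns.comp hks).tendsto_atTop)
      (fun n => hle (ns (ks n)))
    rw [tendsto_pi_nhds] at hc
    exact ⟨r', hr', c, fun j => ge_of_tendsto' (hc j) fun n => hb _ j, δ', hδ', hle'⟩

/-- The absence of free options is stable under a small decrease of the prices. -/
theorem NoFreeOptions.exists_pos [IsFiniteMeasure μ] {𝒢 : MeasurableSpace X}
    (hR : IsMeasurableModule 𝒢 R) (hcl : SeqClosedAE μ (hedgeable μ R))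
    (hD : ∀ j, IsOptionSet μ (D j)) (hNF : NoFreeOptions μ R D 0) :
    ∃ ε > 0, NoFreeOptions μ R D ε := by
  by_contra! hcon
  have hex : ∀ n : ℕ, ∃ r ∈ R, ∃ b : J → ℝ, (∀ j, 0 ≤ b j) ∧ ∃ δ : J → X → ℝ,
      (∀ j, δ j ∈ D j) ∧ (∀ᵐ x ∂μ, 0 ≤ r x + ∑ j, b j * (δ j x + 1 / ((n : ℝ) + 1))) ∧
      ∃ j, b j ≠ 0 := by
    intro n
    have h := hcon (1 / ((n : ℝ) + 1)) (by positivity)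
    simp only [NoFreeOptions] at h
    push Not at h
    obtain ⟨r, hr, b, hb, δ, hδ, h1, h2⟩ := h
    exact ⟨r, hr, b, hb, δ, hδ, h1, h2⟩
  choose r hr b hb δ hδ hle hne using hex
  have hpos : ∀ n, 0 < ∑ j, b n j := by
    intro n
    obtain ⟨j, hj⟩ := hne n
    exact Finset.sum_pos' (fun i _ => hb n i) ⟨j, Finset.mem_univ j, (hb n j).lt_of_ne' hj⟩
  let β : ℕ → ℝ := fun n => (∑ j, b n j)⁻¹
  have hβ : ∀ n, 0 < β n := fun n => inv_pos.2 (hpos n)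
  have hβ1 : ∀ n, ∑ j, β n * b n j = 1 := fun n => by
    rw [← Finset.mul_sum]
    exact inv_mul_cancel₀ (hpos n).ne'
  -- After normalisation the price decrease `1/(n+1)` contributes exactly `1/(n+1)` to the payoff,
  -- whence the deterministic lower bounds tending to `0`.
  refine exists_strategy_of_normalized hR hcl hD hNF
    (r := fun n x => β n * r n x) (fun n => hR.mul_mem (fun _ => β n) measurable_const _ (hr _))
    (b := fun n j => β n * b n j) (fun n j => mul_nonneg (hβ n).le (hb n j)) hβ1 hδ
    (u := fun n _ => -(1 / ((n : ℝ) + 1))) (.of_forall fun x => ?_) (fun n => ?_)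
  · simpa using (tendsto_one_div_add_atTop_nhds_zero_nat (𝕜 := ℝ)).neg
  · filter_upwards [hle n] with x hx
    have h1 := mul_nonneg (hβ n).le hx
    have h2 : β n * (r n x + ∑ j, b n j * (δ n j x + 1 / ((n : ℝ) + 1))) =
        β n * r n x + ∑ j, β n * b n j * δ n j x +
          (∑ j, β n * b n j) * (1 / ((n : ℝ) + 1)) := by
      rw [mul_add, Finset.mul_sum, Finset.sum_mul, add_assoc, ← Finset.sum_add_distrib]
      congr 1
      exact Finset.sum_congr rfl fun j _ => by ring
    rw [h2, hβ1, one_mul] at h1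
    linarith

end Options

/-! ### A Kreps–Yan theorem in `L²`. -/

section Density

variable {X : Type*} {m0 : MeasurableSpace X} {μ : Measure X}

/-- A convex cone of claims, closed under almost everywhere convergence, that contains the
nonpositive claims and no nontrivial nonnegative claim. -/
structure IsHedgingCone (μ : Measure X) (C : Set (X → ℝ)) : Prop where
  add_mem : ∀ u ∈ C, ∀ v ∈ C, (fun x => u x + v x) ∈ C
  smul_mem : ∀ c : ℝ, 0 ≤ c → ∀ u ∈ C, (fun x => c * u x) ∈ C
  of_nonpos : ∀ u : X → ℝ, (∀ᵐ x ∂μ, u x ≤ 0) → u ∈ C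
  closed : SeqClosedAE μ C
  noFreeLunch : NoFreeLunch μ C

variable {C : Set (X → ℝ)}

theorem IsHedgingCone.mem_of_ae_le (hC : IsHedgingCone μ C) {u v : X → ℝ} (hv : v ∈ C)
    (h : ∀ᵐ x ∂μ, u x ≤ v x) : u ∈ C := by
  have := hC.add_mem v hv (fun x => u x - v x)
    (hC.of_nonpos _ (by filter_upwards [h] with x hx using by linarith))
  simpa using this

/-- The square integrable `u` for which `-(G u)` belongs to the cone. -/
def negativeCone (hC : IsHedgingCone μ C) (G : X → ℝ) : ProperCone ℝ (Lp ℝ 2 μ) where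
  carrier := {u | (fun x => -(G x * u x)) ∈ C}
  add_mem' := by
    intro u v hu hv
    refine hC.mem_of_ae_le (hC.add_mem _ hu _ hv) ?_
    filter_upwards [Lp.coeFn_add u v] with x hx
    rw [hx, Pi.add_apply]
    exact le_of_eq (by ring)
  zero_mem' := by
    refine hC.of_nonpos _ ?_
    filter_upwards [Lp.coeFn_zero ℝ 2 μ] with x hx
    change -(G x * (0 : Lp ℝ 2 μ) x) ≤ 0
    rw [hx]
    simp
  smul_mem' := by
    intro c u hu
    refine hC.mem_of_ae_le (hC.smul_mem c c.2 _ hu) ?_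
    filter_upwards [Lp.coeFn_smul (c : ℝ) u] with x hx
    have : (c • u : Lp ℝ 2 μ) = (c : ℝ) • u := rfl
    rw [this, hx, Pi.smul_apply, smul_eq_mul]
    exact le_of_eq (by ring)
  isClosed' := by
    refine IsSeqClosed.isClosed fun u v hu huv => ?_
    obtain ⟨ns, -, hae⟩ := (tendstoInMeasure_of_tendsto_Lp huv).exists_seq_tendsto_ae
    refine hC.closed _ _ (fun n => hu (ns n)) ?_
    filter_upwards [hae] with x hx using (hx.const_mul _).neg

theorem inner_Lp_eq_integral (u v : Lp ℝ 2 μ) : inner ℝ u v = ∫ x, u x * v x ∂μ := by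
  rw [L2.inner_def]
  exact integral_congr_ae (.of_forall fun x => by simp [mul_comm])

variable {G : X → ℝ}

/-- The negative part of `z` belongs to `negativeCone`, as its weighted negative is a nonpositive
claim; pairing it with `z` gives minus its squared norm, so it vanishes. -/
theorem nonneg_of_mem_innerDual (hC : IsHedgingCone μ C) (hG : ∀ x, 0 ≤ G x) {z : Lp ℝ 2 μ}
    (hz : z ∈ ProperCone.innerDual (negativeCone hC G : Set (Lp ℝ 2 μ))) : ∀ᵐ x ∂μ, 0 ≤ z x := by
  have hmem : -(z ⊓ 0) ∈ negativeCone hC G := by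
    refine hC.of_nonpos _ ?_
    filter_upwards [Lp.coeFn_neg (z ⊓ 0), Lp.coeFn_inf z 0, Lp.coeFn_zero ℝ 2 μ] with x h1 h2 h3
    rw [h1, Pi.neg_apply, h2, Pi.inf_apply, h3, Pi.zero_apply]
    have := mul_nonneg (hG x) (neg_nonneg.2 (inf_le_right (a := z x) (b := 0)))
    linarith
  have h := ProperCone.mem_innerDual.1 hz hmem
  have hint : Integrable (fun x => (z ⊓ 0 : Lp ℝ 2 μ) x ^ 2) μ := (Lp.memLp (z ⊓ 0)).integrable_sq
  have heq : inner ℝ (-(z ⊓ 0)) z = -∫ x, (z ⊓ 0 : Lp ℝ 2 μ) x ^ 2 ∂μ := by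
    rw [inner_Lp_eq_integral, ← integral_neg]
    refine integral_congr_ae ?_
    filter_upwards [Lp.coeFn_neg (z ⊓ 0), Lp.coeFn_inf z 0, Lp.coeFn_zero ℝ 2 μ] with x h1 h2 h3
    rw [h1, Pi.neg_apply, h2, Pi.inf_apply, h3, Pi.zero_apply]
    rcases le_total (z x) 0 with h | h
    · rw [inf_eq_left.2 h]; ring
    · rw [inf_eq_right.2 h]; ring
  rw [heq] at h
  have h0 : ∫ x, (z ⊓ 0 : Lp ℝ 2 μ) x ^ 2 ∂μ = 0 :=
    le_antisymm (by linarith) (integral_nonneg fun x => sq_nonneg _)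
  rw [integral_eq_zero_iff_of_nonneg (fun x => sq_nonneg _) hint] at h0
  filter_upwards [h0, Lp.coeFn_inf z 0, Lp.coeFn_zero ℝ 2 μ] with x h1 h2 h3
  have h4 : (z ⊓ 0 : Lp ℝ 2 μ) x = 0 := by simpa using h1
  rw [h2, Pi.inf_apply, h3, Pi.zero_apply] at h4
  exact inf_eq_right.1 h4

/-- Having `-1_A` in the cone would make `G * 1_A` a hedgeable free lunch; hence a hyperplane
separates it from the cone. -/
theorem exists_inner_indicator_pos [IsFiniteMeasure μ] (hC : IsHedgingCone μ C)
    (hG : ∀ x, 0 < G x) {A : Set X} (hA : MeasurableSet A) (hμA : μ A ≠ 0) :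
    ∃ z ∈ ProperCone.innerDual (negativeCone hC G : Set (Lp ℝ 2 μ)), 0 < ∫ x in A, z x ∂μ := by
  let a : Lp ℝ 2 μ := indicatorConstLp 2 hA (measure_ne_top μ A) 1
  have hna : -a ∉ negativeCone hC G := by
    intro h
    have h1 : ∀ᵐ x ∂μ, (-a : Lp ℝ 2 μ) x = -A.indicator (fun _ => 1) x := by
      filter_upwards [Lp.coeFn_neg a, indicatorConstLp_coeFn (p := 2) (hs := hA)
        (hμs := measure_ne_top μ A) (c := (1 : ℝ))] with x h1 h2
      rw [h1, Pi.neg_apply, h2]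
    have h2 := hC.noFreeLunch _ h (by
      filter_upwards [h1] with x hx
      rw [hx]
      have := mul_nonneg (hG x).le
        (Set.indicator_nonneg (s := A) (f := fun _ => (1 : ℝ)) (fun _ _ => zero_le_one) x)
      linarith)
    refine hμA (measure_mono_null ?_ (h1.and h2))
    intro x hx hcon
    obtain ⟨k1, k2⟩ := hcon
    rw [k1] at k2
    simp [hx] at k2
    exact (hG x).ne' k2
  obtain ⟨y, hy, hlt⟩ := ProperCone.hyperplane_separation' _ hna
  refine ⟨y, ProperCone.mem_innerDual.2 fun x hx => hy x hx, ?_⟩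
  rw [inner_neg_left, L2.inner_indicatorConstLp_one] at hlt
  linarith

theorem tsum_mem_properCone {E : Type*} [NormedAddCommGroup E] [NormedSpace ℝ E]
    (K : ProperCone ℝ E) {f : ℕ → E} (hf : ∀ n, f n ∈ K) : ∑' n, f n ∈ K := by
  by_cases hs : Summable f
  · exact K.isClosed.mem_of_tendsto hs.hasSum.tendsto_sum_nat
      (.of_forall fun n => K.toSubmodule.sum_mem fun i _ => hf i)
  · rw [tsum_eq_zero_of_not_summable hs]
    exact K.toSubmodule.zero_mem

/-- Exhaustion: a dual element whose positivity set has maximal measure exists, as a weighted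
countable sum. If its zero set had positive measure, adding a separating functional for that set
would enlarge the positivity set. -/
theorem exists_pos_mem_innerDual [IsProbabilityMeasure μ] (hC : IsHedgingCone μ C)
    (hG : ∀ x, 0 < G x) :
    ∃ z ∈ ProperCone.innerDual (negativeCone hC G : Set (Lp ℝ 2 μ)), ∀ᵐ x ∂μ, 0 < z x := by
  set K := ProperCone.innerDual (negativeCone hC G : Set (Lp ℝ 2 μ)) with hK
  have hK0 : ∀ z ∈ K, ∀ᵐ x ∂μ, 0 ≤ z x := fun z hz =>
    nonneg_of_mem_innerDual hC (fun x => (hG x).le) hz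
  let M : Lp ℝ 2 μ → ℝ := fun z => μ.real {x | 0 < z x}
  have hbdd : BddAbove (M '' K) := ⟨1, by rintro _ ⟨z, -, rfl⟩; exact measureReal_le_one⟩
  obtain ⟨a, -, hat, haK⟩ := exists_seq_tendsto_sSup
    (⟨_, 0, K.toSubmodule.zero_mem, rfl⟩ : (M '' K).Nonempty) hbdd
  choose z hzK hza using haK
  -- Positive weights that make the series absolutely convergent whatever the norms of the `z n`.
  let c : ℕ → ℝ := fun n => (1 / 2) ^ n / (1 + ‖z n‖)
  have hc : ∀ n, 0 < c n := fun n => by positivity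
  have hcz : ∀ n, c n • z n ∈ K := fun n => K.toSubmodule.smul_mem ⟨c n, (hc n).le⟩ (hzK n)
  have hsum : Summable fun n => c n • z n := by
    refine Summable.of_norm_bounded summable_geometric_two fun n => ?_
    rw [norm_smul, Real.norm_of_nonneg (hc n).le, div_mul_eq_mul_div, div_le_iff₀ (by positivity)]
    exact mul_le_mul_of_nonneg_left (by linarith) (by positivity)
  set y := ∑' n, c n • z n with hy
  have hyK : y ∈ K := tsum_mem_properCone K hcz
  have hle : ∀ n, ∀ᵐ x ∂μ, c n * z n x ≤ y x := by
    intro n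
    -- The sum without its `n`-th term still lies in the closed dual cone and is therefore
    -- nonnegative, so `y` dominates each term.
    have h1 := hsum.tsum_eq_add_tsum_ite n
    set t := ∑' k, if k = n then 0 else c k • z k with ht
    have htK : t ∈ K := tsum_mem_properCone K fun k => by
      split_ifs
      exacts [K.toSubmodule.zero_mem, hcz k]
    rw [← hy] at h1
    rw [h1]
    filter_upwards [Lp.coeFn_add (c n • z n) t, Lp.coeFn_smul (c n) (z n), hK0 t htK]
      with x h2 h3 h4
    rw [h2, Pi.add_apply, h3, Pi.smul_apply, smul_eq_mul]
    linarith
  have hMy : sSup (M '' K) ≤ M y := by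
    refine le_of_tendsto' hat fun n => ?_
    rw [← hza n]
    refine ENNReal.toReal_mono (measure_ne_top _ _) (measure_mono_ae ?_)
    filter_upwards [hle n] with x hx hpos
    exact (mul_pos (hc n) hpos).trans_le hx
  refine ⟨y, hyK, ?_⟩
  by_contra hcon
  have hm : MeasurableSet {x | 0 < y x} :=
    measurableSet_lt measurable_const (Lp.stronglyMeasurable y).measurable
  obtain ⟨v, hvK, hv⟩ := exists_inner_indicator_pos hC hG hm.compl hcon
  have hyv : y + v ∈ K := K.toSubmodule.add_mem hyK hvK
  have h1 : M (y + v) ≤ M y := (le_csSup hbdd ⟨_, hyv, rfl⟩).trans hMy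
  have hmv : MeasurableSet {x | 0 < v x} :=
    measurableSet_lt measurable_const (Lp.stronglyMeasurable v).measurable
  have h2 : μ.real ({x | 0 < y x} ∪ ({x | 0 < v x} \ {x | 0 < y x})) ≤ M (y + v) := by
    refine ENNReal.toReal_mono (measure_ne_top _ _) (measure_mono_ae ?_)
    filter_upwards [Lp.coeFn_add y v, hK0 y hyK, hK0 v hvK] with x k1 k2 k3 hx
    change 0 < (y + v : Lp ℝ 2 μ) x
    rw [k1, Pi.add_apply]
    rcases hx with hx | hx
    · exact add_pos_of_pos_of_nonneg hx k3
    · exact add_pos_of_nonneg_of_pos k2 hx.1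
  rw [measureReal_union disjoint_sdiff_self_right (hmv.diff hm)] at h2
  have h3 : μ.real ({x | 0 < v x} \ {x | 0 < y x}) = 0 :=
    le_antisymm (by simp only [M] at h1 h2; linarith) measureReal_nonneg
  rw [measureReal_eq_zero_iff] at h3
  refine hv.not_ge (setIntegral_nonpos_ae hm.compl ?_)
  filter_upwards [measure_eq_zero_iff_ae_notMem.1 h3] with x hx hxy
  by_contra hpos
  exact hx ⟨not_le.1 hpos, hxy⟩

/-- The Kreps–Yan theorem: a hedging cone is separated from the nonnegative claims by an
equivalent probability measure, under which a given function can be assumed to be integrable. -/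
theorem IsHedgingCone.exists_measure [IsProbabilityMeasure μ] (hC : IsHedgingCone μ C)
    (hGm : Measurable G) (hG : ∀ x, 1 ≤ G x) :
    ∃ Q : Measure X, IsProbabilityMeasure Q ∧ Q ≪ μ ∧ μ ≪ Q ∧ Integrable G Q ∧
      ∀ v ∈ C, Measurable v → (∃ K : ℝ, ∀ x, |v x| ≤ K * G x) → ∫ x, v x ∂Q ≤ 0 := by
  have hG0 : ∀ x, 0 < G x := fun x => zero_lt_one.trans_le (hG x)
  obtain ⟨z, hzK, hz⟩ := exists_pos_mem_innerDual hC hG0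
  have hzm : Measurable z := (Lp.stronglyMeasurable z).measurable
  have hzint : Integrable z μ := (Lp.memLp z).integrable one_le_two
  -- Dividing by `G` undoes the weight in `negativeCone`, and makes `G` integrable under the new
  -- measure because `ρ * G = z` is.
  let ρ : X → ℝ := fun x => z x / G x
  have hρm : Measurable ρ := hzm.div hGm
  have hρ : ∀ᵐ x ∂μ, 0 < ρ x := by filter_upwards [hz] with x hx using div_pos hx (hG0 x)
  have hρint : Integrable ρ μ := by
    refine hzint.mono hρm.aestronglyMeasurable (.of_forall fun x => ?_)
    rw [norm_div]
    exact div_le_self (norm_nonneg _) ((hG x).trans (le_abs_self _))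
  set I := ∫ x, ρ x ∂μ with hI
  have hIpos : 0 < I := by
    rw [hI, integral_pos_iff_support_of_nonneg_ae (by filter_upwards [hρ] with x hx using hx.le)
      hρint]
    have : ∀ᵐ x ∂μ, x ∈ Function.support ρ := by filter_upwards [hρ] with x hx using hx.ne'
    rw [measure_congr (eventuallyEq_univ.2 this : Function.support ρ =ᵐ[μ] Set.univ)]
    simp
  let dens : X → ENNReal := fun x => ENNReal.ofReal (ρ x / I)
  have hdm : Measurable dens := (hρm.div_const I).ennreal_ofReal
  have hdt : ∀ᵐ x ∂μ, dens x < ⊤ := .of_forall fun x => ENNReal.ofReal_lt_top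
  have hdr : ∀ᵐ x ∂μ, (dens x).toReal = ρ x / I := by
    filter_upwards [hρ] with x hx using ENNReal.toReal_ofReal (div_pos hx hIpos).le
  have hQint : ∀ v : X → ℝ, ∫ x, v x ∂(μ.withDensity dens) = I⁻¹ * ∫ x, ρ x * v x ∂μ := by
    intro v
    rw [integral_withDensity_eq_integral_toReal_smul hdm hdt, ← integral_const_mul]
    refine integral_congr_ae ?_
    filter_upwards [hdr] with x hx
    rw [hx, smul_eq_mul]
    ring
  refine ⟨μ.withDensity dens, ⟨?_⟩, withDensity_absolutelyContinuous _ _,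
    withDensity_absolutelyContinuous' hdm.aemeasurable ?_, ?_, ?_⟩
  · rw [withDensity_apply _ MeasurableSet.univ, Measure.restrict_univ,
      ← ofReal_integral_eq_lintegral_ofReal (hρint.div_const I), integral_div, ← hI,
      div_self hIpos.ne', ENNReal.ofReal_one]
    filter_upwards [hρ] with x hx using (div_pos hx hIpos).le
  · filter_upwards [hρ] with x hx
    exact (ENNReal.ofReal_pos.2 (div_pos hx hIpos)).ne'
  · rw [integrable_withDensity_iff_integrable_smul' hdm hdt]
    refine (hzint.div_const I).congr ?_
    filter_upwards [hdr] with x hx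
    rw [hx, smul_eq_mul]
    have := (hG0 x).ne'
    simp only [ρ]
    field_simp
  · rintro v hv hvm ⟨K, hvK⟩
    rw [hQint]
    have hu : MemLp (fun x => -(v x / G x)) 2 μ := by
      refine MemLp.of_bound (hvm.div hGm).neg.aestronglyMeasurable K (.of_forall fun x => ?_)
      rw [norm_neg, norm_div, Real.norm_eq_abs, Real.norm_of_nonneg (hG0 x).le,
        div_le_iff₀ (hG0 x)]
      exact hvK x
    let u : Lp ℝ 2 μ := hu.toLp _
    have hmem : u ∈ negativeCone hC G := by
      refine hC.mem_of_ae_le hv ?_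
      filter_upwards [hu.coeFn_toLp] with x hx
      rw [hx]
      have := (hG0 x).ne'
      apply le_of_eq
      field_simp
    have h := ProperCone.mem_innerDual.1 hzK hmem
    rw [inner_Lp_eq_integral] at h
    have heq : ∫ x, u x * z x ∂μ = -∫ x, ρ x * v x ∂μ := by
      rw [← integral_neg]
      refine integral_congr_ae ?_
      filter_upwards [hu.coeFn_toLp] with x hx
      rw [hx]
      simp only [ρ]
      ring
    rw [heq] at h
    exact mul_nonpos_of_nonneg_of_nonpos (inv_nonneg.2 hIpos.le) (by linarith)

end Density

/-! ### Abstract fundamental theorem, attainment and duality. -/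

section Duality

variable {X J : Type*} {m0 : MeasurableSpace X} {μ : Measure X}

/-- The payoffs in `D` shifted by a constant. -/
def translate (c : ℝ) (D : Set (X → ℝ)) : Set (X → ℝ) :=
  {v | ∃ δ ∈ D, v = fun x => δ x + c}

theorem IsOptionSet.translate {D : Set (X → ℝ)} (hD : IsOptionSet μ D) (c : ℝ) :
    IsOptionSet μ (translate c D) where
  nonempty := by
    obtain ⟨δ, hδ⟩ := hD.nonempty
    exact ⟨_, δ, hδ, rfl⟩
  measurable := by
    rintro _ ⟨δ, hδ, rfl⟩
    exact (hD.measurable δ hδ).add_const c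
  bounded := by
    obtain ⟨K, hK⟩ := hD.bounded
    refine ⟨K + |c|, ?_⟩
    rintro _ ⟨δ, hδ, rfl⟩ x
    exact (abs_add_le _ _).trans (by linarith [hK δ hδ x])
  convex := by
    rintro _ ⟨δ, hδ, rfl⟩ _ ⟨δ', hδ', rfl⟩ a b ha hb hab
    refine ⟨_, hD.convex hδ hδ' ha hb hab, ?_⟩
    ext x
    simp only [Pi.add_apply, Pi.smul_apply, smul_eq_mul]
    linear_combination c * hab
  closed := by
    intro δ v hδ hv
    choose η hη hηδ using hδ
    obtain ⟨δ', h1, h2⟩ := hD.closed η (fun x => v x - c) hη (by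
      filter_upwards [hv] with x hx
      have := hx.sub_const c
      simpa [hηδ] using this)
    exact ⟨_, ⟨δ', h1, rfl⟩, by filter_upwards [h2] with x hx using by linarith⟩

/-- The options in `D` together with those in `D'`, bought at the price `y`. -/
def adjoinOption (D : J → Set (X → ℝ)) (D' : Set (X → ℝ)) (y : ℝ) : Option J → Set (X → ℝ)
  | none => translate (-y) D'
  | some j => D j

theorem isOptionSet_adjoinOption {D : J → Set (X → ℝ)} {D' : Set (X → ℝ)} (hD : ∀ j, IsOptionSet μ (D j))
    (hD' : IsOptionSet μ D') (y : ℝ) (j : Option J) : IsOptionSet μ (adjoinOption D D' y j) := by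
  cases j with
  | none => exact hD'.translate (-y)
  | some j => exact hD j

variable [Fintype J] {R : Set (X → ℝ)} {D : J → Set (X → ℝ)}

theorem isHedgingCone_optionCone [IsFiniteMeasure μ] (hR : IsMeasurableModule ⊥ R)
    (hcl : SeqClosedAE μ (hedgeable μ R)) (hNA : NoFreeLunch μ R)
    (hD : ∀ j, IsOptionSet μ (D j)) (hNF : NoFreeOptions μ R D 0) :
    IsHedgingCone μ (optionCone μ R D) where
  add_mem := by
    rintro u ⟨r, hr, b, hb, δ, hδ, hu⟩ v ⟨s, hs, c, hc, γ, hγ, hv⟩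
    -- Two positions in the same option merge into one, with the payoffs averaged in proportion to
    -- the holdings; if both holdings vanish any payoff will do.
    have hex : ∀ j, ∃ θ ∈ D j, ∀ x, b j * δ j x + c j * γ j x = (b j + c j) * θ x := by
      intro j
      by_cases h0 : b j + c j = 0
      · have h1 : b j = 0 := by linarith [hb j, hc j]
        have h2 : c j = 0 := by linarith [hb j, hc j]
        exact ⟨δ j, hδ j, fun x => by simp [h1, h2]⟩
      · have hpos : 0 < b j + c j := lt_of_le_of_ne (add_nonneg (hb j) (hc j)) (Ne.symm h0)
        refine ⟨_, (hD j).convex (hδ j) (hγ j) (div_nonneg (hb j) hpos.le)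
          (div_nonneg (hc j) hpos.le) (by field_simp), fun x => ?_⟩
        simp only [Pi.add_apply, Pi.smul_apply, smul_eq_mul]
        field_simp
    choose θ hθ hθe using hex
    refine ⟨_, hR.add_mem r hr s hs, fun j => b j + c j, fun j => add_nonneg (hb j) (hc j), θ, hθ, ?_⟩
    filter_upwards [hu, hv] with x h1 h2
    simp only [← hθe, Finset.sum_add_distrib]
    linarith
  smul_mem := by
    rintro c hc u ⟨r, hr, b, hb, δ, hδ, hu⟩
    refine ⟨_, hR.mul_mem (fun _ => c) measurable_const r hr, fun j => c * b j,
      fun j => mul_nonneg hc (hb j), δ, hδ, ?_⟩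
    filter_upwards [hu] with x hx
    simp only [mul_assoc, ← Finset.mul_sum, ← mul_add]
    exact mul_le_mul_of_nonneg_left hx hc
  of_nonpos := by
    intro u hu
    choose δ hδ using fun j => (hD j).nonempty
    exact ⟨_, hR.zero_mem, fun _ => 0, fun _ => le_rfl, δ, hδ, by simpa using hu⟩
  closed := seqClosedAE_optionCone hR hcl hD hNF
  noFreeLunch := by
    rintro u ⟨r, hr, b, hb, δ, hδ, hu⟩ hu0
    have hb0 := hNF r hr b hb δ hδ (by
      filter_upwards [hu, hu0] with x h1 h2
      simpa using h2.trans h1)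
    simp only [hb0, zero_mul, Finset.sum_const_zero, add_zero] at hu
    have hr0 := hNA r hr (by filter_upwards [hu, hu0] with x h1 h2 using h2.trans h1)
    filter_upwards [hu, hu0, hr0] with x h1 h2 h3
    exact le_antisymm (h1.trans h3.le) h2

/-- The fundamental theorem of asset pricing for semi-static strategies. -/
theorem NoFreeOptions.exists_measure [IsProbabilityMeasure μ] (hR : IsMeasurableModule ⊥ R)
    (hcl : SeqClosedAE μ (hedgeable μ R)) (hNA : NoFreeLunch μ R)
    (hD : ∀ j, IsOptionSet μ (D j)) (hNF : NoFreeOptions μ R D 0) {G : X → ℝ}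
    (hGm : Measurable G) (hG : ∀ x, 1 ≤ G x) :
    ∃ Q : Measure X, IsProbabilityMeasure Q ∧ Q ≪ μ ∧ μ ≪ Q ∧ Integrable G Q ∧
      (∀ r ∈ R, Measurable r → (∃ K : ℝ, ∀ x, |r x| ≤ K * G x) → ∫ x, r x ∂Q ≤ 0) ∧
      ∃ ε > 0, ∀ j, ∀ δ ∈ D j, ∫ x, δ x ∂Q ≤ -ε := by
  classical
  -- Pricing with payoffs raised by `ε` gives expectations at most `-ε` uniformly over `D j`, so
  -- that the inequality stays strict after taking suprema.
  obtain ⟨ε, hε, hNFε⟩ := hNF.exists_pos hR hcl hD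
  have hDε : ∀ j, IsOptionSet μ (SemiStatic.translate ε (D j)) := fun j => (hD j).translate ε
  have hNF' : NoFreeOptions μ R (fun j => SemiStatic.translate ε (D j)) 0 := by
    intro r hr b hb δ hδ h
    choose γ hγ hγδ using hδ
    refine hNFε r hr b hb γ hγ ?_
    simpa [hγδ] using h
  have hC := isHedgingCone_optionCone hR hcl hNA hDε hNF'
  obtain ⟨Q, hQ, h1, h2, h3, h4⟩ := hC.exists_measure hGm hG
  choose δ₀ hδ₀ using fun j => (hDε j).nonempty
  refine ⟨Q, hQ, h1, h2, h3, fun r hr hrm hrb => h4 r ?_ hrm hrb, ε, hε, fun j δ hδ => ?_⟩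
  · exact ⟨r, hr, fun _ => 0, fun _ => le_rfl, δ₀, hδ₀, by simp⟩
  · obtain ⟨K, hK⟩ := (hDε j).bounded
    have hδε : (fun x => δ x + ε) ∈ SemiStatic.translate ε (D j) := ⟨δ, hδ, rfl⟩
    have h := h4 (fun x => δ x + ε) ⟨_, hR.zero_mem, Pi.single j 1, fun i => ?_,
      Function.update δ₀ j (fun x => δ x + ε), fun i => ?_, .of_forall fun x => ?_⟩
      ((hDε j).measurable _ hδε) ⟨|K|, fun x => ?_⟩
    · have hint : Integrable δ Q := by
        obtain ⟨K', hK'⟩ := (hD j).bounded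
        exact Integrable.of_bound ((hD j).measurable δ hδ).aestronglyMeasurable K'
          (.of_forall fun x => hK' δ hδ x)
      rw [integral_add hint (integrable_const ε)] at h
      simp at h
      linarith
    · by_cases hi : i = j
      · subst hi; simp
      · simp [hi]
    · by_cases hi : i = j
      · subst hi; simpa using hδε
      · simpa [hi] using hδ₀ i
    · simp [Pi.single_apply]
    · exact (hK _ hδε x).trans ((le_abs_self K).trans
        (le_mul_of_one_le_right (abs_nonneg K) (hG x)))

/-- The initial debts that can be covered by the payoff of a semi-static strategy together with
a payoff in `D'`. -/
def coverable (μ : Measure X) (R : Set (X → ℝ)) (D : J → Set (X → ℝ)) (D' : Set (X → ℝ)) : Set ℝ :=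
  {y | ∃ r ∈ R, ∃ b : J → ℝ, (∀ j, 0 ≤ b j) ∧ ∃ δ : J → X → ℝ, (∀ j, δ j ∈ D j) ∧
    ∃ δ' ∈ D', ∀ᵐ x ∂μ, y ≤ r x + ∑ j, b j * δ j x + δ' x}

/-- A nonnegative payoff holding a positive amount of the new option, rescaled to one unit of it,
says precisely that `y` is coverable. -/
theorem noFreeOptions_adjoinOption {D' : Set (X → ℝ)} (hR : IsMeasurableModule ⊥ R)
    (hNF : NoFreeOptions μ R D 0) {y : ℝ} (hy : y ∉ coverable μ R D D') :
    NoFreeOptions μ R (adjoinOption D D' y) 0 := by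
  intro r hr b hb δ hδ h
  obtain ⟨δ', hδ', hδ'e⟩ := hδ none
  simp only [Fintype.sum_option, add_zero] at h
  have hnone : b none = 0 := by
    by_contra hne
    have hpos : 0 < b none := (hb none).lt_of_ne' hne
    refine hy ⟨_, hR.mul_mem (fun _ => (b none)⁻¹) measurable_const r hr,
      fun j => (b none)⁻¹ * b (some j), fun j => mul_nonneg (inv_nonneg.2 hpos.le) (hb _),
      fun j => δ (some j), fun j => hδ (some j), δ', hδ', ?_⟩
    filter_upwards [h] with x hx
    have h1 := mul_nonneg (inv_nonneg.2 hpos.le) hx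
    rw [hδ'e, mul_add, mul_add, ← mul_assoc, inv_mul_cancel₀ hne, Finset.mul_sum] at h1
    simp only [mul_assoc] at h1 ⊢
    linarith
  have hsome := hNF r hr (fun j => b (some j)) (fun j => hb _) (fun j => δ (some j))
    (fun j => hδ (some j)) (by simpa [hnone] using h)
  intro j
  cases j with
  | none => exact hnone
  | some j => exact hsome j

/-- The set of coverable debts has a greatest element. -/
theorem exists_isGreatest_coverable [IsProbabilityMeasure μ] {D' : Set (X → ℝ)}
    (hR : IsMeasurableModule ⊥ R) (hcl : SeqClosedAE μ (hedgeable μ R)) (hNA : NoFreeLunch μ R)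
    (hD : ∀ j, IsOptionSet μ (D j)) (hNF : NoFreeOptions μ R D 0) (hD' : IsOptionSet μ D') :
    ∃ y, IsGreatest (coverable μ R D D') y := by
  obtain ⟨K, hK⟩ := hD'.bounded
  choose δ₀ hδ₀ using fun j => (hD j).nonempty
  obtain ⟨δ', hδ'⟩ := hD'.nonempty
  have hne : (coverable μ R D D').Nonempty :=
    ⟨-K, _, hR.zero_mem, fun _ => 0, fun _ => le_rfl, δ₀, hδ₀, δ', hδ', .of_forall fun x => by
      simpa using (abs_le.1 (hK δ' hδ' x)).1⟩
  have hbdd : BddAbove (coverable μ R D D') := by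
    refine ⟨K, ?_⟩
    rintro y ⟨r, hr, b, hb, δ, hδ, δ', hδ', h⟩
    -- A debt above the bound `K` of `D'` would leave a strategy with payoff at least `y - K > 0`:
    -- first its options must vanish, then its dynamic gain contradicts no arbitrage.
    by_contra! hlt
    have h1 : ∀ᵐ x ∂μ, y - K ≤ r x + ∑ j, b j * δ j x := by
      filter_upwards [h] with x hx
      linarith [(abs_le.1 (hK δ' hδ' x)).2]
    have hb0 := hNF r hr b hb δ hδ (by
      filter_upwards [h1] with x hx
      simp only [add_zero]
      linarith)
    simp only [hb0, zero_mul, Finset.sum_const_zero, add_zero] at h1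
    have h2 := hNA r hr (by filter_upwards [h1] with x hx using by linarith)
    obtain ⟨x, hx1, hx2⟩ := (h1.and h2).exists
    linarith
  refine ⟨sSup (coverable μ R D D'), ?_, fun y hy => le_csSup hbdd hy⟩
  by_contra hy
  obtain ⟨ε, hε, hNFε⟩ := (noFreeOptions_adjoinOption hR hNF hy).exists_pos hR hcl
    (isOptionSet_adjoinOption hD hD' _)
  obtain ⟨y, ⟨r, hr, b, hb, δ, hδ, δ', hδ', h⟩, hlt⟩ :=
    exists_lt_of_lt_csSup hne (sub_lt_self (sSup (coverable μ R D D')) hε)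
  set s := sSup (coverable μ R D D') with hs
  -- One unit of the new option at price `s - ε` together with a strategy covering some `y > s - ε`
  -- has nonnegative payoff, so its holding `1` would have to be `0`.
  have := hNFε r hr (fun j => j.elim 1 b) (fun j => ?_)
    (fun j => j.elim (fun x => δ' x + -s) δ) (fun j => ?_) ?_ none
  · simp at this
  · cases j with
    | none => simp
    | some j => exact hb j
  · cases j with
    | none => exact ⟨δ', hδ', rfl⟩
    | some j => exact hδ j
  · filter_upwards [h] with x hx
    simp only [Fintype.sum_option, Option.elim_none, Option.elim_some, one_mul]
    have : ∑ j, b j * δ j x ≤ ∑ j, b j * (δ j x + ε) :=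
      Finset.sum_le_sum fun j _ => mul_le_mul_of_nonneg_left (by linarith) (hb j)
    linarith

/-- If a debt is not coverable, then some pricing measure prices the payoffs in `D'` below it. -/
theorem exists_measure_of_notMem_coverable [IsProbabilityMeasure μ] {D' : Set (X → ℝ)}
    (hR : IsMeasurableModule ⊥ R) (hcl : SeqClosedAE μ (hedgeable μ R)) (hNA : NoFreeLunch μ R)
    (hD : ∀ j, IsOptionSet μ (D j)) (hNF : NoFreeOptions μ R D 0) (hD' : IsOptionSet μ D')
    {G : X → ℝ} (hGm : Measurable G) (hG : ∀ x, 1 ≤ G x) {y : ℝ} (hy : y ∉ coverable μ R D D') :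
    ∃ Q : Measure X, IsProbabilityMeasure Q ∧ Q ≪ μ ∧ μ ≪ Q ∧ Integrable G Q ∧
      (∀ r ∈ R, Measurable r → (∃ K : ℝ, ∀ x, |r x| ≤ K * G x) → ∫ x, r x ∂Q ≤ 0) ∧
      (∃ ε > 0, ∀ j, ∀ δ ∈ D j, ∫ x, δ x ∂Q ≤ -ε) ∧ ∀ δ ∈ D', ∫ x, δ x ∂Q ≤ y := by
  obtain ⟨Q, hQ, h1, h2, h3, h4, ε, hε, h5⟩ := (noFreeOptions_adjoinOption hR hNF hy).exists_measure
    hR hcl hNA (isOptionSet_adjoinOption hD hD' _) hGm hG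
  refine ⟨Q, hQ, h1, h2, h3, h4, ⟨ε, hε, fun j => h5 (some j)⟩, fun δ hδ => ?_⟩
  have h := h5 none _ ⟨δ, hδ, rfl⟩
  have hint : Integrable δ Q := by
    obtain ⟨K, hK⟩ := hD'.bounded
    exact Integrable.of_bound (hD'.measurable δ hδ).aestronglyMeasurable K
      (.of_forall fun x => hK δ hδ x)
  rw [integral_add hint (integrable_const _)] at h
  simp at h
  linarith

end Duality

/-! ### Liquidating strategies, optimal stopping and martingales. -/

section Processes

variable {X : Type*} {m0 : MeasurableSpace X} {Q : Measure X} {T d : ℕ}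
  {𝒢 : Filtration (Fin (T + 1)) m0}

/-- Partial sums of positive parts, truncated at `1` and set equal to `1` at the terminal time. -/
def truncatedSum (η : Fin (T + 1) → X → ℝ) (k : ℕ) (x : X) : ℝ :=
  if k = T + 1 then 1 else min 1 (∑ s with s.val < k, max (η s x) 0)

theorem truncatedSum_le_one (η : Fin (T + 1) → X → ℝ) (k : ℕ) (x : X) :
    truncatedSum η k x ≤ 1 := by
  unfold truncatedSum
  split_ifs
  exacts [le_rfl, min_le_left _ _]

theorem truncatedSum_le_succ (η : Fin (T + 1) → X → ℝ) {k : ℕ} (hk : k < T + 1) (x : X) :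
    truncatedSum η k x ≤ truncatedSum η (k + 1) x := by
  by_cases h : k + 1 = T + 1
  · refine (truncatedSum_le_one η k x).trans (le_of_eq ?_)
    simp [truncatedSum, h]
  · simp only [truncatedSum, hk.ne, h, if_false]
    refine min_le_min_left _ (Finset.sum_le_sum_of_subset_of_nonneg ?_ fun _ _ _ => le_max_right _ _)
    intro s hs
    simp only [Finset.mem_filter, Finset.mem_univ, true_and] at hs ⊢
    omega

theorem measurable_truncatedSum {η : Fin (T + 1) → X → ℝ} (hη : Adapted 𝒢 η) {k : ℕ}
    {t : Fin (T + 1)} (hkt : k ≤ t.val + 1) : Measurable[𝒢 t] (truncatedSum η k) := by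
  unfold truncatedSum
  split_ifs with h
  · exact measurable_const
  · refine measurable_const.min (Finset.measurable_sum _ fun s hs => ?_)
    simp only [Finset.mem_filter, Finset.mem_univ, true_and] at hs
    have hst : s ≤ t := by
      rw [Fin.le_def]
      omega
    exact ((hη s).mono (𝒢.mono hst) le_rfl).max measurable_const

theorem sum_filter_lt_succ (a : Fin (T + 1) → ℝ) (t : Fin (T + 1)) :
    ∑ s : Fin (T + 1) with s.val < t.val + 1, a s = ∑ s : Fin (T + 1) with s.val < t.val, a s + a t := by
  have : (Finset.univ.filter fun s : Fin (T + 1) => s.val < t.val + 1) =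
      insert t (Finset.univ.filter fun s : Fin (T + 1) => s.val < t.val) := by
    ext s
    simp only [Finset.mem_filter, Finset.mem_univ, true_and, Finset.mem_insert, Fin.ext_iff]
    omega
  rw [this, Finset.sum_insert (by simp), add_comm]

/-- An adapted process that is almost surely a liquidating strategy can be modified on the
exceptional set to become one. -/
theorem exists_liquidating_modification {η : Fin (T + 1) → X → ℝ} (hη : Adapted 𝒢 η) :
    ∃ η' : Fin (T + 1) → X → ℝ, Adapted 𝒢 η' ∧ (∀ t x, 0 ≤ η' t x) ∧ (∀ x, ∑ t, η' t x = 1) ∧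
      ∀ x, (∀ t, 0 ≤ η t x) → ∑ t, η t x = 1 → ∀ t, η' t x = η t x := by
  refine ⟨fun t x => truncatedSum η (t.val + 1) x - truncatedSum η t.val x, fun t => ?_,
    fun t x => ?_, fun x => ?_, fun x h0 h1 t => ?_⟩
  · exact (measurable_truncatedSum hη le_rfl).sub (measurable_truncatedSum hη (Nat.le_succ _))
  · exact sub_nonneg.2 (truncatedSum_le_succ η t.2 x)
  · rw [Fin.sum_univ_eq_sum_range (fun k => truncatedSum η (k + 1) x - truncatedSum η k x),
      Finset.sum_range_sub (fun k => truncatedSum η k x)]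
    simp [truncatedSum]
  · have hpart : ∀ k : ℕ, k ≤ T + 1 → truncatedSum η k x = ∑ s with s.val < k, η s x := by
      intro k hk
      unfold truncatedSum
      split_ifs with h
      · rw [← h1]
        refine Finset.sum_congr ?_ fun _ _ => rfl
        ext s
        simp only [h, s.2, Finset.mem_filter, Finset.mem_univ, true_and]
      · have h2 : ∑ s : Fin (T + 1) with s.val < k, max (η s x) 0 =
            ∑ s : Fin (T + 1) with s.val < k, η s x :=
          Finset.sum_congr rfl fun s _ => max_eq_left (h0 s)
        rw [h2, min_eq_right]
        rw [← h1]
        exact Finset.sum_le_sum_of_subset_of_nonneg (Finset.subset_univ _) fun s _ _ => h0 s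
    change truncatedSum η (t.val + 1) x - truncatedSum η t.val x = η t x
    rw [hpart _ t.2, hpart _ t.2.le, sum_filter_lt_succ (fun s => η s x)]
    ring

/-- Liquidating strategies are compact with respect to forward convex combinations and almost
everywhere convergence. -/
theorem exists_liquidating_limit [IsFiniteMeasure Q] {η : ℕ → Fin (T + 1) → X → ℝ}
    (hη : ∀ n, Adapted 𝒢 (η n)) (hη0 : ∀ n t x, 0 ≤ η n t x) (hη1 : ∀ n x, ∑ t, η n t x = 1) :
    ∃ s w, IsForwardWeights s w ∧ ∃ η' : Fin (T + 1) → X → ℝ, Adapted 𝒢 η' ∧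
      (∀ t x, 0 ≤ η' t x) ∧ (∀ x, ∑ t, η' t x = 1) ∧
      ∀ᵐ x ∂Q, ∀ t, Tendsto (fun n => ∑ m ∈ s n, w n m * η m t x) atTop (𝓝 (η' t x)) := by
  have hbound : ∀ n t x, |η n t x| ≤ 1 := fun n t x => by
    rw [abs_of_nonneg (hη0 n t x), ← hη1 n x]
    exact Finset.single_le_sum (fun t _ => hη0 n t x) (Finset.mem_univ t)
  obtain ⟨s, w, hw, g, hg⟩ := exists_isForwardWeights_tendsto_ae (μ := Q) η
    (fun n t => (hη n t).mono (𝒢.le t) le_rfl) hbound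
  -- The almost everywhere limit `g` is not known to be adapted, the σ-algebras not being assumed
  -- complete. The pointwise `limsup` is adapted and agrees with it almost everywhere.
  have hlim : Adapted 𝒢 fun t x => limsup (fun n => ∑ m ∈ s n, w n m * η m t x) atTop :=
    fun t => Measurable.limsup fun n => Finset.measurable_sum _ fun m _ => (hη m t).const_mul _
  obtain ⟨η', h1, h2, h3, h4⟩ := exists_liquidating_modification hlim
  refine ⟨s, w, hw, η', h1, h2, h3, ?_⟩
  filter_upwards [hg] with x hx t
  have hgl : ∀ t, limsup (fun n => ∑ m ∈ s n, w n m * η m t x) atTop = g t x := fun t =>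
    (hx t).limsup_eq
  have h0 : ∀ t, 0 ≤ limsup (fun n => ∑ m ∈ s n, w n m * η m t x) atTop := fun t => by
    rw [hgl]
    exact ge_of_tendsto' (hx t) fun n => Finset.sum_nonneg fun m hm =>
      mul_nonneg (hw.nonneg n m hm) (hη0 m t x)
  have h1' : ∑ t, limsup (fun n => ∑ m ∈ s n, w n m * η m t x) atTop = 1 := by
    simp only [hgl]
    have h5 : Tendsto (fun n => ∑ t, ∑ m ∈ s n, w n m * η m t x) atTop (𝓝 (∑ t, g t x)) :=
      tendsto_finsetSum _ fun t _ => hx t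
    have h6 : ∀ n, ∑ t, ∑ m ∈ s n, w n m * η m t x = 1 := fun n => by
      rw [Finset.sum_comm]
      simp only [← Finset.mul_sum, hη1, mul_one, hw.sum_eq_one]
    simp only [h6] at h5
    exact (tendsto_nhds_unique h5 tendsto_const_nhds)
  rw [h4 x h0 h1' t, hgl]
  exact hx t

/-- The pull-out property in integrated form: against a bounded `𝒢₀`-measurable weight, a payoff and
its conditional expectation are interchangeable. -/
theorem integral_mul_condExp [IsFiniteMeasure Q] {𝒢₀ : MeasurableSpace X} (h𝒢 : 𝒢₀ ≤ m0)
    {k v : X → ℝ} (hk : Measurable[𝒢₀] k) {C : ℝ} (hC : ∀ x, |k x| ≤ C) (hv : Integrable v Q) :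
    ∫ x, k x * (Q[v|𝒢₀]) x ∂Q = ∫ x, k x * v x ∂Q := by
  have hint : Integrable (k * v) Q :=
    hv.bdd_mul (hk.mono h𝒢 le_rfl).aestronglyMeasurable (.of_forall hC)
  have h := condExp_mul_of_stronglyMeasurable_left hk.stronglyMeasurable hint hv
  exact (integral_congr_ae h.symm).trans (integral_condExp h𝒢)

theorem measurable_stopped {ψ : Fin (T + 1) → X → ℝ} (hψ : Adapted 𝒢 ψ) {τ : X → Fin (T + 1)}
    (hτ : ∀ s, MeasurableSet[𝒢 s] {x | τ x = s}) : Measurable fun x => ψ (τ x) x := by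
  have : (fun x => ψ (τ x) x) = fun x => ∑ s, {x | τ x = s}.indicator (ψ s) x := by
    ext x
    simp [Set.indicator_apply]
  rw [this]
  exact Finset.measurable_sum _ fun s _ =>
    ((hψ s).mono (𝒢.le s) le_rfl).indicator (𝒢.le s _ (hτ s))

/-- From time `t` on, some stopping time performs at least as well as all randomised ones. -/
theorem exists_stoppingTime_from [IsFiniteMeasure Q] {ψ : Fin (T + 1) → X → ℝ}
    (hψ : Adapted 𝒢 ψ) {K : ℝ} (hK : ∀ t x, |ψ t x| ≤ K) (t : Fin (T + 1)) :
    ∃ τ : X → Fin (T + 1), (∀ x, t ≤ τ x) ∧ (∀ s, MeasurableSet[𝒢 s] {x | τ x = s}) ∧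
      ∀ (η : Fin (T + 1) → X → ℝ) (θ : X → ℝ), Adapted 𝒢 η → (∀ s x, 0 ≤ η s x) →
        Measurable[𝒢 t] θ → (∀ x, θ x ≤ 1) → (∀ x, ∑ s ∈ Finset.Ici t, η s x = θ x) →
        ∫ x, ∑ s ∈ Finset.Ici t, η s x * ψ s x ∂Q ≤ ∫ x, θ x * ψ (τ x) x ∂Q := by
  classical
  have hbdd : ∀ k v : X → ℝ, Measurable k → (∀ x, |k x| ≤ 1) → Measurable v → (∀ x, |v x| ≤ K) →
      Integrable (fun x => k x * v x) Q := fun k v hk hk1 hv hvK =>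
    Integrable.of_bound (hk.mul hv).aestronglyMeasurable (1 * K) (.of_forall fun x => by
      rw [norm_mul]
      exact mul_le_mul (hk1 x) (hvK x) (norm_nonneg _) zero_le_one)
  -- Backward induction in which `θ` is the mass not yet liquidated at time `t`. Carrying a general
  -- `θ` is what allows the induction hypothesis to be applied to the remaining mass `θ - e`.
  induction t using Fin.reverseInduction with
  | last =>
    refine ⟨fun _ => Fin.last T, fun _ => le_rfl, fun s => MeasurableSet.const _, ?_⟩
    intro η θ _ _ _ _ hsum
    have hI : Finset.Ici (Fin.last T) = {Fin.last T} := by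
      ext s
      simp
    simp only [hI, Finset.sum_singleton] at hsum ⊢
    simp [hsum]
  | cast i ih =>
    obtain ⟨τ, hτ, hτm, hopt⟩ := ih
    have hlt : i.castSucc < i.succ := Fin.castSucc_lt_succ
    set v : X → ℝ := fun x => ψ (τ x) x with hv
    have hvm : Measurable v := measurable_stopped hψ hτm
    have hvK : ∀ x, |v x| ≤ K := fun x => hK _ x
    have hvint : Integrable v Q := Integrable.of_bound hvm.aestronglyMeasurable K (.of_forall hvK)
    set c : X → ℝ := Q[v|𝒢 i.castSucc] with hc
    have hcm : Measurable[𝒢 i.castSucc] c := stronglyMeasurable_condExp.measurable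
    have hcint : Integrable c Q := integrable_condExp
    -- Stop where the immediate payoff is at least the conditional value of continuing optimally.
    set A : Set X := {x | c x ≤ ψ i.castSucc x} with hA
    have hAm : MeasurableSet[𝒢 i.castSucc] A := measurableSet_le hcm (hψ _)
    refine ⟨fun x => if x ∈ A then i.castSucc else τ x, fun x => ?_, fun s => ?_, ?_⟩
    · dsimp only
      split_ifs
      exacts [le_rfl, hlt.le.trans (hτ x)]
    · by_cases hs : i.castSucc ≤ s
      · have : {x | (if x ∈ A then i.castSucc else τ x) = s} =
            (A ∩ {_x | i.castSucc = s}) ∪ (Aᶜ ∩ {x | τ x = s}) := by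
          ext x
          by_cases hx : x ∈ A <;> simp [hx]
        rw [this]
        exact ((𝒢.mono hs _ hAm).inter (@MeasurableSet.const X (𝒢 s) _)).union
          ((𝒢.mono hs _ hAm).compl.inter (hτm s))
      · have : {x | (if x ∈ A then i.castSucc else τ x) = s} = ∅ := by
          ext x
          simp only [Set.mem_ofPred_eq, Set.mem_empty_iff_false, iff_false]
          split_ifs
          · exact fun h => hs h.le
          · exact fun h => hs (h ▸ hlt.le.trans (hτ x))
        rw [this]
        exact @MeasurableSet.empty X (𝒢 s)
    · intro η θ hη hη0 hθ hθ1 hsum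
      have hI : Finset.Ici i.castSucc = insert i.castSucc (Finset.Ici i.succ) := by
        ext s
        simp only [Finset.mem_Ici, Finset.mem_insert, Fin.le_def, Fin.ext_iff, Fin.val_succ,
          Fin.val_castSucc]
        omega
      have hnot : i.castSucc ∉ Finset.Ici i.succ := by simp
      set e : X → ℝ := η i.castSucc with he
      have hsum' : ∀ x, ∑ s ∈ Finset.Ici i.succ, η s x = θ x - e x := fun x => by
        have := hsum x
        rw [hI, Finset.sum_insert hnot] at this
        linarith
      have hrest : ∀ x, 0 ≤ θ x - e x := fun x => by
        rw [← hsum' x]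
        exact Finset.sum_nonneg fun s _ => hη0 s x
      have he0 : ∀ x, 0 ≤ e x := fun x => hη0 _ x
      have hηm : ∀ s, Measurable (η s) := fun s => (hη s).mono (𝒢.le s) le_rfl
      have hψm : ∀ s, Measurable (ψ s) := fun s => (hψ s).mono (𝒢.le s) le_rfl
      have hem : Measurable[𝒢 i.castSucc] e := hη _
      have hem0 : Measurable e := hηm _
      have hθm0 : Measurable θ := hθ.mono (𝒢.le _) le_rfl
      have hA0 : MeasurableSet A := 𝒢.le _ _ hAm
      have he1 : ∀ x, |e x| ≤ 1 := fun x => by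
        rw [abs_of_nonneg (he0 x)]
        linarith [hrest x, hθ1 x]
      have hrest1 : ∀ x, |θ x - e x| ≤ 1 := fun x => by
        rw [abs_of_nonneg (hrest x)]
        linarith [he0 x, hθ1 x]
      have hθ0 : ∀ x, 0 ≤ θ x := fun x => by linarith [he0 x, hrest x]
      have hind : ∀ (B : Set X) x, |B.indicator θ x| ≤ 1 := fun B x => by
        by_cases hx : x ∈ B
        · simpa [hx, abs_of_nonneg (hθ0 x)] using hθ1 x
        · simp [hx]
      have hηi : ∀ s ∈ Finset.Ici i.succ, Integrable (fun x => η s x * ψ s x) Q := fun s hs => by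
        refine hbdd _ _ (hηm s) (fun x => ?_) (hψm s) (hK s)
        rw [abs_of_nonneg (hη0 s x)]
        have := Finset.single_le_sum (f := fun s => η s x) (fun s _ => hη0 s x) hs
        rw [hsum' x] at this
        linarith [(abs_le.1 (hrest1 x)).2]
      have hIe : Integrable (fun x => e x * ψ i.castSucc x) Q := hbdd _ _ hem0 he1 (hψm _) (hK _)
      calc ∫ x, ∑ s ∈ Finset.Ici i.castSucc, η s x * ψ s x ∂Q
          = ∫ x, e x * ψ i.castSucc x ∂Q + ∫ x, ∑ s ∈ Finset.Ici i.succ, η s x * ψ s x ∂Q := by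
            simp only [hI, Finset.sum_insert hnot]
            exact integral_add hIe (integrable_finsetSum _ hηi)
        _ ≤ ∫ x, e x * ψ i.castSucc x ∂Q + ∫ x, (θ x - e x) * v x ∂Q :=
            add_le_add_right (hopt η _ hη hη0 ((hθ.sub hem).mono (𝒢.mono hlt.le) le_rfl)
              (fun x => (le_abs_self _).trans (hrest1 x)) hsum') _
        _ = ∫ x, e x * ψ i.castSucc x ∂Q + ∫ x, (θ x - e x) * c x ∂Q := by
            rw [hc, integral_mul_condExp (k := fun x => θ x - e x) (𝒢.le _) (hθ.sub hem) hrest1 hvint]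
        _ = ∫ x, (e x * ψ i.castSucc x + (θ x - e x) * c x) ∂Q :=
            (integral_add hIe (hcint.bdd_mul (hθm0.sub hem0).aestronglyMeasurable
              (.of_forall hrest1))).symm
        -- Pointwise, splitting the mass `θ` between stopping and continuing yields at most all of
        -- it placed on the larger of `ψ` and `c`.
        _ ≤ ∫ x, (A.indicator θ x * ψ i.castSucc x + Aᶜ.indicator θ x * c x) ∂Q := by
            refine integral_mono (hIe.add (hcint.bdd_mul (hθm0.sub hem0).aestronglyMeasurable
              (.of_forall hrest1))) ((hbdd _ _ (hθm0.indicator hA0) (hind A) (hψm _) (hK _)).add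
              (hcint.bdd_mul (hθm0.indicator hA0.compl).aestronglyMeasurable
                (.of_forall (hind _)))) fun x => ?_
            by_cases hx : x ∈ A
            · have h1 : c x ≤ ψ i.castSucc x := hx
              have h2 := mul_le_mul_of_nonneg_left h1 (hrest x)
              simp only [hx, Set.indicator_of_mem, Set.mem_compl_iff, not_true_eq_false,
                not_false_eq_true, Set.indicator_of_notMem]
              linarith
            · have h1 : ψ i.castSucc x ≤ c x := (not_le.1 hx).le
              have h2 := mul_le_mul_of_nonneg_left h1 (he0 x)
              simp only [hx, Set.indicator_of_mem, Set.mem_compl_iff,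
                not_false_eq_true, Set.indicator_of_notMem]
              linarith
        _ = ∫ x, A.indicator θ x * ψ i.castSucc x ∂Q + ∫ x, Aᶜ.indicator θ x * c x ∂Q :=
            integral_add (hbdd _ _ (hθm0.indicator hA0) (hind A) (hψm _) (hK _))
              (hcint.bdd_mul (hθm0.indicator hA0.compl).aestronglyMeasurable (.of_forall (hind _)))
        _ = ∫ x, A.indicator θ x * ψ i.castSucc x ∂Q + ∫ x, Aᶜ.indicator θ x * v x ∂Q := by
            rw [hc, integral_mul_condExp (𝒢.le _) (hθ.indicator hAm.compl) (hind _) hvint]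
        _ = ∫ x, θ x * ψ (if x ∈ A then i.castSucc else τ x) x ∂Q := by
            rw [← integral_add (hbdd _ _ (hθm0.indicator hA0) (hind A) (hψm _) (hK _))
              (hbdd _ _ (hθm0.indicator hA0.compl) (hind _) hvm hvK)]
            refine integral_congr_ae (.of_forall fun x => ?_)
            by_cases hx : x ∈ A <;> simp [hx, hv]

/-- Some stopping time performs at least as well as all liquidating strategies. -/
theorem exists_stoppingTime_ge [IsFiniteMeasure Q] {ψ : Fin (T + 1) → X → ℝ}
    (hψ : Adapted 𝒢 ψ) {K : ℝ} (hK : ∀ t x, |ψ t x| ≤ K) :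
    ∃ τ : X → Fin (T + 1), (∀ s, MeasurableSet[𝒢 s] {x | τ x = s}) ∧
      ∀ η : Fin (T + 1) → X → ℝ, Adapted 𝒢 η → (∀ s x, 0 ≤ η s x) → (∀ x, ∑ s, η s x = 1) →
        ∫ x, ∑ s, η s x * ψ s x ∂Q ≤ ∫ x, ψ (τ x) x ∂Q := by
  obtain ⟨τ, -, h1, h2⟩ := exists_stoppingTime_from (Q := Q) hψ hK 0
  refine ⟨τ, h1, fun η hη hη0 hη1 => ?_⟩
  have hI : Finset.Ici (0 : Fin (T + 1)) = Finset.univ := by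
    ext s
    simp
  simpa [hI] using h2 η (fun _ => 1) hη hη0 measurable_const (fun _ => le_rfl) (by simpa [hI] using hη1)

theorem integral_mul_increment_eq_zero [IsFiniteMeasure Q] {S : Fin (T + 1) → X → (Fin d → ℝ)}
    (hS : Martingale S 𝒢 Q) {s t : Fin (T + 1)} (hst : s ≤ t) (i : Fin d) {c : X → ℝ}
    (hc : Measurable[𝒢 s] c) {C : ℝ} (hC : ∀ x, |c x| ≤ C) :
    ∫ x, c x * (S t x i - S s x i) ∂Q = 0 := by
  have hint : ∀ t, Integrable (fun x => S t x i) Q := fun t => (hS.integrable t).eval i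
  have h0 : (fun _ => (0 : ℝ)) =ᵐ[Q] Q[fun x => S t x i - S s x i|𝒢 s] := by
    refine ae_eq_condExp_of_forall_setIntegral_eq (𝒢.le s) ((hint t).sub (hint s))
      (fun _ _ _ => integrableOn_zero) (fun B hB _ => ?_) stronglyMeasurable_const.aestronglyMeasurable
    rw [integral_sub (hint t).integrableOn (hint s).integrableOn, integral_zero]
    have h1 := congrFun (hS.setIntegral_eq hst hB) i
    rw [eval_integral fun j => ((hS.integrable s).eval j).integrableOn,
      eval_integral fun j => ((hS.integrable t).eval j).integrableOn] at h1
    linarith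
  rw [← integral_mul_condExp (v := fun x => S t x i - S s x i) (𝒢.le s) hc hC ((hint t).sub (hint s)), ← integral_zero X ℝ (μ := Q)]
  refine integral_congr_ae ?_
  filter_upwards [h0] with x hx
  rw [← hx, mul_zero]

/-- One-step increments with zero integral over past events suffice, by telescoping; this is the
form in which the pricing inequality for gains delivers the martingale property. -/
theorem martingale_of_setIntegral_increment [IsFiniteMeasure Q]
    {S : Fin (T + 1) → X → (Fin d → ℝ)} (hS : Adapted 𝒢 S) (hint : ∀ t, Integrable (S t) Q)
    (h : ∀ (t : Fin T) (i : Fin d) (B : Set X), MeasurableSet[𝒢 t.castSucc] B →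
      ∫ x in B, (S t.succ x i - S t.castSucc x i) ∂Q = 0) : Martingale S 𝒢 Q := by
  have hinti : ∀ t i, Integrable (fun x => S t x i) Q := fun t i => (hint t).eval i
  have key : ∀ (s t : Fin (T + 1)), s ≤ t → ∀ B, MeasurableSet[𝒢 s] B →
      ∫ x in B, S t x ∂Q = ∫ x in B, S s x ∂Q := by
    intro s t
    induction t using Fin.induction with
    | zero =>
      intro hst B _
      rw [Fin.le_zero_iff.1 hst]
    | succ t ih =>
      intro hst B hB
      rcases hst.lt_or_eq with hlt | rfl
      · have hs : s ≤ t.castSucc := Fin.le_castSucc_iff.2 hlt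
        rw [← ih hs B hB]
        ext i
        rw [eval_integral fun j => (hinti _ j).integrableOn,
          eval_integral fun j => (hinti _ j).integrableOn, ← sub_eq_zero,
          ← integral_sub (hinti _ i).integrableOn (hinti _ i).integrableOn]
        exact h t i B (𝒢.mono hs _ hB)
      · rfl
  refine ⟨fun t => (hS t).stronglyMeasurable, fun s t hst => ?_⟩
  refine (ae_eq_condExp_of_forall_setIntegral_eq (𝒢.le s) (hint t) (fun _ _ _ => (hint s).integrableOn)
    (fun B hB _ => (key s t hst B hB).symm)
    (hS s).stronglyMeasurable.aestronglyMeasurable).symm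

end Processes

/-! ### The enlarged space and the passage to one more exercise time. -/

section EnlargedSpace

variable {Ω : Type*} {mΩ : MeasurableSpace Ω} {T d L M N n : ℕ}
  {𝓕 : Filtration (Fin (T + 1)) mΩ}

theorem measurable_enlarged_fst (𝓕 : Filtration (Fin (T + 1)) mΩ) (n : ℕ) (t : Fin (T + 1)) :
    Measurable[enlargedSigma 𝓕 n t, 𝓕 t] (Prod.fst : Enlarged Ω T n → Ω) :=
  measurable_iff_comap_le.2 le_sup_left

theorem adapted_extend (n : ℕ) {β : Type*} [MeasurableSpace β] {ψ : Fin (T + 1) → Ω → β}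
    (hψ : Adapted 𝓕 ψ) :
    Adapted (enlargedFiltration 𝓕 n) fun t (w : Enlarged Ω T n) => ψ t w.1 :=
  fun t => (hψ t).comp (measurable_enlarged_fst 𝓕 n t)

theorem measurableSet_exercise_le (𝓕 : Filtration (Fin (T + 1)) mΩ) (k : Fin n)
    {s t : Fin (T + 1)} (hst : s ≤ t) :
    MeasurableSet[enlargedSigma 𝓕 n t] {w : Enlarged Ω T n | w.2 k ≤ s} :=
  le_sup_right (a := MeasurableSpace.comap Prod.fst (𝓕 t)) _
    (MeasurableSpace.measurableSet_generateFrom ⟨k, s, hst, rfl⟩)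

theorem measurableSet_exercise_eq (𝓕 : Filtration (Fin (T + 1)) mΩ) (k : Fin n)
    (s : Fin (T + 1)) : MeasurableSet[enlargedSigma 𝓕 n s] {w : Enlarged Ω T n | w.2 k = s} := by
  have : {w : Enlarged Ω T n | w.2 k = s} =
      {w | w.2 k ≤ s} \ ⋃ r : Fin (T + 1), ⋃ _ : r < s, {w : Enlarged Ω T n | w.2 k ≤ r} := by
    ext w
    simp only [Set.mem_ofPred_eq, Set.mem_sdiff, Set.mem_iUnion, exists_prop, not_exists, not_and,
      not_le]
    exact ⟨fun h => ⟨h.le, fun r hr => h ▸ hr⟩, fun h => le_antisymm h.1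
      (not_lt.1 fun hlt => lt_irrefl _ (h.2 _ hlt))⟩
  rw [this]
  exact (measurableSet_exercise_le 𝓕 k le_rfl).diff (MeasurableSet.iUnion fun r =>
    MeasurableSet.iUnion fun hr => measurableSet_exercise_le 𝓕 k hr.le)

theorem measurable_exercised {ψ : Fin (T + 1) → Ω → ℝ} (hψ : Adapted 𝓕 ψ) (k : Fin n) :
    Measurable[terminalSigma 𝓕 n] fun w : Enlarged Ω T n => ψ (w.2 k) w.1 :=
  measurable_stopped (adapted_extend n hψ) (measurableSet_exercise_eq 𝓕 k)

instance isProbabilityMeasure_refMeasure (P : Measure Ω) [IsProbabilityMeasure P]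
    (Pn : Measure (Fin n → Fin (T + 1))) [IsProbabilityMeasure Pn] :
    IsProbabilityMeasure (refMeasure 𝓕 P Pn) := by
  refine ⟨?_⟩
  rw [refMeasure, trim_measurableSet_eq _ MeasurableSet.univ]
  exact measure_univ

/-- The finitely many exercise vectors all have positive mass, so null sets can be checked slice by
slice. Measurability of the event is needed because the reference measure is a trimmed product. -/
theorem ae_refMeasure_iff {P : Measure Ω} [IsProbabilityMeasure P]
    {Pn : Measure (Fin n → Fin (T + 1))} [IsProbabilityMeasure Pn] (hPn : ∀ t, 0 < Pn {t})
    {q : Enlarged Ω T n → Prop} (hq : MeasurableSet[terminalSigma 𝓕 n] {w | q w}) :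
    (∀ᵐ w ∂(refMeasure 𝓕 P Pn), q w) ↔ ∀ t, ∀ᵐ ω ∂P, q (ω, t) := by
  have hc : MeasurableSet[terminalSigma 𝓕 n] {w | ¬ q w} := hq.compl
  rw [ae_iff, refMeasure, trim_measurableSet_eq _ hc,
    Measure.measure_prod_null (enlargedSigma_le_prod 𝓕 n (Fin.last T) _ hc), ← ae_all_iff]
  refine eventually_congr (.of_forall fun ω => ?_)
  constructor
  · intro h t
    by_contra ht
    exact (hPn t).ne' (measure_mono_null (Set.singleton_subset_iff.2 ht) h)
  · intro h
    have : Prod.mk ω ⁻¹' {w : Enlarged Ω T n | ¬ q w} = ∅ := by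
      ext t
      simpa using h t
    change Pn (Prod.mk ω ⁻¹' {w : Enlarged Ω T n | ¬ q w}) = 0
    rw [this, measure_empty]

/-! ### Restriction of strategies to a fixed exercise time of the last option -/

/-- With the last exercise time frozen at `u`, the events `{u ≤ s}` are trivial, so freezing reveals
no future information and preserves adaptedness. -/
theorem measurable_snoc (𝓕 : Filtration (Fin (T + 1)) mΩ) (N : ℕ) (u t : Fin (T + 1)) :
    Measurable[enlargedSigma 𝓕 N t, enlargedSigma 𝓕 (N + 1) t]
      (fun w : Enlarged Ω T N => ((w.1, Fin.snoc w.2 u) : Enlarged Ω T (N + 1))) := by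
  rw [measurable_iff_le_map]
  refine sup_le ?_ (MeasurableSpace.generateFrom_le ?_)
  · rintro _ ⟨A, hA, rfl⟩
    exact measurable_enlarged_fst 𝓕 N t hA
  · rintro _ ⟨k, s, hs, rfl⟩
    change MeasurableSet[enlargedSigma 𝓕 N t]
      {w : Enlarged Ω T N | (Fin.snoc w.2 u : Fin (N + 1) → Fin (T + 1)) k ≤ s}
    cases k using Fin.lastCases with
    | last =>
      simp only [Fin.snoc_last]
      exact @MeasurableSet.const _ (enlargedSigma 𝓕 N t) _
    | cast k =>
      simp only [Fin.snoc_castSucc]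
      exact measurableSet_exercise_le 𝓕 k hs

/-- The strategy obtained by fixing the exercise time of the last shorted option. -/
def Strategy.restrict (s : Strategy 𝓕 d L M N (N + 1)) (u : Fin (T + 1)) :
    Strategy 𝓕 d L M N N where
  H := fun t w => s.H t (w.1, Fin.snoc w.2 u)
  a := s.a
  b := s.b
  μ := fun j t w => s.μ j t (w.1, Fin.snoc w.2 u)
  c := s.c
  adapted_H := fun t => (s.adapted_H t).comp (measurable_snoc 𝓕 N u t)
  a_nonneg := s.a_nonneg
  b_nonneg := s.b_nonneg
  liquidating_μ := fun j =>
    ⟨fun t => ((s.liquidating_μ j).adapted t).comp (measurable_snoc 𝓕 N u t),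
      fun t _ => (s.liquidating_μ j).nonneg t _, fun _ => (s.liquidating_μ j).sum_eq_one _⟩
  c_nonneg := s.c_nonneg

theorem payoff_restrict (m : Market 𝓕 d L M N) (p : Prices L M N)
    (s : Strategy 𝓕 d L M N (N + 1)) (u : Fin (T + 1)) (w : Enlarged Ω T N) :
    payoff m p le_rfl (s.restrict u) w =
      payoff m p (Nat.le_add_right N 1) s (w.1, Fin.snoc w.2 u) := by
  have h : ∀ k, m.hExt (le_refl N) k w =
      m.hExt (Nat.le_add_right N 1) k (w.1, Fin.snoc w.2 u) := by
    intro k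
    have : Fin.castLE (Nat.le_add_right N 1) k = k.castSucc := rfl
    simp [Market.hExt, this]
  simp only [payoff, gain, liquidate, Strategy.restrict, h]

theorem measurable_gain {H : Fin (T + 1) → Enlarged Ω T n → (Fin d → ℝ)}
    (hH : Adapted (enlargedFiltration 𝓕 n) H) (m : Market 𝓕 d L M N) :
    Measurable[terminalSigma 𝓕 n] (gain H m.S) := by
  refine Finset.measurable_sum _ fun t _ => Finset.measurable_sum _ fun i _ => ?_
  have hH' : Measurable[terminalSigma 𝓕 n] (H t.castSucc) :=
    (hH _).mono ((enlargedFiltration 𝓕 n).le _) le_rfl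
  have hS : ∀ t, Measurable[terminalSigma 𝓕 n] fun w : Enlarged Ω T n => m.S t w.1 := fun t =>
    (adapted_extend n m.adapted_S t).mono ((enlargedFiltration 𝓕 n).le _) le_rfl
  exact ((measurable_pi_apply i).comp hH').mul
    ((measurable_pi_apply i).comp ((hS _).sub (hS _)))

theorem measurable_liquidate {η : Fin (T + 1) → Enlarged Ω T n → ℝ} (hη : IsLiquidating 𝓕 n η)
    {ψ : Fin (T + 1) → Ω → ℝ} (hψ : Adapted 𝓕 ψ) :
    Measurable[terminalSigma 𝓕 n] (liquidate η ψ) := by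
  refine Finset.measurable_sum _ fun t _ => ?_
  exact ((adapted_extend n hψ t).mono ((enlargedFiltration 𝓕 n).le _) le_rfl).mul
    ((hη.adapted t).mono ((enlargedFiltration 𝓕 n).le _) le_rfl)

theorem measurable_f (m : Market 𝓕 d L M N) (n : ℕ) (i : Fin L) :
    Measurable[terminalSigma 𝓕 n] fun w : Enlarged Ω T n => m.f i w.1 :=
  (m.measurable_f i).comp (measurable_enlarged_fst 𝓕 n (Fin.last T))

theorem measurable_hExt (m : Market 𝓕 d L M N) (hn : N ≤ n) (k : Fin N) :
    Measurable[terminalSigma 𝓕 n] (m.hExt hn k) :=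
  measurable_exercised (m.adapted_h k) _

theorem measurable_payoff (m : Market 𝓕 d L M N) (p : Prices L M N) (hn : N ≤ n)
    (s : Strategy 𝓕 d L M N n) : Measurable[terminalSigma 𝓕 n] (payoff m p hn s) := by
  refine (((measurable_gain s.adapted_H m).add ?_).add ?_).sub ?_
  · exact Finset.measurable_sum _ fun i _ => ((measurable_f m n i).sub_const _).const_mul _
  · exact Finset.measurable_sum _ fun j _ =>
      ((measurable_liquidate (s.liquidating_μ j) (m.adapted_g j)).sub_const _).const_mul _
  · exact Finset.measurable_sum _ fun k _ => ((measurable_hExt m hn k).sub_const _).const_mul _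

/-- No arbitrage carries over to the space enlarged by one more exercise time. -/
theorem NoArbitrage.succ {m : Market 𝓕 d L M N} {p : Prices L M N} {P : Measure Ω}
    [IsProbabilityMeasure P] {PN : Measure (Fin N → Fin (T + 1))} [IsProbabilityMeasure PN]
    (hPN : ∀ t, 0 < PN {t}) {PN1 : Measure (Fin (N + 1) → Fin (T + 1))}
    [IsProbabilityMeasure PN1] (hPN1 : ∀ t, 0 < PN1 {t}) (h : NoArbitrage m p le_rfl P PN) :
    NoArbitrage m p (Nat.le_add_right N 1) P PN1 := by
  intro s hs
  have hm := measurable_payoff m p (Nat.le_add_right N 1) s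
  have hs' := (ae_refMeasure_iff hPN1 (q := fun w => 0 ≤ payoff m p _ s w)
    (hm measurableSet_Ici)).1 hs
  refine (ae_refMeasure_iff hPN1 (q := fun w => payoff m p _ s w = 0)
    (hm (measurableSet_singleton 0))).2 fun t => ?_
  -- On the slice where the last exercise time is `t (Fin.last N)`, the strategy restricts to one on
  -- the smaller space, where no arbitrage is known.
  have hm' := measurable_payoff m p le_rfl (s.restrict (t (Fin.last N)))
  have h0 := h (s.restrict (t (Fin.last N)))
    ((ae_refMeasure_iff hPN (q := fun w => 0 ≤ payoff m p _ (s.restrict _) w)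
      (hm' measurableSet_Ici)).2 fun t' => by
      filter_upwards [hs' (Fin.snoc t' (t (Fin.last N)))] with ω hω
      rwa [payoff_restrict])
  have h1 := (ae_refMeasure_iff hPN (q := fun w => payoff m p _ (s.restrict _) w = 0)
    (hm' (measurableSet_singleton 0))).1 h0
  filter_upwards [h1 (Fin.init t)] with ω hω
  rw [payoff_restrict] at hω
  simpa using hω

end EnlargedSpace

/-! ### The market as a gain module and a finite family of option sets. -/

section TradedAssets

variable {Ω : Type*} {mΩ : MeasurableSpace Ω} {T d L M N n : ℕ}
  {𝓕 : Filtration (Fin (T + 1)) mΩ}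

/-- The gains from dynamic trading in the stocks. -/
def gains (m : Market 𝓕 d L M N) (n : ℕ) : Set (Enlarged Ω T n → ℝ) :=
  gainSpace (fun q : Fin T × Fin d => enlargedSigma 𝓕 n q.1.castSucc)
    (fun q w => m.S q.1.succ w.1 q.2 - m.S q.1.castSucc w.1 q.2) Finset.univ

theorem gain_mem_gains (m : Market 𝓕 d L M N) {H : Fin (T + 1) → Enlarged Ω T n → (Fin d → ℝ)}
    (hH : Adapted (enlargedFiltration 𝓕 n) H) : gain H m.S ∈ gains m n := by
  refine ⟨fun q w => H q.1.castSucc w q.2, fun q => ?_, ?_⟩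
  · have h : Measurable[enlargedSigma 𝓕 n q.1.castSucc] (H q.1.castSucc) := hH _
    exact (measurable_pi_apply q.2).comp h
  · ext w
    rw [Fintype.sum_prod_type]
    rfl

theorem exists_gain_of_mem_gains (m : Market 𝓕 d L M N) {r : Enlarged Ω T n → ℝ}
    (hr : r ∈ gains m n) : ∃ H : Fin (T + 1) → Enlarged Ω T n → (Fin d → ℝ),
      Adapted (enlargedFiltration 𝓕 n) H ∧ r = gain H m.S := by
  obtain ⟨h, hh, rfl⟩ := hr
  -- The position at the terminal time earns nothing and is set to `0`.
  refine ⟨Fin.lastCases (fun _ => 0) (fun t w i => h (t, i) w), fun t => ?_, ?_⟩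
  · cases t using Fin.lastCases with
    | last =>
      beta_reduce
      rw [Fin.lastCases_last]
      exact measurable_const
    | cast t =>
      beta_reduce
      rw [Fin.lastCases_castSucc]
      exact @measurable_pi_lambda _ _ _ (enlargedSigma 𝓕 n t.castSucc) _ _ fun i => hh (t, i)
  · ext w
    rw [Fintype.sum_prod_type]
    simp only [gain, Fin.lastCases_castSucc]
    rfl

theorem isMeasurableModule_gains (m : Market 𝓕 d L M N) (n : ℕ) :
    IsMeasurableModule ⊥ (gains m n) :=
  isMeasurableModule_gainSpace _ fun _ _ => bot_le

theorem seqClosedAE_gains {m : Market 𝓕 d L M N} {μ : Measure[terminalSigma 𝓕 n] (Enlarged Ω T n)}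
    (hNA : NoFreeLunch μ (gains m n)) : SeqClosedAE μ (hedgeable μ (gains m n)) :=
  seqClosedAE_hedgeable_gainSpace (fun q : Fin T × Fin d => q.1)
    (fun _ _ h => enlargedSigma_mono 𝓕 n (Fin.castSucc_le_castSucc_iff.2 h)) _ hNA

/-- The payoffs of liquidating strategies for an American option. -/
def liquidations (𝓕 : Filtration (Fin (T + 1)) mΩ) (n : ℕ) (ψ : Fin (T + 1) → Ω → ℝ) :
    Set (Enlarged Ω T n → ℝ) :=
  {v | ∃ η, IsLiquidating 𝓕 n η ∧ v = liquidate η ψ}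

theorem abs_liquidate_le {η : Fin (T + 1) → Enlarged Ω T n → ℝ} (hη : IsLiquidating 𝓕 n η)
    {ψ : Fin (T + 1) → Ω → ℝ} {K : ℝ} (hK : ∀ t ω, |ψ t ω| ≤ K) (w : Enlarged Ω T n) :
    |liquidate η ψ w| ≤ K := by
  calc |liquidate η ψ w| ≤ ∑ t, |ψ t w.1 * η t w| := Finset.abs_sum_le_sum_abs _ _
    _ ≤ ∑ t, K * η t w := Finset.sum_le_sum fun t _ => by
        rw [abs_mul, abs_of_nonneg (hη.nonneg t w)]
        exact mul_le_mul_of_nonneg_right (hK t w.1) (hη.nonneg t w)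
    _ = K := by rw [← Finset.mul_sum, hη.sum_eq_one, mul_one]

/-- The liquidating strategy that exercises at time `0`. -/
theorem exists_isLiquidating (𝓕 : Filtration (Fin (T + 1)) mΩ) (n : ℕ) :
    ∃ η : Fin (T + 1) → Enlarged Ω T n → ℝ, IsLiquidating 𝓕 n η :=
  ⟨fun t _ => if t = 0 then 1 else 0, fun _ => measurable_const,
    fun t _ => by split_ifs <;> norm_num, fun _ => by simp⟩

theorem isOptionSet_liquidations {μ : Measure[terminalSigma 𝓕 n] (Enlarged Ω T n)}
    [IsFiniteMeasure μ] {ψ : Fin (T + 1) → Ω → ℝ} (hψ : Adapted 𝓕 ψ) {K : ℝ}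
    (hK : ∀ t ω, |ψ t ω| ≤ K) : IsOptionSet μ (liquidations 𝓕 n ψ) where
  nonempty := by
    obtain ⟨η, hη⟩ := exists_isLiquidating 𝓕 n
    exact ⟨_, η, hη, rfl⟩
  measurable := by
    rintro _ ⟨η, hη, rfl⟩
    exact measurable_liquidate hη hψ
  bounded := ⟨K, by
    rintro _ ⟨η, hη, rfl⟩ w
    exact abs_liquidate_le hη hK w⟩
  convex := by
    rintro _ ⟨η, hη, rfl⟩ _ ⟨θ, hθ, rfl⟩ a b ha hb hab
    refine ⟨fun t w => a * η t w + b * θ t w, ⟨fun t => ((hη.adapted t).const_mul a).add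
      ((hθ.adapted t).const_mul b), fun t w => add_nonneg (mul_nonneg ha (hη.nonneg t w))
      (mul_nonneg hb (hθ.nonneg t w)), fun w => ?_⟩, ?_⟩
    · rw [Finset.sum_add_distrib, ← Finset.mul_sum, ← Finset.mul_sum, hη.sum_eq_one,
        hθ.sum_eq_one, mul_one, mul_one, hab]
    · ext w
      simp only [liquidate, Pi.add_apply, Pi.smul_apply, smul_eq_mul, Finset.mul_sum, mul_add,
        Finset.sum_add_distrib]
      congr 1 <;> exact Finset.sum_congr rfl fun t _ => by ring
  closed := by
    intro δ v hδ hv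
    choose η hη hηδ using hδ
    obtain ⟨s, w, hw, η', h1, h2, h3, h4⟩ := exists_liquidating_limit (Q := μ)
      (fun n => (hη n).adapted) (fun n => (hη n).nonneg) (fun n => (hη n).sum_eq_one)
    refine ⟨_, ⟨η', ⟨h1, h2, h3⟩, rfl⟩, ?_⟩
    filter_upwards [hv, h4] with x hx1 hx2
    have h5 := hw.tendsto hx1
    have h6 : Tendsto (fun n => ∑ t, ψ t x.1 * ∑ m ∈ s n, w n m * η m t x) atTop
        (𝓝 (liquidate η' ψ x)) := tendsto_finsetSum _ fun t _ => (hx2 t).const_mul _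
    refine (tendsto_nhds_unique h5 (h6.congr fun n => ?_)).le
    simp only [hηδ, liquidate, Finset.mul_sum]
    rw [Finset.sum_comm]
    exact Finset.sum_congr rfl fun m _ => Finset.sum_congr rfl fun t _ => by ring

theorem isOptionSet_singleton {X : Type*} {m0 : MeasurableSpace X} {μ : Measure X} {δ : X → ℝ}
    (hδ : Measurable δ) {K : ℝ} (hK : ∀ x, |δ x| ≤ K) : IsOptionSet μ {δ} where
  nonempty := Set.singleton_nonempty δ
  measurable := by rintro _ rfl; exact hδ
  bounded := ⟨K, by rintro _ rfl; exact hK⟩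
  convex := convex_singleton δ
  closed := by
    intro γ v hγ hv
    refine ⟨δ, rfl, ?_⟩
    filter_upwards [hv] with x hx
    simp only [Set.mem_singleton_iff] at hγ
    simp only [hγ] at hx
    exact (tendsto_nhds_unique hx tendsto_const_nhds).le

/-- The payoffs, net of prices, of the traded options. -/
def optionPayoffs (m : Market 𝓕 d L M N) (p : Prices L M N) (hn : N ≤ n) :
    Fin L ⊕ Fin M ⊕ Fin N → Set (Enlarged Ω T n → ℝ)
  | Sum.inl i => {fun w => m.f i w.1 - p.α i}
  | Sum.inr (Sum.inl j) => translate (-p.β j) (liquidations 𝓕 n (m.g j))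
  | Sum.inr (Sum.inr k) => {fun w => -(m.hExt hn k w - p.γ k)}

theorem isOptionSet_optionPayoffs {μ : Measure[terminalSigma 𝓕 n] (Enlarged Ω T n)}
    [IsFiniteMeasure μ] (m : Market 𝓕 d L M N) (p : Prices L M N) (hn : N ≤ n)
    (j : Fin L ⊕ Fin M ⊕ Fin N) : IsOptionSet μ (optionPayoffs m p hn j) := by
  rcases j with i | j | k
  · obtain ⟨C, hC⟩ := m.bounded_f
    exact isOptionSet_singleton ((measurable_f m n i).sub_const _) (K := C + |p.α i|) fun w =>
      (abs_sub _ _).trans (add_le_add_left (hC i w.1) _)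
  · obtain ⟨C, hC⟩ := m.bounded_g
    exact (isOptionSet_liquidations (m.adapted_g j) (hC j)).translate _
  · obtain ⟨C, hC⟩ := m.bounded_h
    refine isOptionSet_singleton ((measurable_hExt m hn k).sub_const _).neg
      (K := C + |p.γ k|) fun w => ?_
    rw [abs_neg]
    exact (abs_sub _ _).trans (add_le_add_left (hC k _ w.1) _)

theorem exists_payoff_eq (m : Market 𝓕 d L M N) (p : Prices L M N) (hn : N ≤ n)
    (s : Strategy 𝓕 d L M N n) : ∃ r ∈ gains m n, ∃ b : Fin L ⊕ Fin M ⊕ Fin N → ℝ,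
      (∀ j, 0 ≤ b j) ∧ ∃ δ : Fin L ⊕ Fin M ⊕ Fin N → Enlarged Ω T n → ℝ,
        (∀ j, δ j ∈ optionPayoffs m p hn j) ∧
          ∀ w, payoff m p hn s w = r w + ∑ j, b j * δ j w := by
  refine ⟨_, gain_mem_gains m s.adapted_H, Sum.elim s.a (Sum.elim s.b s.c), ?_,
    Sum.elim (fun i w => m.f i w.1 - p.α i) (Sum.elim
      (fun j w => liquidate (s.μ j) (m.g j) w + -p.β j)
      (fun k w => -(m.hExt hn k w - p.γ k))), ?_, fun w => ?_⟩
  · rintro (i | j | k)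
    exacts [s.a_nonneg i, s.b_nonneg j, s.c_nonneg k]
  · rintro (i | j | k)
    exacts [rfl, ⟨_, ⟨_, s.liquidating_μ j, rfl⟩, rfl⟩, rfl]
  · simp only [payoff, Fintype.sum_sum_type, Sum.elim_inl, Sum.elim_inr, mul_neg,
      Finset.sum_neg_distrib, ← sub_eq_add_neg]
    ring

theorem exists_strategy_eq (m : Market 𝓕 d L M N) (p : Prices L M N) (hn : N ≤ n)
    {r : Enlarged Ω T n → ℝ} (hr : r ∈ gains m n) {b : Fin L ⊕ Fin M ⊕ Fin N → ℝ}
    (hb : ∀ j, 0 ≤ b j) {δ : Fin L ⊕ Fin M ⊕ Fin N → Enlarged Ω T n → ℝ}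
    (hδ : ∀ j, δ j ∈ optionPayoffs m p hn j) :
    ∃ s : Strategy 𝓕 d L M N n, s.a = (fun i => b (Sum.inl i)) ∧
      s.b = (fun j => b (Sum.inr (Sum.inl j))) ∧ s.c = (fun k => b (Sum.inr (Sum.inr k))) ∧
        ∀ w, payoff m p hn s w = r w + ∑ j, b j * δ j w := by
  obtain ⟨H, hH, rfl⟩ := exists_gain_of_mem_gains m hr
  have hg : ∀ j : Fin M, ∃ η, IsLiquidating 𝓕 n η ∧
      δ (Sum.inr (Sum.inl j)) = fun w => liquidate η (m.g j) w + -p.β j := by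
    intro j
    obtain ⟨_, ⟨η, hη, rfl⟩, h⟩ := hδ (Sum.inr (Sum.inl j))
    exact ⟨η, hη, h⟩
  choose μ hμ hμδ using hg
  have hf : ∀ i : Fin L, δ (Sum.inl i) = fun w => m.f i w.1 - p.α i := fun i => hδ (Sum.inl i)
  have hh : ∀ k : Fin N, δ (Sum.inr (Sum.inr k)) = fun w => -(m.hExt hn k w - p.γ k) :=
    fun k => hδ (Sum.inr (Sum.inr k))
  refine ⟨⟨H, fun i => b (Sum.inl i), fun j => b (Sum.inr (Sum.inl j)), μ,
    fun k => b (Sum.inr (Sum.inr k)), hH, fun i => hb _, fun j => hb _, hμ, fun k => hb _⟩,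
    rfl, rfl, rfl, fun w => ?_⟩
  simp only [payoff, Fintype.sum_sum_type, hf, hh, hμδ, mul_neg, Finset.sum_neg_distrib,
    ← sub_eq_add_neg]
  ring

theorem payoff_shift (m : Market 𝓕 d L M N) (p : Prices L M N) (hn : N ≤ n) (ε : ℝ)
    (s : Strategy 𝓕 d L M N n) (w : Enlarged Ω T n) : payoff m (p.shift ε) hn s w =
      payoff m p hn s w + ε * (∑ i, s.a i + ∑ j, s.b j + ∑ k, s.c k) := by
  have h1 : ∀ i, s.a i * (m.f i w.1 - (p.α i - ε)) = s.a i * (m.f i w.1 - p.α i) + ε * s.a i :=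
    fun i => by ring
  have h2 : ∀ j, s.b j * (liquidate (s.μ j) (m.g j) w - (p.β j - ε)) =
      s.b j * (liquidate (s.μ j) (m.g j) w - p.β j) + ε * s.b j := fun j => by ring
  have h3 : ∀ k, s.c k * (m.hExt hn k w - (p.γ k + ε)) =
      s.c k * (m.hExt hn k w - p.γ k) - ε * s.c k := fun k => by ring
  simp only [payoff, Prices.shift, h1, h2, h3, Finset.sum_add_distrib, Finset.sum_sub_distrib,
    ← Finset.mul_sum]
  ring

variable {m : Market 𝓕 d L M N} {p : Prices L M N} {hn : N ≤ n} {P : Measure Ω}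
  [IsProbabilityMeasure P] {Pn : Measure (Fin n → Fin (T + 1))} [IsProbabilityMeasure Pn]

theorem NoArbitrage.noFreeLunch (h : NoArbitrage m p hn P Pn) :
    NoFreeLunch (refMeasure 𝓕 P Pn) (gains m n) := by
  intro r hr hr0
  choose δ hδ using fun j => (isOptionSet_optionPayoffs (μ := refMeasure 𝓕 P Pn) m p hn j).nonempty
  obtain ⟨s, -, -, -, hs⟩ := exists_strategy_eq m p hn hr (b := fun _ => 0) (fun _ => le_rfl) hδ
  simp only [zero_mul, Finset.sum_const_zero, add_zero] at hs
  have := h s (by simpa only [hs] using hr0)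
  simpa only [hs] using this

theorem StrictNoArbitrage.noFreeLunch (h : StrictNoArbitrage m p hn P Pn) :
    NoFreeLunch (refMeasure 𝓕 P Pn) (gains m n) := by
  obtain ⟨ε, -, hNA⟩ := h
  exact hNA.noFreeLunch

/-- At the prices shifted by `ε` a strategy earns `ε` times its total option holding in addition. If
its payoff was nonnegative before, no arbitrage at the shifted prices makes that extra gain vanish.
-/
theorem StrictNoArbitrage.noFreeOptions (h : StrictNoArbitrage m p hn P Pn) :
    NoFreeOptions (refMeasure 𝓕 P Pn) (gains m n) (optionPayoffs m p hn) 0 := by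
  obtain ⟨ε, hε, hNA⟩ := h
  intro r hr b hb δ hδ h0
  obtain ⟨s, ha, hb', hc, hs⟩ := exists_strategy_eq m p hn hr hb hδ
  simp only [add_zero, ← hs] at h0
  have hsum : ∑ i, s.a i + ∑ j, s.b j + ∑ k, s.c k = ∑ j, b j := by
    rw [ha, hb', hc]
    simp only [Fintype.sum_sum_type]
    ring
  have hpos : 0 ≤ ∑ j, b j := Finset.sum_nonneg fun j _ => hb j
  have h1 := hNA s (by
    filter_upwards [h0] with w hw
    rw [payoff_shift, hsum]
    exact add_nonneg hw (mul_nonneg hε.le hpos))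
  obtain ⟨w, hw0, hw1⟩ := (h0.and h1).exists
  rw [payoff_shift, hsum] at hw1
  have h2 : ε * ∑ j, b j = 0 := by
    have := mul_nonneg hε.le hpos
    linarith
  have h3 : ∑ j, b j = 0 := (mul_eq_zero.1 h2).resolve_left hε.ne'
  intro j
  exact (Finset.sum_eq_zero_iff_of_nonneg fun j _ => hb j).1 h3 j (Finset.mem_univ j)

end TradedAssets

/-! ### Pricing measures and the two hedging dualities. -/

section Pricing

variable {Ω : Type*} {mΩ : MeasurableSpace Ω} {T d L M N n : ℕ}
  {𝓕 : Filtration (Fin (T + 1)) mΩ}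

theorem mem_stoppingTimes_iff {τ : Enlarged Ω T n → Fin (T + 1)} :
    τ ∈ stoppingTimes 𝓕 n ↔ ∀ s, MeasurableSet[enlargedSigma 𝓕 n s] {w | τ w = s} := by
  constructor
  · intro h s
    have h1 := IsStoppingTime.measurableSet_eq (show IsStoppingTime _ _ from h) s
    simp only [WithTop.coe_inj] at h1
    exact h1
  · intro h
    refine isStoppingTime_of_measurableSet_eq fun s => ?_
    simp only [WithTop.coe_inj]
    exact h s

theorem integral_liquidate_le_optimalStopping
    {Q : Measure[terminalSigma 𝓕 n] (Enlarged Ω T n)} [IsFiniteMeasure Q]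
    {ψ : Fin (T + 1) → Ω → ℝ} (hψ : Adapted 𝓕 ψ) {K : ℝ} (hK : ∀ t ω, |ψ t ω| ≤ K)
    {η : Fin (T + 1) → Enlarged Ω T n → ℝ} (hη : IsLiquidating 𝓕 n η) :
    ((∫ w, liquidate η ψ w ∂Q : ℝ) : EReal) ≤ optimalStopping 𝓕 Q ψ := by
  obtain ⟨τ, hτ, hopt⟩ := exists_stoppingTime_ge (Q := Q) (adapted_extend n hψ)
    (fun t w => hK t w.1)
  have h1 : ∫ w, liquidate η ψ w ∂Q ≤ ∫ w, ψ (τ w) w.1 ∂Q := by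
    refine le_trans (le_of_eq ?_) (hopt η hη.adapted hη.nonneg hη.sum_eq_one)
    simp only [liquidate, mul_comm]
  exact (EReal.coe_le_coe_iff.2 h1).trans
    (le_iSup₂ (f := fun (τ : Enlarged Ω T n → Fin (T + 1)) (_ : τ ∈ stoppingTimes 𝓕 n) =>
      ((∫ w, ψ (τ w) w.1 ∂Q : ℝ) : EReal)) τ (mem_stoppingTimes_iff.2 hτ))

/-- A stopping time is the liquidating strategy that sells everything at once. Together with the
reverse comparison, suprema over liquidations and over stopping times coincide for bounded adapted
payoffs under finite measures. -/
theorem optimalStopping_le {Q : Measure[terminalSigma 𝓕 n] (Enlarged Ω T n)}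
    {ψ : Fin (T + 1) → Ω → ℝ} {y : ℝ}
    (h : ∀ η, IsLiquidating 𝓕 n η → ∫ w, liquidate η ψ w ∂Q ≤ y) :
    optimalStopping 𝓕 Q ψ ≤ (y : EReal) := by
  refine iSup₂_le fun τ hτ => EReal.coe_le_coe_iff.2 ?_
  rw [mem_stoppingTimes_iff] at hτ
  have h1 := h (fun t => {w | τ w = t}.indicator 1)
    ⟨fun t => (@measurable_const ℝ _ _ (enlargedSigma 𝓕 n t) 1).indicator (hτ t),
      fun t w => Set.indicator_nonneg (fun _ _ => zero_le_one) w,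
      fun w => by simp [Set.indicator_apply]⟩
  refine le_trans (le_of_eq ?_) h1
  congr 1
  ext w
  simp [liquidate, Set.indicator_apply]

variable {m : Market 𝓕 d L M N} {p : Prices L M N} {hn : N ≤ n} {P : Measure Ω}
  {Pn : Measure (Fin n → Fin (T + 1))}

/-- Payoffs of semi-static strategies have nonpositive expectation under pricing measures. -/
theorem IsPricingMeasure.integral_nonpos {Q : Measure[terminalSigma 𝓕 n] (Enlarged Ω T n)}
    (hQ : IsPricingMeasure m p hn P Pn Q) (s : Strategy 𝓕 d L M N n) {y : Enlarged Ω T n → ℝ}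
    (hy : Integrable y Q) (hle : ∀ᵐ w ∂(refMeasure 𝓕 P Pn), y w ≤ payoff m p hn s w) :
    ∫ w, y w ∂Q ≤ 0 := by
  have := hQ.probability
  have hint : ∀ {δ : Enlarged Ω T n → ℝ} {D : Set (Enlarged Ω T n → ℝ)},
      IsOptionSet Q D → δ ∈ D → Integrable δ Q := by
    intro δ D hD hδ
    obtain ⟨K, hK⟩ := hD.bounded
    exact Integrable.of_bound (hD.measurable δ hδ).aestronglyMeasurable K
      (.of_forall fun x => hK δ hδ x)
  have hD := fun j => isOptionSet_optionPayoffs (μ := Q) m p hn j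
  obtain ⟨r, hr, b, hb, δ, hδ, hs⟩ := exists_payoff_eq m p hn s
  have hδ0 : ∀ j, ∫ w, δ j w ∂Q ≤ 0 := by
    rintro (i | j | k)
    · have h1 : δ (Sum.inl i) = fun w => m.f i w.1 - p.α i := hδ (Sum.inl i)
      obtain ⟨C, hC⟩ := m.bounded_f
      have h2 := hint (isOptionSet_singleton (μ := Q) (measurable_f m n i) fun w => hC i w.1) rfl
      rw [h1, integral_sub h2 (integrable_const _)]
      simpa using (hQ.f_lt i).le
    · obtain ⟨_, ⟨η, hη, rfl⟩, h1⟩ := hδ (Sum.inr (Sum.inl j))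
      obtain ⟨C, hC⟩ := m.bounded_g
      have h2 := hint (isOptionSet_liquidations (μ := Q) (m.adapted_g j) (hC j)) ⟨η, hη, rfl⟩
      have h3 := (integral_liquidate_le_optimalStopping (Q := Q) (m.adapted_g j) (hC j)
        hη).trans_lt (hQ.g_lt j)
      rw [EReal.coe_lt_coe_iff] at h3
      rw [h1, integral_add h2 (integrable_const _)]
      simpa using h3.le
    · have h1 : δ (Sum.inr (Sum.inr k)) = fun w => -(m.hExt hn k w - p.γ k) :=
        hδ (Sum.inr (Sum.inr k))
      obtain ⟨C, hC⟩ := m.bounded_h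
      have h2 := hint (isOptionSet_singleton (μ := Q) (measurable_hExt m hn k)
        fun w => hC k _ w.1) rfl
      rw [h1, integral_neg, integral_sub h2 (integrable_const _)]
      simpa using (hQ.lt_h k).le
  have hsum : Integrable (fun w => ∑ j, b j * δ j w) Q :=
    integrable_finsetSum _ fun j _ => (hint (hD j) (hδ j)).const_mul _
  -- Only the claim net of its bounded option part must be integrable; the dynamic gain itself need
  -- not be.
  have hkey : ∫ w, (y w - ∑ j, b j * δ j w) ∂Q ≤ 0 := by
    refine integral_nonpos_of_le_gain (fun q : Fin T × Fin d => q.1)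
      (fun _ _ h => enlargedSigma_mono 𝓕 n (Fin.castSucc_le_castSucc_iff.2 h))
      (fun q => enlargedSigma_mono 𝓕 n (Fin.le_last _)) Finset.univ
      (fun q => ((hQ.martingale.integrable _).eval q.2).sub
        ((hQ.martingale.integrable _).eval q.2)) ?_ _ (hy.sub hsum) ⟨r, hr, ?_⟩
    · rintro q c hc ⟨K, hK⟩
      exact integral_mul_increment_eq_zero hQ.martingale Fin.castSucc_lt_succ.le q.2 hc hK
    · filter_upwards [hQ.abs_cont.ae_le hle] with w hw
      rw [hs] at hw
      linarith
  rw [integral_sub hy hsum, integral_finsetSum _ fun j _ => (hint (hD j) (hδ j)).const_mul _] at hkey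
  have : ∑ j, ∫ w, b j * δ j w ∂Q ≤ 0 := Finset.sum_nonpos fun j _ => by
    rw [integral_const_mul]
    exact mul_nonpos_of_nonneg_of_nonpos (hb j) (hδ0 j)
  linarith

/-- A function dominating the stock prices. -/
def priceBound (m : Market 𝓕 d L M N) (n : ℕ) (w : Enlarged Ω T n) : ℝ :=
  1 + ∑ t, ∑ i, |m.S t w.1 i|

theorem abs_price_le (m : Market 𝓕 d L M N) (n : ℕ) (w : Enlarged Ω T n) (t : Fin (T + 1))
    (i : Fin d) : |m.S t w.1 i| ≤ priceBound m n w := by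
  have h1 : |m.S t w.1 i| ≤ ∑ i, |m.S t w.1 i| :=
    Finset.single_le_sum (f := fun i => |m.S t w.1 i|) (fun _ _ => abs_nonneg _) (Finset.mem_univ i)
  have h2 : ∑ i, |m.S t w.1 i| ≤ ∑ t, ∑ i, |m.S t w.1 i| :=
    Finset.single_le_sum (f := fun t => ∑ i, |m.S t w.1 i|)
      (fun _ _ => Finset.sum_nonneg fun _ _ => abs_nonneg _) (Finset.mem_univ t)
  unfold priceBound
  linarith

theorem one_le_priceBound (m : Market 𝓕 d L M N) (n : ℕ) (w : Enlarged Ω T n) :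
    1 ≤ priceBound m n w := by
  have : 0 ≤ ∑ t, ∑ i, |m.S t w.1 i| :=
    Finset.sum_nonneg fun _ _ => Finset.sum_nonneg fun _ _ => abs_nonneg _
  unfold priceBound
  linarith

theorem measurable_price (m : Market 𝓕 d L M N) (n : ℕ) (t : Fin (T + 1)) :
    Measurable[terminalSigma 𝓕 n] fun w : Enlarged Ω T n => m.S t w.1 :=
  (adapted_extend n m.adapted_S t).mono ((enlargedFiltration 𝓕 n).le _) le_rfl

theorem measurable_priceBound (m : Market 𝓕 d L M N) (n : ℕ) :
    Measurable[terminalSigma 𝓕 n] (priceBound m n) := by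
  refine measurable_const.add (Finset.measurable_sum _ fun t _ => Finset.measurable_sum _ fun i _ =>
    measurable_abs.comp ((measurable_pi_apply i).comp (measurable_price m n t)))

theorem mem_coverable_iff {D' : Set (Enlarged Ω T n → ℝ)} {y : ℝ} :
    y ∈ coverable (refMeasure 𝓕 P Pn) (gains m n) (optionPayoffs m p hn) D' ↔
      ∃ s : Strategy 𝓕 d L M N n, ∃ δ ∈ D',
        ∀ᵐ w ∂(refMeasure 𝓕 P Pn), y ≤ payoff m p hn s w + δ w := by
  constructor
  · rintro ⟨r, hr, b, hb, δ, hδ, δ', hδ', h⟩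
    obtain ⟨s, -, -, -, hs⟩ := exists_strategy_eq m p hn hr hb hδ
    exact ⟨s, δ', hδ', by simpa only [hs] using h⟩
  · rintro ⟨s, δ', hδ', h⟩
    obtain ⟨r, hr, b, hb, δ, hδ, hs⟩ := exists_payoff_eq m p hn s
    exact ⟨r, hr, b, hb, δ, hδ, δ', hδ', by simpa only [hs] using h⟩

variable [IsProbabilityMeasure P] [IsProbabilityMeasure Pn]

/-- If a debt cannot be covered by semi-static strategies and payoffs in `D'`, then some pricing
measure prices all payoffs in `D'` below it. -/
theorem StrictNoArbitrage.exists_isPricingMeasure (h : StrictNoArbitrage m p hn P Pn)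
    {D' : Set (Enlarged Ω T n → ℝ)} (hD' : IsOptionSet (refMeasure 𝓕 P Pn) D') {y : ℝ}
    (hy : y ∉ coverable (refMeasure 𝓕 P Pn) (gains m n) (optionPayoffs m p hn) D') :
    ∃ Q, IsPricingMeasure m p hn P Pn Q ∧ ∀ δ ∈ D', ∫ w, δ w ∂Q ≤ y := by
  obtain ⟨Q, hQ, h1, h2, h3, h4, ⟨ε, hε, h5⟩, h6⟩ := exists_measure_of_notMem_coverable
    (isMeasurableModule_gains m n) (seqClosedAE_gains h.noFreeLunch) h.noFreeLunch
    (isOptionSet_optionPayoffs m p hn) h.noFreeOptions hD' (measurable_priceBound m n)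
    (one_le_priceBound m n) hy
  have hbdd : ∀ {δ : Enlarged Ω T n → ℝ}, Measurable[terminalSigma 𝓕 n] δ →
      ∀ {K : ℝ}, (∀ w, |δ w| ≤ K) → Integrable δ Q := fun hδ K hK =>
    Integrable.of_bound hδ.aestronglyMeasurable K (.of_forall hK)
  refine ⟨Q, ⟨hQ, h1, h2, ?_, fun i => ?_, fun k => ?_, fun j => ?_⟩, h6⟩
  · refine martingale_of_setIntegral_increment (adapted_extend n m.adapted_S) (fun t => ?_)
      fun t i B hB => ?_
    · refine h3.mono (measurable_price m n t).aestronglyMeasurable (.of_forall fun w => ?_)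
      rw [Real.norm_of_nonneg (zero_le_one.trans (one_le_priceBound m n w))]
      exact (pi_norm_le_iff_of_nonneg (zero_le_one.trans (one_le_priceBound m n w))).2
        fun i => abs_price_le m n w t i
    · have hkey : ∀ c : ℝ, |c| ≤ 1 →
          ∫ w, c * B.indicator (fun w => m.S t.succ w.1 i - m.S t.castSucc w.1 i) w ∂Q ≤ 0 := by
        intro c hc
        have hBm : MeasurableSet[terminalSigma 𝓕 n] B := (enlargedFiltration 𝓕 n).le _ _ hB
        refine h4 _ ?_ ?_ ⟨2, fun w => ?_⟩
        · refine ⟨fun q w => if q = (t, i) then c * B.indicator 1 w else 0, fun q => ?_, ?_⟩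
          · by_cases hq : q = (t, i)
            · subst hq
              simp only [if_true]
              exact ((@measurable_const ℝ _ _ (enlargedSigma 𝓕 n t.castSucc) 1).indicator
                hB).const_mul c
            · simp only [hq, if_false]
              exact measurable_const
          · ext w
            simp only [ite_mul, zero_mul, Finset.sum_ite_eq', Finset.mem_univ, if_true]
            by_cases hw : w ∈ B <;> simp [hw]
        · exact ((((measurable_pi_apply i).comp (measurable_price m n t.succ)).sub
            ((measurable_pi_apply i).comp (measurable_price m n t.castSucc))).indicator
            hBm).const_mul c
        · rw [abs_mul]
          have h7 := abs_price_le m n w t.succ i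
          have h8 := abs_price_le m n w t.castSucc i
          have h9 : |B.indicator (fun w => m.S t.succ w.1 i - m.S t.castSucc w.1 i) w| ≤
              2 * priceBound m n w := by
            by_cases hw : w ∈ B
            · rw [Set.indicator_of_mem hw]
              exact (abs_sub _ _).trans (by linarith)
            · rw [Set.indicator_of_notMem hw, abs_zero]
              linarith [one_le_priceBound m n w]
          exact (mul_le_of_le_one_left (abs_nonneg _) hc).trans h9
      have h7 := hkey 1 (by norm_num)
      have h8 := hkey (-1) (by norm_num)
      rw [integral_const_mul, integral_indicator ((enlargedFiltration 𝓕 n).le _ _ hB)] at h7 h8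
      linarith
  · obtain ⟨C, hC⟩ := m.bounded_f
    have h7 := h5 (Sum.inl i) _ rfl
    rw [integral_sub (hbdd (measurable_f m n i) fun w => hC i w.1) (integrable_const _)] at h7
    simp only [integral_const, probReal_univ, smul_eq_mul, one_mul] at h7
    linarith
  · obtain ⟨C, hC⟩ := m.bounded_h
    have h7 := h5 (Sum.inr (Sum.inr k)) _ rfl
    rw [integral_neg, integral_sub (hbdd (measurable_hExt m hn k) fun w => hC k _ w.1)
      (integrable_const _)] at h7
    simp only [integral_const, probReal_univ, smul_eq_mul, one_mul] at h7
    linarith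
  · obtain ⟨C, hC⟩ := m.bounded_g
    -- The gap `ε` is uniform over liquidating strategies, so the supremum is at most `p.β j - ε`
    -- and remains strictly below the price.
    refine (optimalStopping_le ?_).trans_lt (EReal.coe_lt_coe_iff.2 (sub_lt_self (p.β j) hε))
    intro η hη
    have h7 := h5 (Sum.inr (Sum.inl j)) _ ⟨_, ⟨η, hη, rfl⟩, rfl⟩
    rw [integral_add (hbdd (measurable_liquidate hη (m.adapted_g j)) (abs_liquidate_le hη (hC j)))
      (integrable_const _)] at h7
    simp only [integral_const, probReal_univ, smul_eq_mul, one_mul] at h7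
    linarith

theorem StrictNoArbitrage.exists_isGreatest (h : StrictNoArbitrage m p hn P Pn)
    {D' : Set (Enlarged Ω T n → ℝ)} (hD' : IsOptionSet (refMeasure 𝓕 P Pn) D') :
    ∃ y, IsGreatest (coverable (refMeasure 𝓕 P Pn) (gains m n) (optionPayoffs m p hn) D') y :=
  exists_isGreatest_coverable (isMeasurableModule_gains m n) (seqClosedAE_gains h.noFreeLunch)
    h.noFreeLunch (isOptionSet_optionPayoffs m p hn) h.noFreeOptions hD'

theorem subHedging_duality {m : Market 𝓕 d L M N} {PN : Measure (Fin N → Fin (T + 1))}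
    [IsProbabilityMeasure PN] (h : StrictNoArbitrage m p le_rfl P PN)
    {φ : Fin (T + 1) → Ω → ℝ} (hφ : Adapted 𝓕 φ) {C : ℝ} (hC : ∀ t ω, |φ t ω| ≤ C) :
    ∃ x : ℝ, subHedgingPrice m p P PN φ = (x : EReal) ∧
      (∃ s η, SubHedges m p P PN φ x s η) ∧
      (x : EReal) = ⨅ Q ∈ {Q | IsPricingMeasure m p le_rfl P PN Q}, optimalStopping 𝓕 Q φ := by
  have hD' := isOptionSet_liquidations (μ := refMeasure 𝓕 P PN) hφ hC
  obtain ⟨x, hx, hmax⟩ := h.exists_isGreatest hD'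
  have hset : ∀ y : ℝ, (∃ s η, SubHedges m p P PN φ y s η) ↔
      y ∈ coverable (refMeasure 𝓕 P PN) (gains m N) (optionPayoffs m p le_rfl)
        (liquidations 𝓕 N φ) := by
    intro y
    rw [mem_coverable_iff]
    constructor
    · rintro ⟨s, η, hη, hle⟩
      exact ⟨s, _, ⟨η, hη, rfl⟩, hle⟩
    · rintro ⟨s, _, ⟨η, hη, rfl⟩, hle⟩
      exact ⟨s, η, hη, hle⟩
  refine ⟨x, le_antisymm ?_ ?_, (hset x).2 hx, le_antisymm ?_ ?_⟩
  · exact iSup₂_le fun y hy => EReal.coe_le_coe_iff.2 (hmax ((hset y).1 hy))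
  · exact le_iSup₂ (f := fun (y : ℝ) (_ : y ∈ {y : ℝ | ∃ s η, SubHedges m p P PN φ y s η}) =>
      (y : EReal)) x ((hset x).2 hx)
  · refine le_iInf₂ fun Q hQ => ?_
    obtain ⟨s, η, hη, hle⟩ := (hset x).2 hx
    have := hQ.probability
    refine le_trans (EReal.coe_le_coe_iff.2 ?_) (integral_liquidate_le_optimalStopping hφ hC hη)
    have hint : Integrable (liquidate η φ) Q :=
      Integrable.of_bound (measurable_liquidate hη hφ).aestronglyMeasurable C
        (.of_forall (abs_liquidate_le hη hC))
    have h1 := hQ.integral_nonpos s (y := fun w => x - liquidate η φ w)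
      ((integrable_const x).sub hint) (by filter_upwards [hle] with w hw using by linarith)
    rw [integral_sub (integrable_const x) hint] at h1
    simpa using h1
  · by_contra! hlt
    -- A real `y` strictly inside the duality gap exceeds the largest coverable debt, so some
    -- pricing measure has stopping value at most `y`, below the supposed infimum.
    obtain ⟨y, hxy, hy⟩ := EReal.lt_iff_exists_real_btwn.1 hlt
    obtain ⟨Q, hQ, hQy⟩ := h.exists_isPricingMeasure hD'
      (fun hmem => (EReal.coe_lt_coe_iff.1 hxy).not_ge (hmax hmem))
    have h1 : optimalStopping 𝓕 Q φ ≤ (y : EReal) :=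
      optimalStopping_le fun η hη => hQy _ ⟨η, hη, rfl⟩
    exact (hy.trans_le (iInf₂_le Q hQ)).not_ge h1

theorem superHedging_duality {m : Market 𝓕 d L M N}
    {PN1 : Measure (Fin (N + 1) → Fin (T + 1))} [IsProbabilityMeasure PN1]
    (h : StrictNoArbitrage m p (Nat.le_add_right N 1) P PN1)
    {φ : Fin (T + 1) → Ω → ℝ} (hφ : Adapted 𝓕 φ) {C : ℝ} (hC : ∀ t ω, |φ t ω| ≤ C) :
    ∃ x : ℝ, superHedgingPrice m p P PN1 φ = (x : EReal) ∧
      (∃ s, SuperHedges m p P PN1 φ x s) ∧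
      (x : EReal) = ⨆ Q ∈ {Q | IsPricingMeasure m p (Nat.le_add_right N 1) P PN1 Q},
        ((∫ w, φ (w.2 (Fin.last N)) w.1 ∂Q : ℝ) : EReal) := by
  -- Super-hedging `φ` from `y` means covering the debt `-y` when the payoff `-φ` is added; the
  -- price is minus the largest coverable debt.
  let δ : Enlarged Ω T (N + 1) → ℝ := fun w => -φ (w.2 (Fin.last N)) w.1
  have hδm : Measurable[terminalSigma 𝓕 (N + 1)] δ := (measurable_exercised hφ (Fin.last N)).neg
  have hδC : ∀ w, |δ w| ≤ C := fun w => by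
    simp only [δ, abs_neg]
    exact hC _ _
  have hD' : IsOptionSet (refMeasure 𝓕 P PN1) {δ} := isOptionSet_singleton hδm hδC
  obtain ⟨x, hx, hmax⟩ := h.exists_isGreatest hD'
  have hset : ∀ y : ℝ, (∃ s, SuperHedges m p P PN1 φ y s) ↔
      -y ∈ coverable (refMeasure 𝓕 P PN1) (gains m (N + 1))
        (optionPayoffs m p (Nat.le_add_right N 1)) {δ} := by
    intro y
    rw [mem_coverable_iff]
    constructor
    · rintro ⟨s, hle⟩
      refine ⟨s, δ, rfl, ?_⟩
      filter_upwards [hle] with w hw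
      simp only [δ]
      linarith
    · rintro ⟨s, _, rfl, hle⟩
      refine ⟨s, ?_⟩
      filter_upwards [hle] with w hw
      simp only [δ] at hw
      linarith
  have hx' := (hset (-x)).2 (by simpa using hx)
  refine ⟨-x, le_antisymm ?_ ?_, hx', le_antisymm ?_ ?_⟩
  · exact iInf₂_le (f := fun (y : ℝ) (_ : y ∈ {y : ℝ | ∃ s, SuperHedges m p P PN1 φ y s}) =>
      (y : EReal)) (-x) hx'
  · refine le_iInf₂ fun y hy => EReal.coe_le_coe_iff.2 ?_
    have := hmax ((hset y).1 hy)
    linarith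
  · by_contra! hlt
    obtain ⟨y, hy, hyx⟩ := EReal.lt_iff_exists_real_btwn.1 hlt
    obtain ⟨Q, hQ, hQy⟩ := h.exists_isPricingMeasure hD' (y := -y)
      (fun hmem => by
        have h1 := hmax hmem
        have h2 := EReal.coe_lt_coe_iff.1 hyx
        linarith)
    have h1 := hQy δ rfl
    simp only [δ, integral_neg, neg_le_neg_iff] at h1
    have h2 := (le_iSup₂ (f := fun (Q : Measure[terminalSigma 𝓕 (N + 1)] (Enlarged Ω T (N + 1)))
      (_ : Q ∈ {Q | IsPricingMeasure m p (Nat.le_add_right N 1) P PN1 Q}) =>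
        ((∫ w, φ (w.2 (Fin.last N)) w.1 ∂Q : ℝ) : EReal)) Q hQ).trans_lt hy
    exact (EReal.coe_lt_coe_iff.1 h2).not_ge h1
  · refine iSup₂_le fun Q hQ => EReal.coe_le_coe_iff.2 ?_
    obtain ⟨s, hle⟩ := hx'
    have := (show IsPricingMeasure m p _ P PN1 Q from hQ).probability
    have hint : Integrable (fun w : Enlarged Ω T (N + 1) => φ (w.2 (Fin.last N)) w.1) Q :=
      Integrable.of_bound (measurable_exercised hφ (Fin.last N)).aestronglyMeasurable C
        (.of_forall fun w => hC _ _)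
    have h1 := IsPricingMeasure.integral_nonpos hQ s
      (y := fun w => φ (w.2 (Fin.last N)) w.1 - -x) (hint.sub (integrable_const _)) (by
        filter_upwards [hle] with w hw using by linarith)
    rw [integral_sub hint (integrable_const _)] at h1
    simp only [integral_const, probReal_univ, smul_eq_mul, one_mul] at h1
    linarith

end Pricing

end SemiStatic

end

theorem theorem2p4 {Ω : Type*} {mΩ : MeasurableSpace Ω} {T d L M N : ℕ}
    (P : Measure Ω) [IsProbabilityMeasure P] [IsSeparable P]
    (𝓕 : Filtration (Fin (T + 1)) mΩ)
    (m : Market 𝓕 d L M N) (p : Prices L M N)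
    (φ : Fin (T + 1) → Ω → ℝ) (hφ : Adapted 𝓕 φ) (hφb : ∃ C : ℝ, ∀ t ω, |φ t ω| ≤ C)
    (PN : Measure (Fin N → Fin (T + 1))) [IsProbabilityMeasure PN] (hPN : ∀ t, 0 < PN {t})
    (PN1 : Measure (Fin (N + 1) → Fin (T + 1))) [IsProbabilityMeasure PN1]
    (hPN1 : ∀ t, 0 < PN1 {t})
    (hSNA : StrictNoArbitrage m p le_rfl P PN) :
    StrictNoArbitrage m p (Nat.le_add_right N 1) P PN1 ∧
    subHedgingPrice m p P PN φ =
      ⨅ Q ∈ {Q | IsPricingMeasure m p le_rfl P PN Q}, optimalStopping 𝓕 Q φ ∧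
    superHedgingPrice m p P PN1 φ =
      ⨆ Q ∈ {Q | IsPricingMeasure m p (Nat.le_add_right N 1) P PN1 Q},
        ((∫ w, φ (w.2 (Fin.last N)) w.1 ∂Q : ℝ) : EReal) ∧
    (∃ x : ℝ, subHedgingPrice m p P PN φ = (x : EReal) ∧
      ∃ s η, SubHedges m p P PN φ x s η) ∧
    (∃ x : ℝ, superHedgingPrice m p P PN1 φ = (x : EReal) ∧
      ∃ s, SuperHedges m p P PN1 φ x s) := by
  obtain ⟨C, hC⟩ := hφb
  have hSNA' : StrictNoArbitrage m p (Nat.le_add_right N 1) P PN1 := by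
    obtain ⟨ε, hε, hNA⟩ := hSNA
    exact ⟨ε, hε, hNA.succ hPN hPN1⟩
  obtain ⟨x, hx, hxs, hxd⟩ := subHedging_duality hSNA hφ hC
  obtain ⟨y, hy, hys, hyd⟩ := superHedging_duality hSNA' hφ hC
  exact ⟨hSNA', hx.trans hxd, hy.trans hyd, ⟨x, hx, hxs⟩, ⟨y, hy, hys⟩⟩
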